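/- Let $T\in\mathbb N$, $p\in(1,\infty)$, $q:=p/(p-1)$, and let $X=(X_1,\dots,X_T)$ be the canonical process on $\mathbb R^T$, $\mathcal F^X_t:=\sigma(X_1,\dots,X_t)$ ($\mathcal F_0^X$ trivial). Let $\mathcal P_p(\mathbb R^T)$ be the set of Borel probability measures on $\mathbb R^T$ with finite $p$-th moment. For $P,Q\in\mathcal P_p(\mathbb R^T)$ a coupling $\pi$ of $P$ and $Q$ on $\mathbb R^T\times\mathbb R^T$, with coordinate processes $(X,Y)$, is causal if $\pi((Y_1,\dots,Y_t)\in A\mid X_1,\dots,X_T)=\pi((Y_1,\dots,Y_t)\in A\mid X_1,\dots,X_t)$ $\pi$-a.s. for all $1\le t\le T$ and all Borel $A\subseteq\mathbb R^t$, and bicausal if this also holds with the roles of $X$ and $Y$ exchanged. Put $$\mathcal{AW}_p(P,Q):=\inf_{\pi \text{ bicausal}}\Big(\sum_{t=1}^T E_\pi[|X_t-Y_t|^p]\Big)^{1/p},\qquad B_r(P):=\{Q\in\mathcal P_p(\mathbb R^T):\mathcal{AW}_p(P,Q)\le r\}.$$ Fix $L\ge 0$ and $X_0\in\mathbb R$.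 Let $\mathcal A$ be the set of controls $a=(a_t)_{t=1}^T$ where $a_t:\mathbb R^T\to[-L,L]$ is $\mathcal F^X_{t-1}$-measurable. Let $\ell:\mathbb R\to\mathbb R$ be bounded from below and twice continuously differentiable with $\ell''>0$ and $|\ell'(u)|\le c(1+|u|^{p-1})$ for all $u$ and some constant $c$, let $g:\mathbb R^T\to\mathbb R$ be continuously differentiable with bounded derivative, and let $$u(Q):=\inf_{a\in\mathcal A}E_Q\Big[\ell\Big(g(X)+\sum_{t=1}^T a_t(X)(X_t-X_{t-1})\Big)\Big],\qquad Q\in\mathcal P_p(\mathbb R^T).$$ Let $P\in\mathcal P_p(\mathbb R^T)$ with $P(X_t=X_{t-1})=0$ for $t=1,\dots,T$. Then all expectations in the definition of $u(Q)$, $Q\in\mathcal P_p(\mathbb R^T)$, are well defined and finite, $u$ is bounded above on $B_r(P)$ for every $r\ge0$, and there is an optimizer $a^*\in\mathcal A$ for $u(P)$. The random variable $Z:=g(X)+\sum_{t=1}^T a^*_t(X)(X_t-X_{t-1})$ is the same, up to $P$-null sets, for all optimizers $a^*$. For every optimizer $a^*$, with $a^*_{T+1}:=0$, the random variables $\ell'(Z)$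 and $\ell'(Z)\,\partial_{x_t}g(X)$ are $P$-integrable, $$V:=\Big(\sum_{t=1}^T E_P\Big[\Big|(a^*_{t+1}-a^*_t)\cdot E_P[\ell'(Z)\mid\mathcal F^X_t]-E_P[\ell'(Z)\,\partial_{x_t}g(X)\mid\mathcal F^X_t]\Big|^q\Big]\Big)^{1/q}$$ is finite, and $$\sup_{Q\in B_r(P)}u(Q)=u(P)+r\cdot V+o(r)\qquad\text{as } r\downarrow0.$$ (In particular $V$ does not depend on the choice of $a^*$.) -/

import Mathlib

open MeasureTheory Filter Topology Asymptotics
open scoped ENNReal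

noncomputable section

namespace AWSens

/-- The path space `ℝ^T`. The coordinate with index `i : Fin T` is the time `i + 1`. -/
abbrev Path (T : ℕ) : Type := Fin T → ℝ

/-- The canonical filtration: `canonFilt T n = σ(X_1, …, X_n)`, generated by the first `n`
coordinates; `canonFilt T 0` is trivial. -/
@[reducible] def canonFilt (T n : ℕ) : MeasurableSpace (Path T) :=
  ⨆ (s : Fin T) (_ : (s : ℕ) < n), MeasurableSpace.comap (fun x : Path T => x s) inferInstance

/-- Borel probability measures on `ℝ^T` with finite `p`-th moment. -/
def probMeasures (p : ℝ) (T : ℕ) : Set (Measure (Path T)) :=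
  {Q | IsProbabilityMeasure Q ∧ MemLp (fun x : Path T => x) (ENNReal.ofReal p) Q}

/-- `π` is a coupling of `P` and `Q`. -/
def IsCoupling {T : ℕ} (P Q : Measure (Path T)) (π : Measure (Path T × Path T)) : Prop :=
  π.map Prod.fst = P ∧ π.map Prod.snd = Q

/-- Causality of a law `π` of `(X, Y)`: almost surely
`π((Y_1, …, Y_n) ∈ A | X_1, …, X_T) = π((Y_1, …, Y_n) ∈ A | X_1, …, X_n)`. The events
`{(Y_1, …, Y_n) ∈ A}` with `A` Borel are the events `{Y ∈ B}` with `B ∈ σ(x_1, …, x_n)`. -/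
def IsCausal {T : ℕ} (π : Measure (Path T × Path T)) : Prop :=
  ∀ n : ℕ, 1 ≤ n → n ≤ T → ∀ B : Set (Path T), MeasurableSet[canonFilt T n] B →
    condExp (MeasurableSpace.comap (Prod.fst : Path T × Path T → Path T) (canonFilt T T)) π
        ((Prod.snd ⁻¹' B).indicator fun _ => (1 : ℝ))
      =ᵐ[π]
    condExp (MeasurableSpace.comap (Prod.fst : Path T × Path T → Path T) (canonFilt T n)) π
        ((Prod.snd ⁻¹' B).indicator fun _ => (1 : ℝ))

/-- Causality in both directions. -/
def IsBicausal {T : ℕ} (π : Measure (Path T × Path T)) : Prop :=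
  IsCausal π ∧ IsCausal (π.map Prod.swap)

/-- The adapted Wasserstein distance of order `p`. -/
def adaptedW {T : ℕ} (p : ℝ) (P Q : Measure (Path T)) : ℝ≥0∞ :=
  ⨅ (π : Measure (Path T × Path T)) (_ : IsCoupling P Q π ∧ IsBicausal π),
    (∑ t : Fin T, ∫⁻ z, ENNReal.ofReal (|z.1 t - z.2 t| ^ p) ∂π) ^ (1 / p)

/-- The closed ball of radius `r` around `P` for the adapted Wasserstein distance. -/
def adaptedBall {T : ℕ} (p : ℝ) (P : Measure (Path T)) (r : ℝ) : Set (Measure (Path T)) :=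
  {Q | Q ∈ probMeasures p T ∧ adaptedW p P Q ≤ ENNReal.ofReal r}

/-- Predictable controls bounded by `L`: the control for the time `t + 1` depends, measurably,
on the first `t` coordinates only. -/
def controls (T : ℕ) (L : ℝ) : Set (Path T → Fin T → ℝ) :=
  {a | ∀ t : Fin T, Measurable[canonFilt T (t : ℕ)] (fun x => a x t) ∧ ∀ x, |a x t| ≤ L}

/-- The value of the path one time step before `t`, where the path starts in `x₀`. -/
def prev {T : ℕ} (x₀ : ℝ) (x : Path T) (t : Fin T) : ℝ :=
  if (t : ℕ) = 0 then x₀ else x ⟨(t : ℕ) - 1, lt_of_le_of_lt (Nat.sub_le _ _) t.isLt⟩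

/-- The control one time step after `t`; it is `0` after the last time. -/
def nextControl {T : ℕ} (a : Path T → Fin T → ℝ) (x : Path T) (t : Fin T) : ℝ :=
  if h : (t : ℕ) + 1 < T then a x ⟨(t : ℕ) + 1, h⟩ else 0

/-- `Z = g(X) + ∑_t a_t(X) (X_t - X_{t-1})`. -/
def terminal {T : ℕ} (x₀ : ℝ) (g : Path T → ℝ) (a : Path T → Fin T → ℝ) (x : Path T) : ℝ :=
  g x + ∑ t : Fin T, a x t * (x t - prev x₀ x t)

/-- The expected loss `E_Q[ℓ(g(X) + ∑_t a_t(X) (X_t - X_{t-1}))]` of the control `a`. -/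
def expLoss {T : ℕ} (x₀ : ℝ) (l : ℝ → ℝ) (g : Path T → ℝ) (Q : Measure (Path T))
    (a : Path T → Fin T → ℝ) : ℝ :=
  ∫ x, l (terminal x₀ g a x) ∂Q

/-- The value `u(Q)` of the problem. -/
def value {T : ℕ} (L x₀ : ℝ) (l : ℝ → ℝ) (g : Path T → ℝ) (Q : Measure (Path T)) : ℝ :=
  sInf (expLoss x₀ l g Q '' controls T L)

/-- `a` is an optimizer for `u(Q)`. -/
def IsOptimizer {T : ℕ} (L x₀ : ℝ) (l : ℝ → ℝ) (g : Path T → ℝ) (Q : Measure (Path T))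
    (a : Path T → Fin T → ℝ) : Prop :=
  a ∈ controls T L ∧ expLoss x₀ l g Q a = value L x₀ l g Q

/-- The partial derivative of `g` in the coordinate `t`. -/
def partialDeriv {T : ℕ} (g : Path T → ℝ) (t : Fin T) (x : Path T) : ℝ :=
  fderiv ℝ g x (Pi.single t 1)

/-- `(a_{t+1} - a_t) E_P[ℓ'(Z) | F_t] - E_P[ℓ'(Z) ∂_{x_t} g(X) | F_t]`. -/
def sensTerm {T : ℕ} (x₀ : ℝ) (l : ℝ → ℝ) (g : Path T → ℝ) (P : Measure (Path T))
    (a : Path T → Fin T → ℝ) (t : Fin T) (x : Path T) : ℝ :=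
  (nextControl a x t - a x t)
      * condExp (canonFilt T ((t : ℕ) + 1)) P (fun y => deriv l (terminal x₀ g a y)) x
    - condExp (canonFilt T ((t : ℕ) + 1)) P
        (fun y => deriv l (terminal x₀ g a y) * partialDeriv g t y) x

/-- The first-order coefficient `V`, with `q = p / (p - 1)`. -/
def sensitivity {T : ℕ} (p x₀ : ℝ) (l : ℝ → ℝ) (g : Path T → ℝ) (P : Measure (Path T))
    (a : Path T → Fin T → ℝ) : ℝ :=
  (∑ t : Fin T, ∫ x, |sensTerm x₀ l g P a t x| ^ (p / (p - 1)) ∂P) ^ (1 / (p / (p - 1)))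

end AWSens

end

/-!
For a control `a` and a coupling `π` of `P` and `Q` of cost `r`, the loss of `a(X)` along the path `Y`
differs from its loss along `X` by `E_π[pathDeriv (Y - X)]` up to `o(r)`, uniformly in `a`
(`Regular.abs_integral_remainder_le`). Summation by parts writes the derivative as
`∑_t w_t (Y_t - X_t)` with `w_t = l'(Z) (∂_t g + a_t - a_{t+1})`, and the projection of `w_t` on
`F_t` is, up to the sign, the integrand of `V` (`Regular.condExp_controlGrad`).

*Upper bound.* Take an optimizer `a` for `P` and a bicausal coupling. Causality from `Y` to `X` makes
the projection of `a(X)` on the past of `Y` a control for `Q`, which is at least as good by convexity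
(`exists_projected_control`, `value_le_integral_coupling`). Causality from `X` to `Y` allows replacing
`w_t` by its projection on `F_t`, and Hölder's inequality bounds the first-order term by `r V`
(`integral_pathDeriv_le`, `exists_value_le`).

*Lower bound.* The extremal direction in Hölder's inequality is adapted; it is approximated by a
bounded Lipschitz adapted direction `f` (`exists_direction`). For small `r` the shift
`x ↦ x + r f(x)` is injective and determines the past from the past, so the graph coupling of `P` and
the shifted measure is bicausal (`isBicausal_shift`) and the controls for the shifted measure are
controls for `P`. It remains to see that no control that is nearly optimal for `P` has a much smaller
derivative in the direction `f` than an optimizer (`exists_le_dirDeriv`). By strict convexity the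
marginal losses `l'(Z)` of near-optimizers converge in `L¹` to that of an optimizer
(`Regular.exists_integral_abs_deriv_sub_le`), and once `l'(Z)` is fixed the derivative is affine in
the control. Near-optimizers with a derivative that is too small would thus form convex sets and
accumulate almost surely at an optimizer with the same defect (`exists_optimizer_of_near`), while all
optimizers have the same derivative.

*Independence of the optimizer.* Only the terminal position is unique. Two optimizers `a` and `b` may
differ in the period `t`, but the first-order condition and `P(X_t = X_{t-1}) = 0` force
`E[l'(Z) | F_{t-1}]` and `E[l'(Z) | F_t]` to vanish where they do (`condExp_deriv_mul_diff`,
`condExp_succ_deriv_mul_diff`). Hence `(a_{t+1} - a_t) E[l'(Z) | F_t] = (b_{t+1} - b_t) E[l'(Z) | F_t]`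
(`condExp_deriv_mul_change_eq`).
-/

noncomputable section

namespace AWSens

variable {T : ℕ} {p L x₀ : ℝ} {l : ℝ → ℝ} {g : Path T → ℝ}

/-! ### The terminal position and its derivative in the path -/

/-- The standing assumptions on the exponent, the bound on the controls, the loss `l` and the
payoff `g`. -/
structure Regular (p L : ℝ) (l : ℝ → ℝ) (g : Path T → ℝ) : Prop where
  one_lt : 1 < p
  nonneg : 0 ≤ L
  loss : ContDiff ℝ 2 l
  bddBelow : BddBelow (Set.range l)
  deriv2_pos : ∀ u, 0 < deriv (deriv l) u
  growth : ∃ c : ℝ, ∀ u, |deriv l u| ≤ c * (1 + |u| ^ (p - 1))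
  payoff : ContDiff ℝ 1 g
  fderiv_bdd : ∃ K : ℝ, ∀ x, ‖fderiv ℝ g x‖ ≤ K

/-- The terminal position `g(x) + ∑_t α_t (x_t - x_{t-1})` of a constant control `α`. In contrast to
`terminal`, the path and the value of the control along the path can vary separately. -/
def wealth (x₀ : ℝ) (g : Path T → ℝ) (α x : Path T) : ℝ :=
  g x + ∑ t : Fin T, α t * (x t - prev x₀ x t)

/-- The derivative of `x ↦ l (wealth x₀ g α x)` at `x` in the direction `d`, see
`hasDerivAt_loss_wealth`. -/
def pathDeriv (x₀ : ℝ) (l : ℝ → ℝ) (g : Path T → ℝ) (α x d : Path T) : ℝ :=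
  deriv l (wealth x₀ g α x) * (fderiv ℝ g x d + ∑ t : Fin T, α t * (d t - prev 0 d t))

lemma terminal_eq_wealth (a : Path T → Fin T → ℝ) (x : Path T) :
    terminal x₀ g a x = wealth x₀ g (a x) x := rfl

lemma prev_add (x d : Path T) (t : Fin T) : prev x₀ (x + d) t = prev x₀ x t + prev 0 d t := by
  unfold prev; split_ifs <;> simp

lemma prev_smul (s : ℝ) (d : Path T) (t : Fin T) : prev 0 (s • d) t = s * prev 0 d t := by
  unfold prev; split_ifs <;> simp

lemma abs_prev_le (x : Path T) (t : Fin T) : |prev x₀ x t| ≤ |x₀| + ‖x‖ := by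
  unfold prev
  split_ifs
  · linarith [norm_nonneg x]
  · exact (norm_le_pi_norm x _).trans (by linarith [abs_nonneg x₀])

lemma continuous_prev (t : Fin T) : Continuous (fun x : Path T => prev x₀ x t) := by
  unfold prev; split_ifs <;> fun_prop

lemma sum_mul_prev (α d : Path T) :
    ∑ t, α t * prev 0 d t = ∑ t, nextControl (fun _ : Path T => α) d t * d t := by
  rcases T with _ | n
  · simp
  · rw [Fin.sum_univ_succ, Fin.sum_univ_castSucc]
    simp [prev, nextControl]
    rfl

/-- Summation by parts turns the increments of the direction `d` into its coordinates. -/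
lemma pathDeriv_eq_sum (α x d : Path T) :
    pathDeriv x₀ l g α x d = ∑ t : Fin T, deriv l (wealth x₀ g α x) *
      (partialDeriv g t x + α t - nextControl (fun _ : Path T => α) d t) * d t := by
  have h1 : fderiv ℝ g x d = ∑ t, partialDeriv g t x * d t := by
    have := LinearMap.pi_apply_eq_sum_univ (fderiv ℝ g x).toLinearMap d
    rw [ContinuousLinearMap.coe_coe] at this
    rw [this]
    refine Finset.sum_congr rfl fun t _ => ?_
    rw [smul_eq_mul, mul_comm, partialDeriv]
    congr 2; ext j; simp [Pi.single_apply, eq_comm]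
  have h2 := sum_mul_prev α d
  rw [pathDeriv, h1]
  simp only [mul_sub, Finset.sum_sub_distrib, h2]
  simp only [add_mul, sub_mul, mul_add, mul_sub, Finset.sum_add_distrib, Finset.sum_sub_distrib,
    mul_assoc, Finset.mul_sum]
  ring

lemma wealth_add (α x d : Path T) : wealth x₀ g α (x + d) =
    g (x + d) + ∑ t, α t * (x t - prev x₀ x t) + ∑ t, α t * (d t - prev 0 d t) := by
  simp only [wealth, prev_add, Pi.add_apply, add_assoc, ← Finset.sum_add_distrib]
  congr 1; refine Finset.sum_congr rfl fun t _ => ?_; ring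

lemma wealth_sub_wealth (α β x : Path T) : wealth x₀ g α x - wealth x₀ g β x =
    ∑ t, (α t - β t) * (x t - prev x₀ x t) := by
  simp only [wealth, sub_mul, Finset.sum_sub_distrib]; ring

lemma wealth_combo (s : ℝ) (α β x : Path T) : wealth x₀ g (fun t => (1 - s) * α t + s * β t) x =
    (1 - s) * wealth x₀ g α x + s * wealth x₀ g β x := by
  simp only [wealth, add_mul, Finset.sum_add_distrib, mul_assoc, ← Finset.mul_sum]; ring

lemma Regular.loss_diff (h : Regular p L l g) : Differentiable ℝ l :=
  h.loss.differentiable (by norm_num)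

lemma Regular.cont_deriv (h : Regular p L l g) : Continuous (deriv l) :=
  h.loss.continuous_deriv (by norm_num)

lemma Regular.cont_payoff (h : Regular p L l g) : Continuous g := h.payoff.continuous

lemma Regular.cont_fderiv (h : Regular p L l g) : Continuous (fderiv ℝ g) :=
  h.payoff.continuous_fderiv (by norm_num)

lemma Regular.strictConvexOn (h : Regular p L l g) : StrictConvexOn ℝ Set.univ l := by
  refine strictConvexOn_of_deriv2_pos convex_univ h.loss.continuous.continuousOn ?_
  intro x _; exact h.deriv2_pos x

/-- The graph of the convex function `l` lies above its tangents. -/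
lemma Regular.tangent_le (h : Regular p L l g) (u v : ℝ) : l u + deriv l u * (v - u) ≤ l v := by
  have hc := h.strictConvexOn.convexOn
  rcases lt_trichotomy u v with huv | rfl | huv
  · have := hc.le_slope_of_hasDerivAt (Set.mem_univ u) (Set.mem_univ v) huv
      (h.loss_diff u).hasDerivAt
    rw [slope_def_field, le_div_iff₀ (by linarith)] at this
    linarith
  · simp
  · have := hc.slope_le_of_hasDerivAt (Set.mem_univ v) (Set.mem_univ u) huv
      (h.loss_diff u).hasDerivAt
    rw [slope_def_field, div_le_iff₀ (by linarith)] at this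
    linarith

lemma continuous_wealth (hg : Continuous g) :
    Continuous (fun z : Path T × Path T => wealth x₀ g z.1 z.2) := by
  unfold wealth
  have := fun t : Fin T => continuous_prev (x₀ := x₀) t
  fun_prop

lemma hasDerivAt_loss_wealth (h : Regular p L l g) (α x d : Path T) (s : ℝ) :
    HasDerivAt (fun s : ℝ => l (wealth x₀ g α (x + s • d)))
      (pathDeriv x₀ l g α (x + s • d) d) s := by
  have h1 : HasDerivAt (fun s : ℝ => wealth x₀ g α (x + s • d))
      (fderiv ℝ g (x + s • d) d + ∑ t : Fin T, α t * (d t - prev 0 d t)) s := by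
    have e : (fun s : ℝ => wealth x₀ g α (x + s • d)) = fun s => g (x + s • d) +
        ∑ t, α t * (x t - prev x₀ x t) + s * ∑ t, α t * (d t - prev 0 d t) := by
      funext s
      rw [wealth_add]
      simp only [prev_smul, Pi.smul_apply, smul_eq_mul, Finset.mul_sum]
      congr 1; refine Finset.sum_congr rfl fun t _ => ?_; ring
    rw [e]
    have hd : HasDerivAt (fun s : ℝ => x + s • d) d s := by
      simpa using ((hasDerivAt_id s).smul_const d).const_add x
    have hg := ((h.payoff.differentiable (by norm_num) (x + s • d)).hasFDerivAt).comp_hasDerivAt s hd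
    have := (hg.add_const (∑ t, α t * (x t - prev x₀ x t))).add
      ((hasDerivAt_id s).mul_const (∑ t, α t * (d t - prev 0 d t)))
    rw [one_mul] at this
    exact this
  exact ((h.loss_diff _).hasDerivAt).comp s h1

/-- Growth bounds that are uniform in the bounded controls. -/
lemma Regular.exists_growth (h : Regular p L l g) (x₀ : ℝ) : ∃ C : ℝ, 1 ≤ C ∧
    ∀ α x : Path T, (∀ t, |α t| ≤ L) →
      |wealth x₀ g α x| ≤ C * (1 + ‖x‖) ∧ |deriv l (wealth x₀ g α x)| ≤ C * (1 + ‖x‖) ^ (p - 1) ∧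
      |l (wealth x₀ g α x)| ≤ C * (1 + ‖x‖) ^ p ∧
      (∀ d : Path T, |fderiv ℝ g x d + ∑ t : Fin T, α t * (d t - prev 0 d t)| ≤ C * ‖d‖) := by
  obtain ⟨c, hc⟩ := h.growth
  obtain ⟨K, hK⟩ := h.fderiv_bdd
  have hp := h.one_lt
  have hL := h.nonneg
  have hK0 : 0 ≤ K := (norm_nonneg _).trans (hK 0)
  have hc0 : 0 ≤ c := by
    have := (abs_nonneg _).trans (hc 0)
    rw [abs_zero, Real.zero_rpow (by linarith)] at this; linarith
  have hl' : ∀ u, |deriv l u| ≤ 2 * c * (1 + |u|) ^ (p - 1) := fun u => by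
    have h1 : (1 : ℝ) ≤ (1 + |u|) ^ (p - 1) :=
      Real.one_le_rpow (by linarith [abs_nonneg u]) (by linarith)
    have h2 : |u| ^ (p - 1) ≤ (1 + |u|) ^ (p - 1) :=
      Real.rpow_le_rpow (abs_nonneg u) (by linarith [abs_nonneg u]) (by linarith)
    nlinarith [hc u]
  have hl : ∀ u, |l u| ≤ (|l 0| + 2 * c) * (1 + |u|) ^ p := fun u => by
    have h1 : ‖l u - l 0‖ ≤ 2 * c * (1 + |u|) ^ (p - 1) * ‖u - 0‖ := by
      refine (convex_closedBall (0 : ℝ) |u|).norm_image_sub_le_of_norm_deriv_le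
        (fun v _ => h.loss_diff v) (fun v hv => ?_) (by simp) (by simp)
      refine (hl' v).trans ?_
      have : |v| ≤ |u| := by simpa using hv
      have := abs_nonneg v
      gcongr
    have h2 : |u| ≤ 1 + |u| := by linarith
    have h3 : (1 + |u|) ^ p = (1 + |u|) ^ (p - 1) * (1 + |u|) := by
      rw [Real.rpow_sub_one (by positivity)]; field_simp
    have h4 : 1 ≤ (1 + |u|) ^ p := Real.one_le_rpow (by linarith [abs_nonneg u]) (by linarith)
    have h5 : |l u| ≤ |l 0| + |l u - l 0| := by
      have := abs_add_le (l 0) (l u - l 0); simpa using this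
    rw [sub_zero, Real.norm_eq_abs, Real.norm_eq_abs, mul_assoc] at h1
    have h6 : (1 + |u|) ^ (p - 1) * |u| ≤ (1 + |u|) ^ p := by rw [h3]; gcongr
    nlinarith [abs_nonneg (l 0)]
  set A : ℝ := 1 + |g 0| + K + T * (L * (2 + |x₀|)) with hA
  have hA1 : 1 ≤ A := by
    rw [hA]
    have := abs_nonneg (g 0)
    have : 0 ≤ T * (L * (2 + |x₀|)) := by positivity
    linarith
  have hw : ∀ α x : Path T, (∀ t, |α t| ≤ L) → |wealth x₀ g α x| ≤ A * (1 + ‖x‖) := by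
    intro α x hα
    have h1 : |g x| ≤ |g 0| + K * ‖x‖ := by
      have := (convex_univ (𝕜 := ℝ) (E := Path T)).norm_image_sub_le_of_norm_fderiv_le
        (fun y _ => h.payoff.differentiable (by norm_num) y) (fun y _ => hK y)
        (Set.mem_univ 0) (Set.mem_univ x)
      rw [sub_zero, Real.norm_eq_abs] at this
      have h5 := abs_add_le (g 0) (g x - g 0)
      rw [add_sub_cancel] at h5; linarith
    have h2 : |∑ t, α t * (x t - prev x₀ x t)| ≤ ∑ t : Fin T, L * ((2 + |x₀|) * (1 + ‖x‖)) := by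
      refine (Finset.abs_sum_le_sum_abs _ _).trans (Finset.sum_le_sum fun t _ => ?_)
      rw [abs_mul]
      have h3 := abs_prev_le (x₀ := x₀) x t
      have h4 : |x t| ≤ ‖x‖ := norm_le_pi_norm x t
      have h5 := abs_sub (x t) (prev x₀ x t)
      refine mul_le_mul (hα t) ?_ (abs_nonneg _) hL
      nlinarith [abs_nonneg x₀, norm_nonneg x]
    rw [Finset.sum_const, Finset.card_univ, Fintype.card_fin, nsmul_eq_mul] at h2
    have h6 := abs_add_le (g x) (∑ t, α t * (x t - prev x₀ x t))
    rw [wealth]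
    refine h6.trans ?_
    have : A * (1 + ‖x‖) = (1 + |g 0| + K) * (1 + ‖x‖) + T * (L * ((2 + |x₀|) * (1 + ‖x‖))) := by
      rw [hA]; ring
    rw [this]
    nlinarith [abs_nonneg (g 0), norm_nonneg x]
  have hT : (0 : ℝ) ≤ T * (L * (2 + |x₀|)) := by positivity
  have hl0 := abs_nonneg (l 0)
  -- the bounds along `wealth` follow from those for `l` and `deriv l` because its values `u`
  -- satisfy `1 + |u| ≤ 2 A (1 + ‖x‖)`
  set C : ℝ := A + 2 * c + (|l 0| + 2 * c + 1) * (2 * A) ^ p + 2 * c * (2 * A) ^ (p - 1) with hC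
  have e1 : (0 : ℝ) ≤ (2 * A) ^ p := by positivity
  have e2 : (0 : ℝ) ≤ (2 * A) ^ (p - 1) := by positivity
  have e3 : 0 ≤ (|l 0| + 2 * c + 1) * (2 * A) ^ p := by positivity
  have e4 : 0 ≤ 2 * c * (2 * A) ^ (p - 1) := by positivity
  have hKA : K ≤ A := by rw [hA]; linarith [abs_nonneg (g 0)]
  refine ⟨C, by linarith, fun α x hα => ⟨(hw α x hα).trans ?_, ?_, ?_, ?_⟩⟩
  · gcongr; linarith
  · have h1 : 1 + |wealth x₀ g α x| ≤ (2 * A) * (1 + ‖x‖) := by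
      nlinarith [hw α x hα, norm_nonneg x]
    refine (hl' _).trans ((mul_le_mul_of_nonneg_left (Real.rpow_le_rpow (by positivity) h1
      (by linarith)) (by positivity)).trans ?_)
    rw [Real.mul_rpow (by positivity) (by positivity), ← mul_assoc]
    gcongr; linarith
  · have h1 : 1 + |wealth x₀ g α x| ≤ (2 * A) * (1 + ‖x‖) := by
      nlinarith [hw α x hα, norm_nonneg x]
    refine (hl _).trans ((mul_le_mul_of_nonneg_left (Real.rpow_le_rpow (by positivity) h1
      (by linarith)) (by positivity)).trans ?_)
    rw [Real.mul_rpow (by positivity) (by positivity), ← mul_assoc]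
    gcongr; nlinarith
  · intro d
    have h1 : |fderiv ℝ g x d| ≤ K * ‖d‖ := ((fderiv ℝ g x).le_opNorm d).trans (by gcongr; exact hK x)
    have h2 : |∑ t, α t * (d t - prev 0 d t)| ≤ ∑ t : Fin T, L * ((2 + |x₀|) * ‖d‖) := by
      refine (Finset.abs_sum_le_sum_abs _ _).trans (Finset.sum_le_sum fun t _ => ?_)
      rw [abs_mul]
      have h3 := abs_prev_le (x₀ := 0) d t
      have h4 : |d t| ≤ ‖d‖ := norm_le_pi_norm d t
      have h5 := abs_sub (d t) (prev 0 d t)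
      refine mul_le_mul (hα t) ?_ (abs_nonneg _) hL
      rw [abs_zero] at h3
      nlinarith [abs_nonneg x₀, norm_nonneg d]
    rw [Finset.sum_const, Finset.card_univ, Fintype.card_fin, nsmul_eq_mul] at h2
    refine (abs_add_le _ _).trans ?_
    have : (K + T * (L * (2 + |x₀|))) * ‖d‖ ≤ C * ‖d‖ := by
      gcongr; rw [hC, hA]; rw [hA] at e3 e4; linarith [abs_nonneg (g 0)]
    nlinarith

/-! ### First-order expansion of the loss, uniformly in the controls and the couplings -/

/-- The coordinates of `pathDeriv`, see `pathDeriv_eq_sum_pathGrad`. -/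
def pathGrad (x₀ : ℝ) (l : ℝ → ℝ) (g : Path T → ℝ) (α x : Path T) (t : Fin T) : ℝ :=
  deriv l (wealth x₀ g α x) * (partialDeriv g t x + α t - nextControl (fun _ : Path T => α) x t)

lemma pathDeriv_eq_sum_pathGrad (α x d : Path T) :
    pathDeriv x₀ l g α x d = ∑ t : Fin T, pathGrad x₀ l g α x t * d t :=
  pathDeriv_eq_sum α x d

lemma continuous_pathGrad (h : Regular p L l g) :
    Continuous (fun z : Path T × Path T => pathGrad x₀ l g z.1 z.2) := by
  refine continuous_pi fun t => ?_
  unfold pathGrad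
  have h1 := h.cont_deriv.comp (continuous_wealth (x₀ := x₀) h.cont_payoff)
  have h2 : Continuous fun z : Path T × Path T => partialDeriv g t z.2 := by
    unfold partialDeriv
    exact (h.cont_fderiv.comp continuous_snd).clm_apply continuous_const
  have h3 : Continuous fun z : Path T × Path T => nextControl (fun _ : Path T => z.1) z.2 t := by
    unfold nextControl; split_ifs <;> fun_prop
  exact h1.mul ((h2.add ((continuous_apply t).comp continuous_fst)).sub h3)

lemma continuous_loss_wealth (h : Regular p L l g) :
    Continuous (fun z : Path T × Path T => l (wealth x₀ g z.1 z.2)) :=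
  h.loss.continuous.comp (continuous_wealth h.cont_payoff)

lemma exists_pathDeriv_eq (h : Regular p L l g) (α x d : Path T) : ∃ s ∈ Set.Ioo (0 : ℝ) 1,
    l (wealth x₀ g α (x + d)) - l (wealth x₀ g α x) = pathDeriv x₀ l g α (x + s • d) d := by
  obtain ⟨s, hs, he⟩ := exists_hasDerivAt_eq_slope
    (fun s : ℝ => l (wealth x₀ g α (x + s • d))) (fun s => pathDeriv x₀ l g α (x + s • d) d)
    one_pos (fun s _ => (hasDerivAt_loss_wealth h α x d s).continuousAt.continuousWithinAt)
    (fun s _ => hasDerivAt_loss_wealth h α x d s)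
  exact ⟨s, hs, by simpa using he.symm⟩

/-- The remainder of the first-order expansion of `x ↦ l (wealth x₀ g α x)`. -/
def remainder (x₀ : ℝ) (l : ℝ → ℝ) (g : Path T → ℝ) (α x d : Path T) : ℝ :=
  l (wealth x₀ g α (x + d)) - l (wealth x₀ g α x) - pathDeriv x₀ l g α x d

lemma Regular.abs_pathDeriv_le (h : Regular p L l g) (x₀ : ℝ) : ∃ C : ℝ, 0 ≤ C ∧
    ∀ α x d : Path T, (∀ t, |α t| ≤ L) →
      |pathDeriv x₀ l g α x d| ≤ C * (1 + ‖x‖) ^ (p - 1) * ‖d‖ := by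
  obtain ⟨C, hC1, hC⟩ := h.exists_growth x₀
  refine ⟨C * C, by positivity, fun α x d hα => ?_⟩
  obtain ⟨-, h2, -, h5⟩ := hC α x hα
  rw [pathDeriv, abs_mul]
  calc _ ≤ (C * (1 + ‖x‖) ^ (p - 1)) * (C * ‖d‖) := by gcongr; exact h5 d
    _ = _ := by ring

lemma Regular.abs_remainder_le (h : Regular p L l g) (x₀ : ℝ) : ∃ C : ℝ, 0 < C ∧
    ∀ α x d : Path T, (∀ t, |α t| ≤ L) →
      |remainder x₀ l g α x d| ≤ C * (1 + ‖x‖ + ‖d‖) ^ (p - 1) * ‖d‖ := by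
  obtain ⟨C, hC0, hC⟩ := h.abs_pathDeriv_le x₀
  have hp := h.one_lt
  refine ⟨C + C + 1, by positivity, fun α x d hα => ?_⟩
  obtain ⟨s, hs, he⟩ := exists_pathDeriv_eq (x₀ := x₀) h α x d
  rw [remainder, he]
  have h1 : ‖x + s • d‖ ≤ ‖x‖ + ‖d‖ := by
    refine (norm_add_le _ _).trans ?_
    rw [norm_smul, Real.norm_eq_abs, abs_of_pos hs.1]
    nlinarith [norm_nonneg d, hs.2]
  have h2 : |pathDeriv x₀ l g α (x + s • d) d| ≤ C * (1 + ‖x‖ + ‖d‖) ^ (p - 1) * ‖d‖ := by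
    refine (hC α _ d hα).trans ?_
    gcongr ?_ * ?_ ^ _ * ?_
    linarith
  have h3 : |pathDeriv x₀ l g α x d| ≤ C * (1 + ‖x‖ + ‖d‖) ^ (p - 1) * ‖d‖ := by
    refine (hC α _ d hα).trans ?_
    gcongr ?_ * ?_ ^ _ * ?_
    linarith [norm_nonneg d]
  have h4 : 0 ≤ (1 + ‖x‖ + ‖d‖) ^ (p - 1) * ‖d‖ := by positivity
  have := abs_sub (pathDeriv x₀ l g α (x + s • d) d) (pathDeriv x₀ l g α x d)
  nlinarith

lemma Regular.abs_remainder_le_of_small (h : Regular p L l g) (x₀ R : ℝ) {ε : ℝ} (hε : 0 < ε) :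
    ∃ δ : ℝ, 0 < δ ∧ ∀ α x d : Path T, (∀ t, |α t| ≤ L) → ‖x‖ ≤ R → ‖d‖ ≤ δ →
      |remainder x₀ l g α x d| ≤ ε * ‖d‖ := by
  have hK : IsCompact (Metric.closedBall (0 : Path T) L ×ˢ Metric.closedBall (0 : Path T) (R + 1)) :=
    (isCompact_closedBall _ _).prod (isCompact_closedBall _ _)
  have huc := hK.uniformContinuousOn_of_continuous
    (continuous_pathGrad (x₀ := x₀) h).continuousOn
  obtain ⟨δ, hδ, hu⟩ := Metric.uniformContinuousOn_iff.1 huc (ε / (T + 1)) (by positivity)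
  refine ⟨min 1 (δ / 2), by positivity, fun α x d hα hx hd => ?_⟩
  obtain ⟨s, hs, he⟩ := exists_pathDeriv_eq (x₀ := x₀) h α x d
  rw [remainder, he, pathDeriv_eq_sum_pathGrad, pathDeriv_eq_sum_pathGrad,
    ← Finset.sum_sub_distrib]
  have hsd : ‖s • d‖ ≤ ‖d‖ := by
    rw [norm_smul, Real.norm_eq_abs, abs_of_pos hs.1]
    nlinarith [norm_nonneg d, hs.2]
  have hαL : ‖α‖ ≤ L := (pi_norm_le_iff_of_nonneg h.nonneg).2 hα
  have hclose : dist (pathGrad x₀ l g α (x + s • d)) (pathGrad x₀ l g α x) < ε / (T + 1) := by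
    refine hu (α, x + s • d) ⟨by simpa using hαL, ?_⟩ (α, x) ⟨by simpa using hαL, ?_⟩ ?_
    · have := norm_add_le x (s • d)
      have := min_le_left 1 (δ / 2)
      simp only [mem_closedBall_zero_iff]; linarith
    · simp only [mem_closedBall_zero_iff]; linarith
    · have := min_le_right 1 (δ / 2)
      rw [Prod.dist_eq, dist_self, dist_eq_norm, add_sub_cancel_left]
      exact max_lt hδ (by linarith)
  have hbd : ∀ t ∈ Finset.univ, |pathGrad x₀ l g α (x + s • d) t * d t -
      pathGrad x₀ l g α x t * d t| ≤ ε / (T + 1) * ‖d‖ := fun t _ => by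
    rw [← sub_mul, abs_mul]
    refine mul_le_mul ?_ (norm_le_pi_norm d t) (abs_nonneg _) (by positivity)
    exact (dist_le_pi_dist _ _ t).trans hclose.le
  refine (Finset.abs_sum_le_sum_abs _ _).trans ((Finset.sum_le_sum hbd).trans ?_)
  rw [Finset.sum_const, Finset.card_univ, Fintype.card_fin, nsmul_eq_mul, ← mul_assoc]
  gcongr
  rw [mul_div_assoc', div_le_iff₀ (by positivity)]
  nlinarith

/-- The three terms of this bound are, after integration and for a suitable choice of `R`, of order
`ε r`, `ε r` and `r ^ p`, provided that the `p`-th moment of `d` is at most `r ^ p`. -/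
lemma Regular.abs_remainder_le_young (h : Regular p L l g) (x₀ : ℝ) {ε : ℝ} (hε : 0 < ε) :
    ∃ K₁ : ℝ, 0 ≤ K₁ ∧ ∀ R : ℝ, ∃ K₂ : ℝ, 0 ≤ K₂ ∧ ∀ r : ℝ, 0 < r → ∀ α x d : Path T,
      (∀ t, |α t| ≤ L) → |remainder x₀ l g α x d| ≤ ε * (r * (1 + (‖d‖ / r) ^ p)) +
        K₁ * r * {x : Path T | R < ‖x‖}.indicator (fun x => (1 + ‖x‖) ^ p) x + K₂ * ‖d‖ ^ p := by
  obtain ⟨C, hC0, hC⟩ := h.abs_remainder_le x₀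
  have hp := h.one_lt
  set C' : ℝ := C * 2 ^ (p - 1) with hC'
  have hC'0 : 0 < C' := by positivity
  set η : ℝ := (ε / C') ^ (p - 1)⁻¹ with hη
  have hη0 : 0 < η := by positivity
  have hηp : C' * η ^ (p - 1) = ε := by
    rw [hη, Real.rpow_inv_rpow (by positivity) (by linarith)]; field_simp
  refine ⟨C' / η, by positivity, fun R => ?_⟩
  obtain ⟨δ, hδ, hδr⟩ := h.abs_remainder_le_of_small x₀ R hε
  refine ⟨C' + C * ((1 + |R|) / δ + 1) ^ (p - 1), by positivity, fun r hr α x d hα => ?_⟩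
  have hpow : ∀ b : ℝ, 0 ≤ b → b ^ (p - 1) * b = b ^ p := fun b hb => by
    rcases hb.eq_or_lt with rfl | hb
    · rw [mul_zero, Real.zero_rpow (by linarith)]
    · rw [Real.rpow_sub_one hb.ne']; field_simp
  have hD : 0 ≤ ‖d‖ ^ p := by positivity
  have hS : 0 ≤ (‖d‖ / r) ^ p := by positivity
  have hE : 0 ≤ C * ((1 + |R|) / δ + 1) ^ (p - 1) := by positivity
  by_cases hx : R < ‖x‖
  · rw [Set.indicator_of_mem (by exact hx)]
    set b := 1 + ‖x‖ with hb
    have hb0 : 0 < b := by positivity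
    have h1 : (b + ‖d‖) ^ (p - 1) ≤ 2 ^ (p - 1) * (b ^ (p - 1) + ‖d‖ ^ (p - 1)) := by
      have : b + ‖d‖ ≤ 2 * max b ‖d‖ := by
        linarith [le_max_left b ‖d‖, le_max_right b ‖d‖]
      refine (Real.rpow_le_rpow (by positivity) this (by linarith)).trans ?_
      rw [Real.mul_rpow (by positivity) (by positivity)]
      gcongr
      rcases max_cases b ‖d‖ with ⟨e, -⟩ | ⟨e, -⟩ <;> rw [e]
      · linarith [show 0 ≤ ‖d‖ ^ (p - 1) by positivity]
      · linarith [show 0 ≤ b ^ (p - 1) by positivity]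
    -- Young's inequality with the weight `η`
    have h2 : b ^ (p - 1) * (‖d‖ / r) ≤ η ^ (p - 1) * (‖d‖ / r) ^ p + b ^ p / η := by
      have hs0 : 0 ≤ ‖d‖ / r := by positivity
      rcases le_total (‖d‖ / r) (b / η) with hs | hs
      · have : b ^ (p - 1) * (‖d‖ / r) ≤ b ^ (p - 1) * (b / η) := by gcongr
        rw [show b ^ (p - 1) * (b / η) = b ^ p / η by rw [← hpow b hb0.le]; ring] at this
        linarith [show 0 ≤ η ^ (p - 1) * (‖d‖ / r) ^ p by positivity]
      · have h3 : b ≤ η * (‖d‖ / r) := by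
          rw [div_le_iff₀ hη0] at hs; linarith
        have : b ^ (p - 1) * (‖d‖ / r) ≤ (η * (‖d‖ / r)) ^ (p - 1) * (‖d‖ / r) := by
          gcongr
        rw [Real.mul_rpow hη0.le hs0, mul_assoc, hpow _ hs0] at this
        linarith [show 0 ≤ b ^ p / η by positivity]
    have h4 : b ^ (p - 1) * ‖d‖ ≤ r * (η ^ (p - 1) * (‖d‖ / r) ^ p + b ^ p / η) := by
      have := mul_le_mul_of_nonneg_left h2 hr.le
      calc _ = r * (b ^ (p - 1) * (‖d‖ / r)) := by field_simp
        _ ≤ _ := this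
    calc |remainder x₀ l g α x d| ≤ C * (b + ‖d‖) ^ (p - 1) * ‖d‖ := hC α x d hα
      _ ≤ C * (2 ^ (p - 1) * (b ^ (p - 1) + ‖d‖ ^ (p - 1))) * ‖d‖ := by gcongr
      _ = C' * (b ^ (p - 1) * ‖d‖) + C' * (‖d‖ ^ (p - 1) * ‖d‖) := by rw [hC']; ring
      _ ≤ C' * (r * (η ^ (p - 1) * (‖d‖ / r) ^ p + b ^ p / η)) + C' * ‖d‖ ^ p := by
        rw [hpow _ (norm_nonneg d)]; gcongr
      _ = (C' * η ^ (p - 1)) * (r * (‖d‖ / r) ^ p) + C' / η * r * b ^ p + C' * ‖d‖ ^ p := by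
        field_simp
      _ ≤ _ := by
        rw [hηp]
        gcongr
        · linarith
        · linarith
  · rw [Set.indicator_of_notMem (by exact hx), mul_zero, add_zero]
    rw [not_lt] at hx
    by_cases hd : ‖d‖ ≤ δ
    · refine (hδr α x d hα hx hd).trans ?_
      have : ‖d‖ / r ≤ 1 + (‖d‖ / r) ^ p := by
        rcases le_total (‖d‖ / r) 1 with h1 | h1
        · linarith
        · linarith [Real.self_le_rpow_of_one_le h1 hp.le]
      have h2 : ‖d‖ ≤ r * (1 + (‖d‖ / r) ^ p) := by
        rw [div_le_iff₀ hr] at this; linarith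
      have h3 : 0 ≤ C' * ‖d‖ ^ p := by positivity
      nlinarith [mul_nonneg hE hD]
    · rw [not_le] at hd
      have h1 : 1 + ‖x‖ + ‖d‖ ≤ ((1 + |R|) / δ + 1) * ‖d‖ := by
        have : (1 + |R|) / δ * δ ≤ (1 + |R|) / δ * ‖d‖ := by gcongr
        rw [div_mul_cancel₀ _ hδ.ne'] at this
        linarith [le_abs_self R]
      calc |remainder x₀ l g α x d| ≤ C * (1 + ‖x‖ + ‖d‖) ^ (p - 1) * ‖d‖ := hC α x d hα
        _ ≤ C * (((1 + |R|) / δ + 1) * ‖d‖) ^ (p - 1) * ‖d‖ := by gcongr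
        _ = C * ((1 + |R|) / δ + 1) ^ (p - 1) * ‖d‖ ^ p := by
          rw [Real.mul_rpow (by positivity) (by positivity), ← hpow ‖d‖ (norm_nonneg d)]; ring
        _ ≤ _ := by
          have : 0 ≤ ε * (r * (1 + (‖d‖ / r) ^ p)) := by positivity
          nlinarith [mul_nonneg hC'0.le hD]

lemma integrable_one_add_norm_rpow {Ω : Type*} [MeasurableSpace Ω] {μ : Measure Ω}
    [IsFiniteMeasure μ] {E : Type*} [NormedAddCommGroup E] {X : Ω → E} (hp : 0 < p)
    (hX : MemLp X (ENNReal.ofReal p) μ) : Integrable (fun ω => (1 + ‖X ω‖) ^ p) μ := by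
  have h1 : MemLp (fun ω => (1 : ℝ) + ‖X ω‖) (ENNReal.ofReal p) μ :=
    MemLp.add (f := fun _ => (1 : ℝ)) (memLp_const 1) hX.norm
  have := h1.integrable_norm_rpow (by simpa using hp) (by simp)
  rw [ENNReal.toReal_ofReal hp.le] at this
  refine this.congr (Eventually.of_forall fun ω => ?_)
  simp only [Real.norm_eq_abs]
  rw [abs_of_nonneg (by positivity)]

lemma integrable_of_growth {Ω : Type*} [MeasurableSpace Ω] {μ : Measure Ω} {B f : Ω → ℝ}
    (hB : Integrable B μ) (hf : Measurable f) {C : ℝ} (h : ∀ ω, |f ω| ≤ C * B ω) :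
    Integrable f μ :=
  (hB.const_mul C).mono' hf.aestronglyMeasurable (Eventually.of_forall h)

lemma tendsto_tail {P : Measure (Path T)} (hP : Integrable (fun x : Path T => (1 + ‖x‖) ^ p) P) :
    Tendsto (fun n : ℕ => ∫ x, {x : Path T | (n : ℝ) < ‖x‖}.indicator (fun x => (1 + ‖x‖) ^ p) x ∂P)
      atTop (𝓝 0) := by
  have hm : ∀ n : ℕ, MeasurableSet {x : Path T | (n : ℝ) < ‖x‖} := fun n =>
    measurableSet_lt measurable_const measurable_norm
  have := tendsto_integral_of_dominated_convergence (μ := P) (f := fun _ => (0 : ℝ))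
    (F := fun (n : ℕ) x => {x : Path T | (n : ℝ) < ‖x‖}.indicator (fun x => (1 + ‖x‖) ^ p) x)
    (fun x => (1 + ‖x‖) ^ p) (fun n => (hP.indicator (hm n)).1) hP
    (fun n => Eventually.of_forall fun x => ?_) (Eventually.of_forall fun x => ?_)
  · simpa using this
  · refine (norm_indicator_le_norm_self _ _).trans ?_
    rw [Real.norm_of_nonneg (by positivity)]
  · refine tendsto_const_nhds.congr' ?_
    obtain ⟨N, hN⟩ := exists_nat_gt ‖x‖
    filter_upwards [eventually_ge_atTop N] with n hn
    rw [Set.indicator_of_notMem]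
    have : (N : ℝ) ≤ n := by exact_mod_cast hn
    simp only [Set.mem_ofPred_eq, not_lt]; linarith

lemma integrable_norm_fst_add {P : Measure (Path T)} {π : Measure (Path T × Path T)}
    [IsProbabilityMeasure π] (hp : 1 ≤ p) (hP : P ∈ probMeasures p T) (hπ : π.map Prod.fst = P)
    (hD : Integrable (fun z => ‖z.2 - z.1‖ ^ p) π) :
    Integrable (fun z : Path T × Path T => (1 + (‖z.1‖ + ‖z.2 - z.1‖)) ^ p) π := by
  have h1 : MemLp (fun z : Path T × Path T => z.1) (ENNReal.ofReal p) π := by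
    have := hP.2
    rw [← hπ] at this
    exact this.comp_of_map measurable_fst.aemeasurable
  have h2 : MemLp (fun z : Path T × Path T => z.2 - z.1) (ENNReal.ofReal p) π := by
    rw [← integrable_norm_rpow_iff (by fun_prop) (by simp; linarith) (by simp),
      ENNReal.toReal_ofReal (by linarith)]
    exact hD
  have := integrable_one_add_norm_rpow (by linarith) (h1.norm.add h2.norm)
  refine this.congr (Eventually.of_forall fun z => ?_)
  simp only [Pi.add_apply]
  rw [Real.norm_of_nonneg (by positivity)]

lemma measurable_wealth_comp {Ω : Type*} [MeasurableSpace Ω] (hg : Continuous g)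
    {a x : Ω → Path T} (ha : Measurable a) (hx : Measurable x) :
    Measurable (fun ω => wealth x₀ g (a ω) (x ω)) :=
  (continuous_wealth hg).measurable.comp (ha.prodMk hx)

lemma Regular.measurable_pathGrad_comp (h : Regular p L l g) {Ω : Type*} [MeasurableSpace Ω]
    {a x : Ω → Path T} (ha : Measurable a) (hx : Measurable x) :
    Measurable (fun ω => pathGrad x₀ l g (a ω) (x ω)) :=
  (continuous_pathGrad h).measurable.comp (ha.prodMk hx)

lemma Regular.measurable_pathDeriv_comp (h : Regular p L l g) {Ω : Type*} [MeasurableSpace Ω]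
    {a x d : Ω → Path T} (ha : Measurable a) (hx : Measurable x) (hd : Measurable d) :
    Measurable (fun ω => pathDeriv x₀ l g (a ω) (x ω) (d ω)) := by
  simp only [pathDeriv_eq_sum_pathGrad]
  exact Finset.measurable_sum _ fun t _ =>
    ((measurable_pi_apply t).comp (h.measurable_pathGrad_comp ha hx)).mul
      ((measurable_pi_apply t).comp hd)

/-- The bound shared by the integrands below: their growth is of order `p` in the pair of paths. -/
lemma Regular.exists_growth_pair (h : Regular p L l g) (x₀ : ℝ) : ∃ C : ℝ, 0 ≤ C ∧
    ∀ α x d : Path T, (∀ t, |α t| ≤ L) →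
      |l (wealth x₀ g α (x + d))| ≤ C * (1 + (‖x‖ + ‖d‖)) ^ p ∧
      |l (wealth x₀ g α x)| ≤ C * (1 + (‖x‖ + ‖d‖)) ^ p ∧
      |pathDeriv x₀ l g α x d| ≤ C * (1 + (‖x‖ + ‖d‖)) ^ p := by
  obtain ⟨C₁, h1, hC₁⟩ := h.exists_growth x₀
  obtain ⟨C₂, h2, hC₂⟩ := h.abs_pathDeriv_le x₀
  have hp := h.one_lt
  refine ⟨C₁ + C₂, by linarith, fun α x d hα => ⟨?_, ?_, ?_⟩⟩
  · refine (hC₁ α (x + d) hα).2.2.1.trans ?_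
    have := norm_add_le x d
    gcongr
    linarith
  · refine (hC₁ α x hα).2.2.1.trans ?_
    gcongr
    · linarith
    · linarith [norm_nonneg d]
  · refine (hC₂ α x d hα).trans ?_
    have h3 : (1 + (‖x‖ + ‖d‖)) ^ p = (1 + (‖x‖ + ‖d‖)) ^ (p - 1) * (1 + (‖x‖ + ‖d‖)) := by
      rw [Real.rpow_sub_one (by positivity)]; field_simp
    rw [h3, ← mul_assoc]
    gcongr
    · linarith
    · linarith [norm_nonneg d]
    · linarith [norm_nonneg x]

/-- Along couplings `π` of `P` with a distribution at distance at most `r`, the expected loss has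
a first-order expansion with an error `o(r)` that is uniform in `π` and in the controls. -/
theorem Regular.abs_integral_remainder_le (h : Regular p L l g) (x₀ : ℝ) {P : Measure (Path T)}
    (hP : P ∈ probMeasures p T) {ε : ℝ} (hε : 0 < ε) :
    ∃ ρ : ℝ, 0 < ρ ∧ ∀ r : ℝ, 0 < r → r ≤ ρ → ∀ π : Measure (Path T × Path T),
      IsProbabilityMeasure π → π.map Prod.fst = P →
      Integrable (fun z => ‖z.2 - z.1‖ ^ p) π → ∫ z, ‖z.2 - z.1‖ ^ p ∂π ≤ r ^ p →
      ∀ a : Path T → Path T, Measurable a → (∀ x t, |a x t| ≤ L) →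
        |∫ z, l (wealth x₀ g (a z.1) z.2) ∂π - ∫ x, l (wealth x₀ g (a x) x) ∂P
          - ∫ z, pathDeriv x₀ l g (a z.1) z.1 (z.2 - z.1) ∂π| ≤ ε * r := by
  have hp := h.one_lt
  have := hP.1
  have hPi := integrable_one_add_norm_rpow (by linarith) hP.2
  obtain ⟨K₁, hK₁, hyoung⟩ := h.abs_remainder_le_young x₀ (ε := ε / 4) (by positivity)
  obtain ⟨n, hn⟩ : ∃ n : ℕ, K₁ * ∫ x, {x : Path T | (n : ℝ) < ‖x‖}.indicator
      (fun x => (1 + ‖x‖) ^ p) x ∂P < ε / 4 := by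
    have h1 := (tendsto_tail hPi).const_mul K₁
    rw [mul_zero] at h1
    exact (h1.eventually (gt_mem_nhds (by positivity))).exists
  obtain ⟨K₂, hK₂, hbd⟩ := hyoung n
  refine ⟨(ε / (4 * (K₂ + 1))) ^ (p - 1)⁻¹, by positivity, fun r hr hrρ π _ hπ hD hDr a ha haL => ?_⟩
  have hKr : K₂ * r ^ p ≤ ε / 4 * r := by
    have h1 : r ^ (p - 1) ≤ ε / (4 * (K₂ + 1)) := by
      refine (Real.rpow_le_rpow hr.le hrρ (by linarith)).trans ?_
      rw [Real.rpow_inv_rpow (by positivity) (by linarith)]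
    have h2 : r ^ p = r ^ (p - 1) * r := by rw [Real.rpow_sub_one hr.ne']; field_simp
    rw [h2, ← mul_assoc]
    gcongr
    rw [le_div_iff₀ (by positivity)] at h1
    nlinarith [show 0 ≤ r ^ (p - 1) by positivity]
  obtain ⟨C, hC0, hC⟩ := h.exists_growth_pair x₀
  have hB := integrable_norm_fst_add hp.le hP hπ hD
  have ha1 : Measurable fun z : Path T × Path T => a z.1 := ha.comp measurable_fst
  have hd : Measurable fun z : Path T × Path T => z.2 - z.1 := by fun_prop
  have hadd : ∀ z : Path T × Path T, z.1 + (z.2 - z.1) = z.2 := fun z => by abel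
  have i1 : Integrable (fun z : Path T × Path T => l (wealth x₀ g (a z.1) z.2)) π := by
    refine integrable_of_growth (C := C) hB (h.loss.continuous.measurable.comp
      (measurable_wealth_comp h.cont_payoff ha1 measurable_snd)) fun z => ?_
    have := (hC (a z.1) z.1 (z.2 - z.1) (haL _)).1
    rwa [hadd] at this
  have i2 : Integrable (fun z : Path T × Path T => l (wealth x₀ g (a z.1) z.1)) π :=
    integrable_of_growth (C := C) hB (h.loss.continuous.measurable.comp
      (measurable_wealth_comp h.cont_payoff ha1 measurable_fst)) fun z =>
        (hC (a z.1) z.1 (z.2 - z.1) (haL _)).2.1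
  have i3 : Integrable (fun z : Path T × Path T => pathDeriv x₀ l g (a z.1) z.1 (z.2 - z.1)) π :=
    integrable_of_growth (C := C) hB (h.measurable_pathDeriv_comp ha1 measurable_fst hd) fun z =>
        (hC (a z.1) z.1 (z.2 - z.1) (haL _)).2.2
  have hm : MeasurableSet {x : Path T | (n : ℝ) < ‖x‖} :=
    measurableSet_lt measurable_const measurable_norm
  set tail : Path T → ℝ := {x : Path T | (n : ℝ) < ‖x‖}.indicator (fun x => (1 + ‖x‖) ^ p)
    with htail
  have itail : Integrable tail P := hPi.indicator hm
  have itail' : Integrable (fun z : Path T × Path T => tail z.1) π := by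
    rw [← hπ] at itail
    exact itail.comp_measurable measurable_fst
  have etail : ∫ z, tail z.1 ∂π = ∫ x, tail x ∂P := by
    rw [← hπ, integral_map measurable_fst.aemeasurable (by rw [hπ]; exact itail.1)]
  have e2 : ∫ x, l (wealth x₀ g (a x) x) ∂P = ∫ z, l (wealth x₀ g (a z.1) z.1) ∂π := by
    rw [← hπ, integral_map measurable_fst.aemeasurable]
    exact (h.loss.continuous.measurable.comp
      (measurable_wealth_comp h.cont_payoff ha measurable_id)).aestronglyMeasurable
  have hDr' : (fun z : Path T × Path T => (‖z.2 - z.1‖ / r) ^ p) =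
      fun z => (r ^ p)⁻¹ * ‖z.2 - z.1‖ ^ p := by
    funext z
    rw [Real.div_rpow (norm_nonneg _) hr.le, div_eq_inv_mul]
  have iD : Integrable (fun z : Path T × Path T => (‖z.2 - z.1‖ / r) ^ p) π := by
    rw [hDr']; exact hD.const_mul _
  have eD : ∫ z : Path T × Path T, (‖z.2 - z.1‖ / r) ^ p ∂π ≤ 1 := by
    rw [hDr', integral_const_mul, inv_mul_le_iff₀ (by positivity)]; linarith
  have e3 := integral_sub (i1.sub i2) i3
  simp only [Pi.sub_apply] at e3
  rw [e2, ← integral_sub i1 i2, ← e3]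
  have j1 : Integrable (fun z : Path T × Path T => ε / 4 * (r * (1 + (‖z.2 - z.1‖ / r) ^ p))) π :=
    (((integrable_const 1).add iD).const_mul r).const_mul (ε / 4)
  have j2 : Integrable (fun z : Path T × Path T => K₁ * r * tail z.1) π := itail'.const_mul _
  have j3 : Integrable (fun z : Path T × Path T => K₂ * ‖z.2 - z.1‖ ^ p) π := hD.const_mul _
  rw [← Real.norm_eq_abs]
  refine le_trans (norm_integral_le_of_norm_le ((j1.add j2).add j3)
    (Eventually.of_forall fun z => ?_)) ?_
  · have := hbd r hr (a z.1) z.1 (z.2 - z.1) (haL _)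
    rw [remainder, hadd] at this
    exact this
  · rw [integral_add' (j1.add j2) j3, integral_add' j1 j2, integral_const_mul, integral_const_mul,
      integral_const_mul, integral_const_mul, integral_add (integrable_const 1) iD, etail]
    simp only [integral_const, probReal_univ, smul_eq_mul, mul_one]
    have h1 : ε / 4 * (r * (1 + ∫ z : Path T × Path T, (‖z.2 - z.1‖ / r) ^ p ∂π)) ≤ ε / 4 * (r * 2) := by
      gcongr; linarith
    have h2 : K₁ * r * ∫ x, tail x ∂P ≤ ε / 4 * r := by
      have := mul_le_mul_of_nonneg_right hn.le hr.le
      linarith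
    have h3 : K₂ * ∫ z : Path T × Path T, ‖z.2 - z.1‖ ^ p ∂π ≤ K₂ * r ^ p := by gcongr
    linarith

/-! ### The canonical filtration -/

lemma canonFilt_le (T n : ℕ) : canonFilt T n ≤ (inferInstance : MeasurableSpace (Path T)) :=
  iSup₂_le fun s _ => (measurable_pi_apply s).comap_le

lemma canonFilt_mono {m n : ℕ} (h : m ≤ n) : canonFilt T m ≤ canonFilt T n :=
  iSup₂_le fun s hs => le_iSup₂_of_le s (lt_of_lt_of_le hs h) le_rfl

lemma canonFilt_zero (T : ℕ) : canonFilt T 0 = ⊥ := by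
  simp [canonFilt]

lemma canonFilt_self (T : ℕ) : canonFilt T T = (inferInstance : MeasurableSpace (Path T)) := by
  refine le_antisymm (canonFilt_le T T) ?_
  exact iSup_le fun s => le_iSup₂_of_le (f := fun (s : Fin T) (_ : (s : ℕ) < T) =>
    MeasurableSpace.comap (fun x : Path T => x s) inferInstance) s s.isLt le_rfl

lemma measurable_coord {n : ℕ} {s : Fin T} (h : (s : ℕ) < n) :
    Measurable[canonFilt T n] (fun x : Path T => x s) :=
  Measurable.of_comap_le (le_iSup₂_of_le (f := fun (s : Fin T) (_ : (s : ℕ) < n) =>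
    MeasurableSpace.comap (fun x : Path T => x s) inferInstance) s h le_rfl)

lemma measurable_canonFilt_of {Ω : Type*} {m : MeasurableSpace Ω} {n : ℕ} {f : Ω → Path T}
    (h : ∀ s : Fin T, (s : ℕ) < n → Measurable fun ω => f ω s) :
    @Measurable Ω (Path T) m (canonFilt T n) f := by
  refine Measurable.of_comap_le ?_
  rw [canonFilt, MeasurableSpace.comap_iSup]
  refine iSup_le fun s => ?_
  rw [MeasurableSpace.comap_iSup]
  refine iSup_le fun hs => ?_
  rw [MeasurableSpace.comap_comp]
  exact (h s hs).comap_le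

lemma measurable_prev (t : Fin T) :
    Measurable[canonFilt T (t : ℕ)] (fun x : Path T => prev x₀ x t) := by
  unfold prev
  split_ifs with h
  · exact @measurable_const _ _ _ (canonFilt T t) _
  · exact measurable_coord (by simp only; omega)

lemma measurable_increment (t : Fin T) :
    Measurable[canonFilt T ((t : ℕ) + 1)] (fun x : Path T => x t - prev x₀ x t) :=
  Measurable.sub (m := canonFilt T (t + 1)) (f := fun x : Path T => x t)
    (g := fun x : Path T => prev x₀ x t) (measurable_coord (Nat.lt_succ_self _))
    ((measurable_prev t).mono (canonFilt_mono (Nat.le_succ _)) le_rfl)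

lemma measurable_of_mem_controls {a : Path T → Fin T → ℝ} (ha : a ∈ controls T L) :
    Measurable a :=
  measurable_pi_lambda _ fun t => (ha t).1.mono (canonFilt_le T t) le_rfl

lemma measurable_nextControl {a : Path T → Fin T → ℝ} (ha : a ∈ controls T L) (t : Fin T) :
    Measurable[canonFilt T ((t : ℕ) + 1)] (fun x => nextControl a x t) := by
  unfold nextControl
  split_ifs with h
  · exact (ha ⟨t + 1, h⟩).1
  · exact @measurable_const _ _ _ (canonFilt T (t + 1)) _

lemma abs_nextControl_le (hL : 0 ≤ L) {a : Path T → Fin T → ℝ} (ha : a ∈ controls T L) (t : Fin T)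
    (x : Path T) : |nextControl a x t| ≤ L := by
  unfold nextControl
  split_ifs with h
  · exact (ha _).2 x
  · simpa using hL

/-! ### Causal couplings -/

lemma condExp_comp_fst_eq_zero {π : Measure (Path T × Path T)} [IsProbabilityMeasure π]
    {n : ℕ} {v : Path T → ℝ} (hv : Integrable v (π.map Prod.fst))
    (hv0 : condExp (canonFilt T n) (π.map Prod.fst) v =ᵐ[π.map Prod.fst] 0) :
    condExp (MeasurableSpace.comap (Prod.fst : Path T × Path T → Path T) (canonFilt T n)) π
      (fun z => v z.1) =ᵐ[π] 0 := by
  have := Measure.isProbabilityMeasure_map (μ := π) measurable_fst.aemeasurable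
  have hle : MeasurableSpace.comap (Prod.fst : Path T × Path T → Path T) (canonFilt T n) ≤
      (inferInstance : MeasurableSpace (Path T × Path T)) :=
    (MeasurableSpace.comap_mono (canonFilt_le T n)).trans measurable_fst.comap_le
  symm
  refine ae_eq_condExp_of_forall_setIntegral_eq hle (hv.comp_measurable measurable_fst)
    (fun s _ _ => (integrable_zero _ _ _).integrableOn) ?_
    (stronglyMeasurable_zero.aestronglyMeasurable)
  rintro s ⟨A, hA, rfl⟩ -
  have hA' := canonFilt_le T n A hA
  have h1 : ∫ z in Prod.fst ⁻¹' A, v z.1 ∂π = ∫ x in A, v x ∂(π.map Prod.fst) :=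
    (setIntegral_map hA' hv.1 measurable_fst.aemeasurable).symm
  rw [h1, ← setIntegral_condExp (canonFilt_le T n) hv hA,
    setIntegral_congr_ae hA' (hv0.mono fun x hx _ => hx)]
  simp

/-- Under a causal coupling, a function of `X` that is conditionally centred given
`X_1, …, X_n` has integral zero over every event that depends on `Y_1, …, Y_n`. -/
lemma IsCausal.setIntegral_eq_zero {π : Measure (Path T × Path T)} [IsProbabilityMeasure π]
    (hc : IsCausal π) {n : ℕ} (hn : n ≤ T) {v : Path T → ℝ} (hvm : Measurable v)
    (hv : Integrable v (π.map Prod.fst))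
    (hv0 : condExp (canonFilt T n) (π.map Prod.fst) v =ᵐ[π.map Prod.fst] 0)
    {B : Set (Path T)} (hB : MeasurableSet[canonFilt T n] B) :
    ∫ z in Prod.snd ⁻¹' B, v z.1 ∂π = 0 := by
  have hPm := Measure.isProbabilityMeasure_map (μ := π) measurable_fst.aemeasurable
  have hle : ∀ n, MeasurableSpace.comap (Prod.fst : Path T × Path T → Path T) (canonFilt T n) ≤
      (inferInstance : MeasurableSpace (Path T × Path T)) := fun n =>
    (MeasurableSpace.comap_mono (canonFilt_le T n)).trans measurable_fst.comap_le
  have hV : Integrable (fun z : Path T × Path T => v z.1) π := hv.comp_measurable measurable_fst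
  have hV0 := condExp_comp_fst_eq_zero hv hv0
  have hBm : MeasurableSet (Prod.snd ⁻¹' B : Set (Path T × Path T)) :=
    measurable_snd (canonFilt_le T n B hB)
  rcases Nat.eq_zero_or_pos n with rfl | hn0
  · have htot : ∫ z, v z.1 ∂π = 0 := by
      rw [← integral_condExp (hle 0), integral_congr_ae hV0]; simp
    rw [canonFilt_zero, MeasurableSpace.measurableSet_bot_iff] at hB
    rcases hB with rfl | rfl
    · simp
    · simpa using htot
  set mX := MeasurableSpace.comap (Prod.fst : Path T × Path T → Path T) (canonFilt T T) with hmX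
  set m := MeasurableSpace.comap (Prod.fst : Path T × Path T → Path T) (canonFilt T n) with hm
  set I : Path T × Path T → ℝ := (Prod.snd ⁻¹' B).indicator fun _ => (1 : ℝ) with hI
  have hII : Integrable I π := (integrable_const 1).indicator hBm
  have hIb : ∀ᵐ z ∂π, |I z| ≤ (1 : ℝ) := Eventually.of_forall fun z => by
    rw [hI]; by_cases h : z ∈ Prod.snd ⁻¹' B <;> simp [h]
  have hcz : condExp mX π I =ᵐ[π] condExp m π I := hc n hn0 hn B hB
  have hVI : Integrable ((fun z : Path T × Path T => v z.1) * I) π := by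
    refine hV.mul_bdd (c := 1) hII.1 ?_
    filter_upwards [hIb] with z hz; simpa using hz
  have hVs : StronglyMeasurable[mX] (fun z : Path T × Path T => v z.1) := by
    refine Measurable.stronglyMeasurable ?_
    rw [hmX, canonFilt_self]
    exact hvm.comp (comap_measurable _)
  have hcb : ∀ᵐ z ∂π, ‖condExp m π I z‖ ≤ 1 := by
    filter_upwards [ae_bdd_abs_condExp_of_ae_bdd_abs (m := m) hIb] with z hz; simpa using hz
  calc ∫ z in Prod.snd ⁻¹' B, v z.1 ∂π = ∫ z, ((fun z : Path T × Path T => v z.1) * I) z ∂π := by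
        rw [← integral_indicator hBm]
        refine integral_congr_ae (Eventually.of_forall fun z => ?_)
        simp only [hI, Pi.mul_apply, Set.indicator]; split_ifs <;> simp
    _ = ∫ z, condExp mX π ((fun z : Path T × Path T => v z.1) * I) z ∂π :=
        (integral_condExp (hle T)).symm
    _ = ∫ z, (condExp m π I * fun z : Path T × Path T => v z.1) z ∂π := by
        refine integral_congr_ae ?_
        filter_upwards [condExp_mul_of_stronglyMeasurable_left hVs hVI hII, hcz] with z h1 h2
        rw [h1, Pi.mul_apply, Pi.mul_apply, h2, mul_comm]
    _ = ∫ z, condExp m π (condExp m π I * fun z : Path T × Path T => v z.1) z ∂π :=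
        (integral_condExp (hle n)).symm
    _ = 0 := by
        rw [← integral_zero (Path T × Path T) ℝ (μ := π)]
        refine integral_congr_ae ?_
        filter_upwards [condExp_stronglyMeasurable_mul_of_bound (hle n)
          stronglyMeasurable_condExp hV 1 hcb, hV0] with z h1 h2
        rw [h1, Pi.mul_apply, h2]; simp

lemma IsCausal.integral_mul_eq_zero {π : Measure (Path T × Path T)} [IsProbabilityMeasure π]
    (hc : IsCausal π) {n : ℕ} (hn : n ≤ T) {v : Path T → ℝ} (hvm : Measurable v)
    (hv : Integrable v (π.map Prod.fst))
    (hv0 : condExp (canonFilt T n) (π.map Prod.fst) v =ᵐ[π.map Prod.fst] 0)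
    {k : Path T → ℝ} (hk : Measurable[canonFilt T n] k)
    (hvk : Integrable (fun z : Path T × Path T => v z.1 * k z.2) π) :
    ∫ z, v z.1 * k z.2 ∂π = 0 := by
  have hle : MeasurableSpace.comap (Prod.snd : Path T × Path T → Path T) (canonFilt T n) ≤
      (inferInstance : MeasurableSpace (Path T × Path T)) :=
    (MeasurableSpace.comap_mono (canonFilt_le T n)).trans measurable_snd.comap_le
  have hV : Integrable (fun z : Path T × Path T => v z.1) π := hv.comp_measurable measurable_fst
  have h0 : condExp (MeasurableSpace.comap (Prod.snd : Path T × Path T → Path T) (canonFilt T n)) π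
      (fun z => v z.1) =ᵐ[π] 0 := by
    symm
    refine ae_eq_condExp_of_forall_setIntegral_eq hle hV
      (fun s _ _ => (integrable_zero _ _ _).integrableOn) ?_
      (stronglyMeasurable_zero.aestronglyMeasurable)
    rintro s ⟨B, hB, rfl⟩ -
    rw [hc.setIntegral_eq_zero hn hvm hv hv0 hB]; simp
  have hks : StronglyMeasurable[MeasurableSpace.comap Prod.snd (canonFilt T n)]
      (fun z : Path T × Path T => k z.2) := by
    refine Measurable.stronglyMeasurable ?_
    exact hk.comp (comap_measurable (m := canonFilt T n) _)
  have h1 := condExp_mul_of_stronglyMeasurable_right hks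
    (f := fun z : Path T × Path T => v z.1) hvk hV
  rw [← integral_condExp hle]
  rw [← integral_zero (Path T × Path T) ℝ (μ := π)]
  refine integral_congr_ae ?_
  filter_upwards [h0, h1] with z e0 e1
  have e2 : condExp (MeasurableSpace.comap (Prod.snd : Path T × Path T → Path T) (canonFilt T n)) π
    (fun z => v z.1 * k z.2) z = _ := e1
  rw [e2, Pi.mul_apply, e0]; simp

/-- Under a causal coupling, a function of `X` that is integrated against a function of
`Y_1, …, Y_n` can be replaced by its conditional expectation given `X_1, …, X_n`. -/
lemma IsCausal.integral_mul_eq {π : Measure (Path T × Path T)} [IsProbabilityMeasure π]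
    (hc : IsCausal π) {n : ℕ} (hn : n ≤ T) {w : Path T → ℝ} (hwm : Measurable w)
    (hw : Integrable w (π.map Prod.fst))
    {k : Path T → ℝ} (hk : Measurable[canonFilt T n] k)
    (hwk : Integrable (fun z : Path T × Path T => w z.1 * k z.2) π)
    (hwk' : Integrable (fun z : Path T × Path T =>
      condExp (canonFilt T n) (π.map Prod.fst) w z.1 * k z.2) π) :
    ∫ z, w z.1 * k z.2 ∂π = ∫ z, condExp (canonFilt T n) (π.map Prod.fst) w z.1 * k z.2 ∂π := by
  have := Measure.isProbabilityMeasure_map (μ := π) measurable_fst.aemeasurable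
  have hsm : StronglyMeasurable[canonFilt T n] (condExp (canonFilt T n) (π.map Prod.fst) w) :=
    stronglyMeasurable_condExp
  rw [← sub_eq_zero, ← integral_sub hwk hwk']
  simp_rw [← sub_mul]
  refine hc.integral_mul_eq_zero hn
    (v := fun x => w x - condExp (canonFilt T n) (π.map Prod.fst) w x)
    (hwm.sub (hsm.measurable.mono (canonFilt_le T n) le_rfl))
    (hw.sub integrable_condExp) ?_ hk ?_
  · have h1 := condExp_sub hw (integrable_condExp (m := canonFilt T n) (f := w)) (canonFilt T n)
    rw [condExp_of_stronglyMeasurable (canonFilt_le T n) hsm integrable_condExp, sub_self] at h1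
    exact h1
  · simp_rw [sub_mul]; exact hwk.sub hwk'

/-- The projection of a control on the observation of `Y`. If the coupling is causal from `Y` to
`X`, the conditional expectation of `a_t(X)` given `Y` is a control in `Y`. -/
lemma exists_projected_control {π : Measure (Path T × Path T)} [IsProbabilityMeasure π]
    (hc : IsCausal (π.map Prod.swap)) {Q : Measure (Path T)} (hQ : π.map Prod.snd = Q)
    (hL : 0 ≤ L) {a : Path T → Fin T → ℝ} (ha : a ∈ controls T L) :
    ∃ b ∈ controls T L, ∀ (t : Fin T) (v : Path T → ℝ), Measurable v → Integrable v Q →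
      ∫ z, a z.1 t * v z.2 ∂π = ∫ z, b z.2 t * v z.2 ∂π := by
  have hQp : IsProbabilityMeasure Q := by
    rw [← hQ]; exact Measure.isProbabilityMeasure_map measurable_snd.aemeasurable
  have hle : ∀ n, MeasurableSpace.comap (Prod.snd : Path T × Path T → Path T) (canonFilt T n) ≤
      (inferInstance : MeasurableSpace (Path T × Path T)) := fun n =>
    (MeasurableSpace.comap_mono (canonFilt_le T n)).trans measurable_snd.comap_le
  have ham : ∀ t, Measurable fun x => a x t := fun t => (ha t).1.mono (canonFilt_le T t) le_rfl
  have hab : ∀ t (z : Path T × Path T), ‖a z.1 t‖ ≤ L := fun t z => (ha t).2 z.1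
  have hai : ∀ t, Integrable (fun z : Path T × Path T => a z.1 t) π := fun t =>
    Integrable.of_bound ((ham t).comp measurable_fst).aestronglyMeasurable L
      (Eventually.of_forall (hab t))
  have hex : ∀ t : Fin T, ∃ b₀ : Path T → ℝ, Measurable[canonFilt T t] b₀ ∧
      condExp (MeasurableSpace.comap Prod.snd (canonFilt T t)) π
        (fun z : Path T × Path T => a z.1 t) = b₀ ∘ Prod.snd := fun t =>
    Measurable.exists_eq_measurable_comp (mY := canonFilt T t)
      (stronglyMeasurable_condExp (m := MeasurableSpace.comap Prod.snd (canonFilt T t))).measurable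
  choose b₀ hb₀m hb₀ using hex
  have hclip : Measurable fun y : ℝ => max (-L) (min L y) := by fun_prop
  refine ⟨fun x t => max (-L) (min L (b₀ t x)), fun t => ⟨?_, fun x => ?_⟩, fun t v hvm hv => ?_⟩
  · exact hclip.comp (hb₀m t)
  · rw [abs_le]
    exact ⟨le_max_left _ _, max_le (by linarith) (min_le_left _ _)⟩
  set E := condExp (MeasurableSpace.comap Prod.snd (canonFilt T t)) π (fun z : Path T × Path T => a z.1 t) with hE
  have hEb : ∀ᵐ z ∂π, |E z| ≤ L := by
    exact ae_bdd_abs_condExp_of_ae_bdd_abs (Eventually.of_forall (hab t))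
  have hbE : ∀ᵐ z ∂π, max (-L) (min L (b₀ t z.2)) = E z := by
    filter_upwards [hEb] with z hz
    have : b₀ t z.2 = E z := (congrFun (hb₀ t) z).symm
    rw [this, min_eq_right (abs_le.1 hz).2, max_eq_right (abs_le.1 hz).1]
  have hsw : (π.map Prod.swap).map Prod.fst = Q := by
    rw [Measure.map_map measurable_fst measurable_swap, ← hQ]; rfl
  have hpsw := Measure.isProbabilityMeasure_map (μ := π) measurable_swap.aemeasurable
  set F := condExp (canonFilt T t) Q v with hF
  have hFm : Measurable F :=
    (stronglyMeasurable_condExp (m := canonFilt T t)).measurable.mono (canonFilt_le T t) le_rfl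
  have hFs : StronglyMeasurable[MeasurableSpace.comap Prod.snd (canonFilt T t)]
      (fun z : Path T × Path T => F z.2) :=
    ((stronglyMeasurable_condExp (m := canonFilt T t)).measurable.comp
      (comap_measurable (m := canonFilt T t) _)).stronglyMeasurable
  have hi : ∀ u : Path T → ℝ, Measurable u → Integrable u Q →
      Integrable (fun z : Path T × Path T => u z.2 * a z.1 t) π := fun u _ hu => by
    have : Integrable (fun z : Path T × Path T => u z.2) π := by
      rw [← hQ] at hu; exact hu.comp_measurable measurable_snd
    exact this.mul_bdd (hai t).1 (Eventually.of_forall (hab t))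
  have hFi : Integrable F Q := integrable_condExp
  have e1 : ∫ z, v z.2 * a z.1 t ∂π = ∫ z, F z.2 * a z.1 t ∂π := by
    have hkey := hc.integral_mul_eq (n := t) t.isLt.le (w := v) hvm (by rw [hsw]; exact hv)
      (k := fun x => a x t) (ha t).1
    rw [hsw] at hkey
    have s1 : ∀ u : Path T → ℝ, Measurable u →
        Measurable (fun z : Path T × Path T => u z.1 * a z.2 t) := fun u hu =>
      (hu.comp measurable_fst).mul ((ham t).comp measurable_snd)
    have s2 : ∀ u : Path T → ℝ, Measurable u → Integrable u Q →
        Integrable (fun z : Path T × Path T => u z.1 * a z.2 t) (π.map Prod.swap) := fun u hu hui => by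
      rw [integrable_map_measure (s1 u hu).aestronglyMeasurable measurable_swap.aemeasurable]
      exact hi u hu hui
    have := hkey (s2 v hvm hv) (s2 F hFm hFi)
    rw [integral_map measurable_swap.aemeasurable (s1 v hvm).aestronglyMeasurable,
      integral_map measurable_swap.aemeasurable (s1 F hFm).aestronglyMeasurable] at this
    exact this
  have e2 : ∫ z, F z.2 * a z.1 t ∂π = ∫ z, F z.2 * E z ∂π := by
    rw [← integral_condExp (hle t)]
    refine integral_congr_ae ?_
    exact condExp_mul_of_stronglyMeasurable_left hFs (hi F hFm hFi) (hai t)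
  -- `β` is the projected control, and `F z.2 * E z = F z.2 * β z.2` almost surely
  set β : Path T → ℝ := fun x => max (-L) (min L (b₀ t x)) with hβ
  have hβm' : Measurable[canonFilt T t] β :=
    hclip.comp (hb₀m t)
  have hβm : Measurable β := hβm'.mono (canonFilt_le T t) le_rfl
  have hβb : ∀ x, ‖β x‖ ≤ L := fun x => by
    rw [Real.norm_eq_abs, abs_le]
    exact ⟨le_max_left _ _, max_le (by linarith) (min_le_left _ _)⟩
  have e3 : ∫ z, F z.2 * E z ∂π = ∫ x, F x * β x ∂Q := by
    rw [← hQ, integral_map measurable_snd.aemeasurable (by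
      exact (Measurable.mul hFm hβm).aestronglyMeasurable)]
    refine integral_congr_ae ?_
    filter_upwards [hbE] with z hz
    rw [← hz]
  have e4 : ∫ x, F x * β x ∂Q = ∫ x, v x * β x ∂Q := by
    rw [← integral_condExp (canonFilt_le T t) (f := fun x => v x * β x)]
    refine integral_congr_ae ?_
    exact (condExp_mul_of_stronglyMeasurable_right hβm'.stronglyMeasurable
      (hv.mul_bdd hβm.aestronglyMeasurable (Eventually.of_forall hβb)) hv).symm
  have e5 : ∫ x, v x * β x ∂Q = ∫ z, v z.2 * β z.2 ∂π := by
    rw [← hQ, integral_map measurable_snd.aemeasurable (by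
      exact (hvm.mul hβm).aestronglyMeasurable)]
  simp_rw [mul_comm _ (v _)]
  rw [e1, e2, e3, e4, e5]

/-! ### Integrability and elementary properties of the value -/

lemma mul_rpow_sub_one {b : ℝ} (hb : 0 < b) : b ^ (p - 1) * b = b ^ p := by
  rw [Real.rpow_sub_one hb.ne']; field_simp

lemma integrable_norm_growth {Q : Measure (Path T)} (hp : 0 < p) (hQ : Q ∈ probMeasures p T) :
    Integrable (fun x : Path T => (1 + ‖x‖) ^ p) Q :=
  have := hQ.1
  integrable_one_add_norm_rpow hp hQ.2

lemma measurable_terminal (hg : Continuous g) {a : Path T → Fin T → ℝ} (ha : a ∈ controls T L) :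
    Measurable (terminal x₀ g a) :=
  measurable_wealth_comp hg (measurable_of_mem_controls ha) measurable_id

lemma Regular.integrable_loss (h : Regular p L l g) (x₀ : ℝ) {Q : Measure (Path T)}
    (hQ : Q ∈ probMeasures p T) {a : Path T → Fin T → ℝ} (ha : a ∈ controls T L) :
    Integrable (fun x => l (terminal x₀ g a x)) Q := by
  obtain ⟨C, -, hC⟩ := h.exists_growth x₀
  exact integrable_of_growth (integrable_norm_growth (by linarith [h.one_lt]) hQ)
    (h.loss.continuous.measurable.comp (measurable_terminal h.cont_payoff ha))
    fun x => (hC (a x) x fun t => (ha t).2 x).2.2.1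

lemma Regular.integrable_deriv_mul (h : Regular p L l g) (x₀ : ℝ) {Q : Measure (Path T)}
    (hQ : Q ∈ probMeasures p T) {a : Path T → Fin T → ℝ} (ha : a ∈ controls T L)
    {k : Path T → ℝ} (hk : Measurable k) {A : ℝ} (hkA : ∀ x, |k x| ≤ A * (1 + ‖x‖)) :
    Integrable (fun x => deriv l (terminal x₀ g a x) * k x) Q := by
  obtain ⟨C, hC1, hC⟩ := h.exists_growth x₀
  refine integrable_of_growth (C := C * A) (integrable_norm_growth (by linarith [h.one_lt]) hQ)
    ((h.cont_deriv.measurable.comp (measurable_terminal h.cont_payoff ha)).mul hk) fun x => ?_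
  rw [abs_mul, ← mul_rpow_sub_one (by positivity)]
  calc _ ≤ (C * (1 + ‖x‖) ^ (p - 1)) * (A * (1 + ‖x‖)) :=
        mul_le_mul (hC (a x) x fun t => (ha t).2 x).2.1 (hkA x) (abs_nonneg _) (by positivity)
    _ = _ := by ring

lemma Regular.integrable_deriv_mul_bdd (h : Regular p L l g) (x₀ : ℝ) {Q : Measure (Path T)}
    (hQ : Q ∈ probMeasures p T) {a : Path T → Fin T → ℝ} (ha : a ∈ controls T L)
    {k : Path T → ℝ} (hk : Measurable k) {A : ℝ} (hkA : ∀ x, |k x| ≤ A) :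
    Integrable (fun x => deriv l (terminal x₀ g a x) * k x) Q := by
  refine h.integrable_deriv_mul x₀ hQ ha hk (A := A) fun x => (hkA x).trans ?_
  have : 0 ≤ A := (abs_nonneg _).trans (hkA x)
  nlinarith [norm_nonneg x]

lemma Regular.integrable_deriv (h : Regular p L l g) (x₀ : ℝ) {Q : Measure (Path T)}
    (hQ : Q ∈ probMeasures p T) {a : Path T → Fin T → ℝ} (ha : a ∈ controls T L) :
    Integrable (fun x => deriv l (terminal x₀ g a x)) Q := by
  have := h.integrable_deriv_mul_bdd x₀ hQ ha (k := fun _ => 1) measurable_const (A := 1) (by simp)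
  simpa using this

lemma zero_mem_controls (hL : 0 ≤ L) : (0 : Path T → Fin T → ℝ) ∈ controls T L :=
  fun t => ⟨@measurable_const _ _ _ (canonFilt T t) _, fun x => by simpa using hL⟩

lemma combo_mem_controls {a b : Path T → Fin T → ℝ} (ha : a ∈ controls T L)
    (hb : b ∈ controls T L) {s : ℝ} (h0 : 0 ≤ s) (h1 : s ≤ 1) :
    (fun x t => (1 - s) * a x t + s * b x t) ∈ controls T L := by
  refine fun t => ⟨?_, fun x => ?_⟩
  · have hm : Measurable fun q : ℝ × ℝ => (1 - s) * q.1 + s * q.2 := by fun_prop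
    exact hm.comp (Measurable.prodMk (ha t).1 (hb t).1)
  · refine (abs_add_le _ _).trans ?_
    rw [abs_mul, abs_mul, abs_of_nonneg h0, abs_of_nonneg (by linarith : 0 ≤ 1 - s)]
    have h2 := (ha t).2 x
    have h3 := (hb t).2 x
    nlinarith

lemma bddBelow_expLoss (h : Regular p L l g) (x₀ : ℝ) {Q : Measure (Path T)}
    (hQ : Q ∈ probMeasures p T) : BddBelow (expLoss x₀ l g Q '' controls T L) := by
  obtain ⟨c, hc⟩ := h.bddBelow
  have := hQ.1
  refine ⟨c, ?_⟩
  rintro _ ⟨a, ha, rfl⟩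
  have := integral_mono (integrable_const c) (h.integrable_loss x₀ hQ ha)
    fun x => hc (Set.mem_range_self (terminal x₀ g a x))
  simpa [expLoss] using this

lemma value_le_expLoss (h : Regular p L l g) (x₀ : ℝ) {Q : Measure (Path T)}
    (hQ : Q ∈ probMeasures p T) {a : Path T → Fin T → ℝ} (ha : a ∈ controls T L) :
    value L x₀ l g Q ≤ expLoss x₀ l g Q a :=
  csInf_le (bddBelow_expLoss h x₀ hQ) (Set.mem_image_of_mem _ ha)

lemma le_value (hL : 0 ≤ L) {Q : Measure (Path T)} {c : ℝ}
    (hc : ∀ a ∈ controls T L, c ≤ expLoss x₀ l g Q a) : c ≤ value L x₀ l g Q := by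
  refine le_csInf ⟨_, Set.mem_image_of_mem _ (zero_mem_controls hL)⟩ ?_
  rintro _ ⟨a, ha, rfl⟩
  exact hc a ha

lemma exists_expLoss_lt (hL : 0 ≤ L) {Q : Measure (Path T)} {δ : ℝ} (hδ : 0 < δ) :
    ∃ a ∈ controls T L, expLoss x₀ l g Q a < value L x₀ l g Q + δ := by
  obtain ⟨_, ⟨a, ha, rfl⟩, h⟩ := exists_lt_of_csInf_lt
    (⟨_, Set.mem_image_of_mem _ (zero_mem_controls hL)⟩ :
      (expLoss x₀ l g Q '' controls T L).Nonempty) (lt_add_of_pos_right (value L x₀ l g Q) hδ)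
  exact ⟨a, ha, h⟩

lemma terminal_combo (s : ℝ) (a b : Path T → Fin T → ℝ) (x : Path T) :
    terminal x₀ g (fun x t => (1 - s) * a x t + s * b x t) x =
      (1 - s) * terminal x₀ g a x + s * terminal x₀ g b x :=
  wealth_combo s (a x) (b x) x

/-- Convexity of the expected loss in the control. -/
lemma expLoss_combo_le (h : Regular p L l g) (x₀ : ℝ) {Q : Measure (Path T)}
    (hQ : Q ∈ probMeasures p T) {a b : Path T → Fin T → ℝ} (ha : a ∈ controls T L)
    (hb : b ∈ controls T L) {s : ℝ} (h0 : 0 ≤ s) (h1 : s ≤ 1) :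
    expLoss x₀ l g Q (fun x t => (1 - s) * a x t + s * b x t) ≤
      (1 - s) * expLoss x₀ l g Q a + s * expLoss x₀ l g Q b := by
  have i1 := h.integrable_loss x₀ hQ ha
  have i2 := h.integrable_loss x₀ hQ hb
  rw [expLoss, expLoss, expLoss, ← integral_const_mul, ← integral_const_mul,
    ← integral_add (i1.const_mul _) (i2.const_mul _)]
  refine integral_mono (h.integrable_loss x₀ hQ (combo_mem_controls ha hb h0 h1))
    ((i1.const_mul _).add (i2.const_mul _)) fun x => ?_
  simp only [terminal_combo]
  exact h.strictConvexOn.convexOn.2 (Set.mem_univ _) (Set.mem_univ _) (by linarith) h0 (by ring)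

lemma tendsto_expLoss (h : Regular p L l g) (x₀ : ℝ) {Q : Measure (Path T)}
    (hQ : Q ∈ probMeasures p T) {s : ℕ → Path T → Fin T → ℝ} (hs : ∀ n, s n ∈ controls T L)
    {a : Path T → Fin T → ℝ}
    (hlim : ∀ᵐ x ∂Q, ∀ t, Tendsto (fun n => s n x t) atTop (𝓝 (a x t))) :
    Tendsto (fun n => expLoss x₀ l g Q (s n)) atTop (𝓝 (expLoss x₀ l g Q a)) := by
  obtain ⟨C, -, hC⟩ := h.exists_growth x₀
  refine tendsto_integral_of_dominated_convergence (fun x => C * (1 + ‖x‖) ^ p)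
    (fun n => (h.integrable_loss x₀ hQ (hs n)).1)
    ((integrable_norm_growth (by linarith [h.one_lt]) hQ).const_mul C)
    (fun n => Eventually.of_forall fun x => (hC (s n x) x fun t => (hs n t).2 x).2.2.1) ?_
  filter_upwards [hlim] with x hx
  have hc : Continuous fun α : Path T => l (wealth x₀ g α x) :=
    (continuous_loss_wealth h).comp (by fun_prop : Continuous fun α : Path T => (α, x))
  exact (hc.tendsto (a x)).comp (tendsto_pi_nhds.2 hx)

/-! ### Existence of an optimizer -/

/-- The squared `L²`-norm of a control. -/
def controlEnergy (P : Measure (Path T)) (a : Path T → Fin T → ℝ) : ℝ :=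
  ∫ x, ∑ t, a x t ^ 2 ∂P

lemma integrable_sq {P : Measure (Path T)} [IsProbabilityMeasure P] {f : Path T → ℝ} {M : ℝ}
    (hf : Measurable f) (hM : ∀ x, |f x| ≤ M) : Integrable (fun x => f x ^ 2) P :=
  Integrable.of_bound (hf.pow_const 2).aestronglyMeasurable (M ^ 2) (Eventually.of_forall fun x => by
    rw [Real.norm_eq_abs, abs_pow]
    exact pow_le_pow_left₀ (abs_nonneg _) (hM x) 2)

lemma controlEnergy_midpoint {P : Measure (Path T)} [IsProbabilityMeasure P]
    {a b : Path T → Fin T → ℝ} (ha : a ∈ controls T L) (hb : b ∈ controls T L) :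
    controlEnergy P (fun x t => (1 - 1 / 2) * a x t + 1 / 2 * b x t) =
      (controlEnergy P a + controlEnergy P b) / 2 - controlEnergy P (fun x t => a x t - b x t) / 4 := by
  have ham := fun t => (measurable_pi_apply t).comp (measurable_of_mem_controls ha)
  have hbm := fun t => (measurable_pi_apply t).comp (measurable_of_mem_controls hb)
  have i1 : Integrable (fun x => ∑ t, a x t ^ 2) P :=
    integrable_finsetSum _ fun t _ => integrable_sq (ham t) (ha t).2
  have i2 : Integrable (fun x => ∑ t, b x t ^ 2) P :=
    integrable_finsetSum _ fun t _ => integrable_sq (hbm t) (hb t).2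
  have i3 : Integrable (fun x => ∑ t, (a x t - b x t) ^ 2) P :=
    integrable_finsetSum _ fun t _ => integrable_sq (M := L + L) ((ham t).sub (hbm t)) fun x =>
      (abs_sub _ _).trans (add_le_add ((ha t).2 x) ((hb t).2 x))
  have e1 := integral_sub ((i1.add i2).div_const 2) (i3.div_const 4)
  simp only [Pi.add_apply] at e1
  rw [controlEnergy, controlEnergy, controlEnergy, controlEnergy, ← integral_add i1 i2,
    ← integral_div, ← integral_div, ← e1]
  refine integral_congr_ae (Eventually.of_forall fun x => ?_)
  simp only [← Finset.sum_add_distrib, Finset.sum_div, ← Finset.sum_sub_distrib]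
  refine Finset.sum_congr rfl fun t _ => ?_
  ring

/-- For a decreasing sequence of nonempty midpoint-convex sets `C n` of controls, some choice of
elements `s n` of `C n` converges almost surely to a control: by the parallelogram identity, elements
of nearly minimal `L²`-norm form a Cauchy sequence. This replaces weak compactness of the set of controls. -/
theorem exists_tendsto_of_nested {P : Measure (Path T)} [IsProbabilityMeasure P] (hL : 0 ≤ L)
    {C : ℕ → Set (Path T → Fin T → ℝ)} (hC : ∀ n, C n ⊆ controls T L) (hne : ∀ n, (C n).Nonempty)
    (hanti : Antitone C)
    (hmid : ∀ n, ∀ a ∈ C n, ∀ b ∈ C n, (fun x t => (1 - 1 / 2) * a x t + 1 / 2 * b x t) ∈ C n) :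
    ∃ a ∈ controls T L, ∃ s : ℕ → Path T → Fin T → ℝ, (∀ n, s n ∈ C n) ∧
      ∀ᵐ x ∂P, ∀ t, Tendsto (fun n => s n x t) atTop (𝓝 (a x t)) := by
  have hJ0 : ∀ a, 0 ≤ controlEnergy P a := fun a =>
    integral_nonneg fun x => Finset.sum_nonneg fun t _ => sq_nonneg _
  have hJb : ∀ a ∈ controls T L, controlEnergy P a ≤ T * L ^ 2 := fun a ha => by
    have hm := fun t => (measurable_pi_apply t).comp (measurable_of_mem_controls ha)
    have i1 : Integrable (fun x => ∑ t, a x t ^ 2) P :=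
      integrable_finsetSum _ fun t _ => integrable_sq (hm t) (ha t).2
    have := integral_mono i1 (integrable_const (μ := P) (T * L ^ 2 : ℝ)) fun x => by
      have : ∑ t, a x t ^ 2 ≤ ∑ _t : Fin T, L ^ 2 := Finset.sum_le_sum fun t _ => by
        rw [← sq_abs]; exact pow_le_pow_left₀ (abs_nonneg _) ((ha t).2 x) 2
      simpa using this
    simpa [controlEnergy] using this
  set d : ℕ → ℝ := fun n => sInf (controlEnergy P '' C n) with hd
  have hbelow : ∀ n, BddBelow (controlEnergy P '' C n) := fun n =>
    ⟨0, by rintro _ ⟨a, -, rfl⟩; exact hJ0 a⟩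
  have hdle : ∀ n, ∀ a ∈ C n, d n ≤ controlEnergy P a := fun n a ha =>
    csInf_le (hbelow n) (Set.mem_image_of_mem _ ha)
  have hdmono : Monotone d := fun m n hmn =>
    csInf_le_csInf (hbelow m) ((hne n).image _) (Set.image_mono (hanti hmn))
  have hdb : BddAbove (Set.range d) := ⟨T * L ^ 2, by
    rintro _ ⟨n, rfl⟩
    obtain ⟨a, ha⟩ := hne n
    exact (hdle n a ha).trans (hJb a (hC n ha))⟩
  set D := ⨆ n, d n with hD
  have hdD : Tendsto d atTop (𝓝 D) := tendsto_atTop_ciSup hdmono hdb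
  have hdleD : ∀ n, d n ≤ D := fun n => le_ciSup hdb n
  have hex : ∀ n : ℕ, ∃ a ∈ C n, controlEnergy P a < d n + 1 / ((n : ℝ) + 1) := fun n => by
    obtain ⟨_, ⟨a, ha, rfl⟩, h⟩ := exists_lt_of_csInf_lt ((hne n).image (controlEnergy P))
      (lt_add_of_pos_right (d n) (by positivity : (0 : ℝ) < 1 / ((n : ℝ) + 1)))
    exact ⟨a, ha, h⟩
  choose a haC haJ using hex
  have hcau : ∀ N n m : ℕ, N ≤ n → N ≤ m →
      controlEnergy P (fun x t => a n x t - a m x t) ≤ 4 * (D - d N) + 4 * (1 / ((N : ℝ) + 1)) := by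
    intro N n m hn hm
    have h1 := hdle N _ (hmid N _ (hanti hn (haC n)) _ (hanti hm (haC m)))
    rw [controlEnergy_midpoint (hC n (haC n)) (hC m (haC m))] at h1
    have h2 : ∀ k, N ≤ k → controlEnergy P (a k) ≤ D + 1 / ((N : ℝ) + 1) := fun k hk => by
      have : 1 / ((k : ℝ) + 1) ≤ 1 / ((N : ℝ) + 1) := by
        apply one_div_le_one_div_of_le (by positivity)
        have : (N : ℝ) ≤ k := by exact_mod_cast hk
        linarith
      linarith [haJ k, hdleD k]
    linarith [h2 n hn, h2 m hm]
  have hE : Tendsto (fun N : ℕ => 4 * (D - d N) + 4 * (1 / ((N : ℝ) + 1))) atTop (𝓝 0) := by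
    have := ((hdD.const_sub D).const_mul 4).add
      ((tendsto_one_div_add_atTop_nhds_zero_nat (𝕜 := ℝ)).const_mul 4)
    simpa using this
  obtain ⟨φ, hφ, hφE⟩ := extraction_forall_of_eventually
    (P := fun k n => 4 * (D - d n) + 4 * (1 / ((n : ℝ) + 1)) < (1 / 4) ^ k)
    fun k => hE.eventually (gt_mem_nhds (by positivity))
  set s : ℕ → Path T → Fin T → ℝ := fun k => a (φ k) with hs
  have hsC : ∀ n, s n ∈ C n := fun n => hanti hφ.le_apply (haC (φ n))
  have hsm : ∀ n t, Measurable fun x => s n x t := fun n t =>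
    (measurable_pi_apply t).comp (measurable_of_mem_controls (hC n (hsC n)))
  have hconv : ∀ t, ∀ᵐ x ∂P, ∃ y : ℝ, Tendsto (fun n => s n x t) atTop (𝓝 y) := by
    intro t
    refine Lp.ae_tendsto_of_cauchy_eLpNorm (p := 2) (B := fun n => ENNReal.ofReal ((1 / 2) ^ n))
      (fun n => (hsm n t).aestronglyMeasurable) (by norm_num) ?_ fun N n m hn hm => ?_
    · rw [← ENNReal.ofReal_tsum_of_nonneg (fun n => by positivity)
        (summable_geometric_of_lt_one (by norm_num) (by norm_num))]
      exact ENNReal.ofReal_ne_top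
    · have hb : ∀ x, |s n x t - s m x t| ≤ L + L := fun x =>
        (abs_sub _ _).trans (add_le_add ((hC n (hsC n) t).2 x) ((hC m (hsC m) t).2 x))
      have hmem : MemLp ((fun x => s n x t) - fun x => s m x t) 2 P :=
        MemLp.of_bound ((hsm n t).sub (hsm m t)).aestronglyMeasurable (L + L)
          (Eventually.of_forall hb)
      rw [hmem.eLpNorm_eq_integral_rpow_norm (by norm_num) (by norm_num)]
      refine ENNReal.ofReal_lt_ofReal_iff (by positivity) |>.2 ?_
      have h1 : ∫ x, (s n x t - s m x t) ^ 2 ∂P ≤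
          controlEnergy P (fun x t => s n x t - s m x t) := by
        refine integral_mono (integrable_sq ((hsm n t).sub (hsm m t)) hb)
          (integrable_finsetSum _ fun u _ => integrable_sq (M := L + L)
            ((hsm n u).sub (hsm m u)) fun x =>
            (abs_sub _ _).trans (add_le_add ((hC n (hsC n) u).2 x) ((hC m (hsC m) u).2 x)))
          fun x => ?_
        exact Finset.single_le_sum (f := fun u => (s n x u - s m x u) ^ 2)
          (fun u _ => sq_nonneg _) (Finset.mem_univ t)
      have h2 : ∫ x, (s n x t - s m x t) ^ 2 ∂P < (1 / 4) ^ N :=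
        (h1.trans (hcau (φ N) _ _ (hφ.monotone hn) (hφ.monotone hm))).trans_lt (hφE N)
      have h3 : ∫ x, ‖((fun x => s n x t) - fun x => s m x t) x‖ ^ (2 : ℝ≥0∞).toReal ∂P =
          ∫ x, (s n x t - s m x t) ^ 2 ∂P := by
        refine integral_congr_ae (Eventually.of_forall fun x => ?_)
        simp
      rw [h3, ENNReal.toReal_ofNat, ← one_div, ← Real.sqrt_eq_rpow,
        Real.sqrt_lt' (by positivity)]
      refine h2.trans_eq ?_
      rw [← pow_mul, mul_comm N 2, pow_mul]; norm_num
  have hclip : Measurable fun y : ℝ => max (-L) (min L y) := by fun_prop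
  refine ⟨fun x t => max (-L) (min L (limsup (fun n => s n x t) atTop)), fun t => ⟨?_, fun x => ?_⟩,
    s, hsC, ?_⟩
  · exact hclip.comp (Measurable.limsup (mδ := canonFilt T t) fun n => (hC n (hsC n) t).1)
  · rw [abs_le]
    exact ⟨le_max_left _ _, max_le (by linarith) (min_le_left _ _)⟩
  · filter_upwards [ae_all_iff.2 hconv] with x hx t
    obtain ⟨y, hy⟩ := hx t
    have hy1 : y ≤ L := le_of_tendsto' hy fun n => (abs_le.1 ((hC n (hsC n) t).2 x)).2
    have hy2 : -L ≤ y := ge_of_tendsto' hy fun n => (abs_le.1 ((hC n (hsC n) t).2 x)).1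
    rw [hy.limsup_eq, min_eq_right hy1, max_eq_right hy2]
    exact hy

/-- If the near-optimizers with an additional midpoint-convex property are never exhausted, there is
an optimizer that is an almost sure limit of such near-optimizers. -/
theorem exists_optimizer_of_near (h : Regular p L l g) (x₀ : ℝ) {P : Measure (Path T)}
    (hP : P ∈ probMeasures p T) {S : Set (Path T → Fin T → ℝ)}
    (hS : ∀ a ∈ S, ∀ b ∈ S, (fun x t => (1 - 1 / 2) * a x t + 1 / 2 * b x t) ∈ S)
    (hnear : ∀ δ : ℝ, 0 < δ → ∃ a ∈ controls T L, a ∈ S ∧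
      expLoss x₀ l g P a ≤ value L x₀ l g P + δ) :
    ∃ a, IsOptimizer L x₀ l g P a ∧ ∃ s : ℕ → Path T → Fin T → ℝ, (∀ n, s n ∈ controls T L) ∧
      (∀ n, s n ∈ S) ∧ ∀ᵐ x ∂P, ∀ t, Tendsto (fun n => s n x t) atTop (𝓝 (a x t)) := by
  have := hP.1
  obtain ⟨a, ha, s, hsC, hs⟩ := exists_tendsto_of_nested (P := P) h.nonneg
    (C := fun n : ℕ => {a | a ∈ controls T L ∧ a ∈ S ∧
      expLoss x₀ l g P a ≤ value L x₀ l g P + 1 / ((n : ℝ) + 1)})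
    (fun n a ha => ha.1)
    (fun n => by
      obtain ⟨a, h1, h2, h3⟩ := hnear (1 / ((n : ℝ) + 1)) (by positivity)
      exact ⟨a, h1, h2, h3⟩)
    (fun m n hmn a ha => ⟨ha.1, ha.2.1, ha.2.2.trans (by
      have : (m : ℝ) ≤ n := by exact_mod_cast hmn
      gcongr)⟩)
    (fun n a ha b hb => ⟨combo_mem_controls ha.1 hb.1 (by norm_num) (by norm_num),
      hS a ha.2.1 b hb.2.1, by
        have := expLoss_combo_le h x₀ hP ha.1 hb.1 (s := 1 / 2) (by norm_num) (by norm_num)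
        have := ha.2.2
        have := hb.2.2
        linarith⟩)
  refine ⟨a, ⟨ha, le_antisymm ?_ (value_le_expLoss h x₀ hP ha)⟩, s, fun n => (hsC n).1,
    fun n => (hsC n).2.1, hs⟩
  have h1 := tendsto_expLoss h x₀ hP (fun n => (hsC n).1) hs
  have h2 : Tendsto (fun n : ℕ => value L x₀ l g P + 1 / ((n : ℝ) + 1)) atTop
      (𝓝 (value L x₀ l g P)) := by
    have := (tendsto_one_div_add_atTop_nhds_zero_nat (𝕜 := ℝ)).const_add (value L x₀ l g P)
    simpa using this
  exact le_of_tendsto_of_tendsto' h1 h2 fun n => (hsC n).2.2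

theorem exists_isOptimizer (h : Regular p L l g) (x₀ : ℝ) {P : Measure (Path T)}
    (hP : P ∈ probMeasures p T) : ∃ a, IsOptimizer L x₀ l g P a := by
  obtain ⟨a, ha, -⟩ := exists_optimizer_of_near h x₀ hP (S := Set.univ)
    (fun _ _ _ _ => Set.mem_univ _) fun δ hδ => by
      obtain ⟨a, ha, hlt⟩ := exists_expLoss_lt (x₀ := x₀) (l := l) (g := g) h.nonneg (Q := P) hδ
      exact ⟨a, ha, Set.mem_univ _, hlt.le⟩
  exact ⟨a, ha⟩

/-! ### Strict convexity and the first-order condition -/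

/-- The convexity defect of `l` at the midpoint of `u` and `v`. -/
def midpointGap (l : ℝ → ℝ) (u v : ℝ) : ℝ := (l u + l v) / 2 - l ((u + v) / 2)

lemma Regular.midpointGap_nonneg (h : Regular p L l g) (u v : ℝ) : 0 ≤ midpointGap l u v := by
  have := h.strictConvexOn.convexOn.2 (Set.mem_univ u) (Set.mem_univ v)
    (by norm_num : (0 : ℝ) ≤ 1 / 2) (by norm_num : (0 : ℝ) ≤ 1 / 2) (by norm_num)
  simp only [smul_eq_mul] at this
  rw [midpointGap, show (u + v) / 2 = 1 / 2 * u + 1 / 2 * v by ring]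
  linarith

lemma Regular.midpointGap_pos (h : Regular p L l g) {u v : ℝ} (huv : u ≠ v) :
    0 < midpointGap l u v := by
  have := h.strictConvexOn.2 (Set.mem_univ u) (Set.mem_univ v) huv
    (by norm_num : (0 : ℝ) < 1 / 2) (by norm_num : (0 : ℝ) < 1 / 2) (by norm_num)
  simp only [smul_eq_mul] at this
  rw [midpointGap, show (u + v) / 2 = 1 / 2 * u + 1 / 2 * v by ring]
  linarith

lemma terminal_midpoint (a b : Path T → Fin T → ℝ) (x : Path T) :
    terminal x₀ g (fun x t => (1 - 1 / 2) * a x t + 1 / 2 * b x t) x =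
      (terminal x₀ g a x + terminal x₀ g b x) / 2 := by
  rw [terminal_combo]; ring

lemma Regular.integrable_midpointGap (h : Regular p L l g) (x₀ : ℝ) {P : Measure (Path T)}
    (hP : P ∈ probMeasures p T) {a b : Path T → Fin T → ℝ} (ha : a ∈ controls T L)
    (hb : b ∈ controls T L) :
    Integrable (fun x => midpointGap l (terminal x₀ g a x) (terminal x₀ g b x)) P := by
  have i3 := h.integrable_loss x₀ hP
    (combo_mem_controls ha hb (s := 1 / 2) (by norm_num) (by norm_num))
  simp only [terminal_midpoint] at i3
  exact (((h.integrable_loss x₀ hP ha).add (h.integrable_loss x₀ hP hb)).div_const 2).sub i3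

lemma Regular.integral_midpointGap_le (h : Regular p L l g) (x₀ : ℝ) {P : Measure (Path T)}
    (hP : P ∈ probMeasures p T) {a b : Path T → Fin T → ℝ} (ha : a ∈ controls T L)
    (hb : b ∈ controls T L) :
    ∫ x, midpointGap l (terminal x₀ g a x) (terminal x₀ g b x) ∂P ≤
      (expLoss x₀ l g P a + expLoss x₀ l g P b) / 2 - value L x₀ l g P := by
  have i1 := h.integrable_loss x₀ hP ha
  have i2 := h.integrable_loss x₀ hP hb
  have hm := combo_mem_controls ha hb (s := 1 / 2) (by norm_num) (by norm_num)
  have i3 := h.integrable_loss x₀ hP hm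
  have h3 := value_le_expLoss h x₀ hP hm
  rw [expLoss] at h3
  simp only [terminal_midpoint] at i3 h3
  have e1 := integral_sub ((i1.add i2).div_const 2) i3
  simp only [Pi.add_apply] at e1
  unfold midpointGap
  rw [e1, integral_div, integral_add i1 i2]
  simp only [expLoss]
  linarith

theorem terminal_ae_eq_of_isOptimizer (h : Regular p L l g) {P : Measure (Path T)}
    (hP : P ∈ probMeasures p T) {a b : Path T → Fin T → ℝ} (ha : IsOptimizer L x₀ l g P a)
    (hb : IsOptimizer L x₀ l g P b) : terminal x₀ g a =ᵐ[P] terminal x₀ g b := by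
  have h1 := h.integral_midpointGap_le x₀ hP ha.1 hb.1
  rw [ha.2, hb.2] at h1
  have h2 := (integral_eq_zero_iff_of_nonneg (fun x => h.midpointGap_nonneg _ _)
    (h.integrable_midpointGap x₀ hP ha.1 hb.1)).1
    (le_antisymm (by linarith) (integral_nonneg fun x => h.midpointGap_nonneg _ _))
  filter_upwards [h2] with x hx
  by_contra hne
  exact (h.midpointGap_pos hne).ne' hx

lemma Regular.abs_deriv_sub_le_gap (h : Regular p L l g) (R : ℝ) {ε : ℝ} (hε : 0 < ε) :
    ∃ K : ℝ, 0 ≤ K ∧ ∀ u v : ℝ, |u| ≤ R → |v| ≤ R →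
      |deriv l u - deriv l v| ≤ ε + K * midpointGap l u v := by
  set B : Set (ℝ × ℝ) := Metric.closedBall 0 R ×ˢ Metric.closedBall 0 R with hB
  have hBc : IsCompact B := (isCompact_closedBall _ _).prod (isCompact_closedBall _ _)
  have hd : Continuous fun z : ℝ × ℝ => |deriv l z.1 - deriv l z.2| := by
    have := h.cont_deriv; fun_prop
  have hgc : Continuous fun z : ℝ × ℝ => midpointGap l z.1 z.2 := by
    have := h.loss.continuous; unfold midpointGap; fun_prop
  obtain ⟨M, hM⟩ := hBc.exists_bound_of_continuousOn hd.continuousOn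
  set S : Set (ℝ × ℝ) := B ∩ {z | ε ≤ |deriv l z.1 - deriv l z.2|} with hS
  have hSc : IsCompact S := hBc.inter_right (isClosed_le continuous_const hd)
  have hmem : ∀ u v : ℝ, |u| ≤ R → |v| ≤ R → (u, v) ∈ B := fun u v hu hv => by
    simp [hB, hu, hv]
  rcases S.eq_empty_or_nonempty with hemp | hne
  · refine ⟨0, le_rfl, fun u v hu hv => ?_⟩
    by_contra hcon
    have : (u, v) ∈ S := ⟨hmem u v hu hv, by simp only [Set.mem_ofPred_eq]; linarith⟩
    rw [hemp] at this
    exact this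
  · obtain ⟨z, hz, hmin⟩ := hSc.exists_isMinOn hne hgc.continuousOn
    have hzpos : 0 < midpointGap l z.1 z.2 := by
      refine h.midpointGap_pos fun e => ?_
      have := hz.2
      simp only [Set.mem_ofPred_eq, e, sub_self, abs_zero] at this
      linarith
    have hM0 : 0 ≤ M := (norm_nonneg _).trans (hM z hz.1)
    refine ⟨M / midpointGap l z.1 z.2, by positivity, fun u v hu hv => ?_⟩
    have hg0 := h.midpointGap_nonneg u v
    by_cases hc : ε ≤ |deriv l u - deriv l v|
    · have h1 : midpointGap l z.1 z.2 ≤ midpointGap l u v := hmin ⟨hmem u v hu hv, hc⟩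
      have h2 : |deriv l u - deriv l v| ≤ M := by
        have := hM (u, v) (hmem u v hu hv)
        rwa [Real.norm_eq_abs, abs_abs] at this
      have h3 : M ≤ M / midpointGap l z.1 z.2 * midpointGap l u v := by
        rw [div_mul_eq_mul_div, le_div_iff₀ hzpos]; gcongr
      linarith
    · have : 0 ≤ M / midpointGap l z.1 z.2 * midpointGap l u v := by positivity
      linarith

/-- The marginal loss of near-optimizers is close in `L¹` to that of an optimizer. -/
theorem Regular.exists_integral_abs_deriv_sub_le (h : Regular p L l g) {P : Measure (Path T)}
    (hP : P ∈ probMeasures p T) {b : Path T → Fin T → ℝ} (hb : IsOptimizer L x₀ l g P b)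
    {ε : ℝ} (hε : 0 < ε) : ∃ δ : ℝ, 0 < δ ∧ ∀ a ∈ controls T L,
      expLoss x₀ l g P a ≤ value L x₀ l g P + δ →
      ∫ x, |deriv l (terminal x₀ g a x) - deriv l (terminal x₀ g b x)| ∂P ≤ ε := by
  have hPp := hP.1
  have hp := h.one_lt
  obtain ⟨C, hC1, hC⟩ := h.exists_growth x₀
  have hPi := integrable_norm_growth (by linarith) hP
  obtain ⟨n, hn⟩ : ∃ n : ℕ, 2 * C * ∫ x, {x : Path T | (n : ℝ) < ‖x‖}.indicator
      (fun x => (1 + ‖x‖) ^ p) x ∂P < ε / 3 := by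
    have h1 := (tendsto_tail hPi).const_mul (2 * C)
    rw [mul_zero] at h1
    exact (h1.eventually (gt_mem_nhds (by positivity))).exists
  obtain ⟨K, hK, hgap⟩ := h.abs_deriv_sub_le_gap (C * (1 + n)) (ε := ε / 3) (by positivity)
  refine ⟨ε / (3 * (K + 1)), by positivity, fun a ha hle => ?_⟩
  have hm : MeasurableSet {x : Path T | (n : ℝ) < ‖x‖} :=
    measurableSet_lt measurable_const measurable_norm
  set tail : Path T → ℝ := {x : Path T | (n : ℝ) < ‖x‖}.indicator (fun x => (1 + ‖x‖) ^ p)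
  have itail : Integrable tail P := hPi.indicator hm
  have ig := h.integrable_midpointGap x₀ hP ha hb.1
  have hpt : ∀ x, |deriv l (terminal x₀ g a x) - deriv l (terminal x₀ g b x)| ≤
      (ε / 3 + K * midpointGap l (terminal x₀ g a x) (terminal x₀ g b x)) + 2 * C * tail x := by
    intro x
    have ha' := hC (a x) x fun t => (ha t).2 x
    have hb' := hC (b x) x fun t => (hb.1 t).2 x
    have htail0 : 0 ≤ 2 * C * tail x :=
      mul_nonneg (by positivity) (Set.indicator_nonneg (fun x _ => by positivity) x)
    by_cases hx : (n : ℝ) < ‖x‖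
    · have e : tail x = (1 + ‖x‖) ^ p := Set.indicator_of_mem (by exact hx) _
      have h1 : (1 + ‖x‖) ^ (p - 1) ≤ (1 + ‖x‖) ^ p :=
        Real.rpow_le_rpow_of_exponent_le (by linarith [norm_nonneg x]) (by linarith)
      have h2 := abs_sub (deriv l (terminal x₀ g a x)) (deriv l (terminal x₀ g b x))
      have h3 : |deriv l (terminal x₀ g a x)| ≤ C * (1 + ‖x‖) ^ (p - 1) := ha'.2.1
      have h4 : |deriv l (terminal x₀ g b x)| ≤ C * (1 + ‖x‖) ^ (p - 1) := hb'.2.1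
      have h5 := mul_nonneg hK (h.midpointGap_nonneg (terminal x₀ g a x) (terminal x₀ g b x))
      rw [e]
      nlinarith
    · rw [not_lt] at hx
      have h1 : |terminal x₀ g a x| ≤ C * (1 + n) := ha'.1.trans (by gcongr)
      have h2 : |terminal x₀ g b x| ≤ C * (1 + n) := hb'.1.trans (by gcongr)
      linarith [hgap _ _ h1 h2]
  have h1 := integral_mono_of_nonneg (Eventually.of_forall fun x => abs_nonneg _)
    (((integrable_const (ε / 3)).add (ig.const_mul K)).add (itail.const_mul (2 * C)))
    (Eventually.of_forall hpt)
  refine h1.trans ?_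
  rw [integral_add' ((integrable_const (ε / 3)).add (ig.const_mul K)) (itail.const_mul (2 * C)),
    integral_add' (integrable_const (ε / 3)) (ig.const_mul K), integral_const_mul,
    integral_const_mul]
  simp only [integral_const, probReal_univ, smul_eq_mul, one_mul]
  have h2 := h.integral_midpointGap_le x₀ hP ha hb.1
  rw [hb.2] at h2
  have h3 : K * ∫ x, midpointGap l (terminal x₀ g a x) (terminal x₀ g b x) ∂P ≤ ε / 3 := by
    have h4 : K * (ε / (3 * (K + 1))) ≤ ε / 3 := by
      rw [mul_div_assoc', div_le_div_iff₀ (by positivity) (by positivity)]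
      nlinarith
    have h5 : 0 < ε / (3 * (K + 1)) := by positivity
    nlinarith
  linarith

/-- The first-order condition for an optimizer. -/
theorem IsOptimizer.integral_deriv_mul_nonneg (h : Regular p L l g) {P : Measure (Path T)}
    (hP : P ∈ probMeasures p T) {b : Path T → Fin T → ℝ} (hb : IsOptimizer L x₀ l g P b)
    {a : Path T → Fin T → ℝ} (ha : a ∈ controls T L) :
    0 ≤ ∫ x, deriv l (terminal x₀ g b x) * (terminal x₀ g a x - terminal x₀ g b x) ∂P := by
  have hp := h.one_lt
  obtain ⟨C, hC1, hC⟩ := h.exists_growth x₀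
  have hPi := integrable_norm_growth (by linarith) hP
  set s : ℕ → ℝ := fun n => 1 / ((n : ℝ) + 1) with hs
  have hs0 : ∀ n, 0 < s n := fun n => by positivity
  have hs1 : ∀ n, s n ≤ 1 := fun n => by
    rw [hs]; simp only; rw [div_le_one (by positivity)]; linarith [Nat.cast_nonneg (α := ℝ) n]
  have hst : Tendsto s atTop (𝓝 0) := tendsto_one_div_add_atTop_nhds_zero_nat
  set c : ℕ → Path T → Fin T → ℝ := fun n x t => (1 - s n) * b x t + s n * a x t with hc
  have hcm : ∀ n, c n ∈ controls T L := fun n => combo_mem_controls hb.1 ha (hs0 n).le (hs1 n)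
  have hct : ∀ n x, terminal x₀ g (c n) x =
      terminal x₀ g b x + s n * (terminal x₀ g a x - terminal x₀ g b x) := fun n x => by
    rw [hc]; simp only [terminal_combo]; ring
  have ham := measurable_terminal (x₀ := x₀) h.cont_payoff ha
  have hbm := measurable_terminal (x₀ := x₀) h.cont_payoff hb.1
  have hkb : ∀ x, |terminal x₀ g a x - terminal x₀ g b x| ≤ (2 * C) * (1 + ‖x‖) := fun x => by
    have h1 : |terminal x₀ g a x| ≤ C * (1 + ‖x‖) := (hC (a x) x fun t => (ha t).2 x).1
    have h2 : |terminal x₀ g b x| ≤ C * (1 + ‖x‖) := (hC (b x) x fun t => (hb.1 t).2 x).1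
    linarith [abs_sub (terminal x₀ g a x) (terminal x₀ g b x)]
  have hi : ∀ n, Integrable (fun x => deriv l (terminal x₀ g (c n) x) *
      (terminal x₀ g a x - terminal x₀ g b x)) P := fun n =>
    h.integrable_deriv_mul x₀ hP (hcm n) (ham.sub hbm) hkb
  -- The tangent at the perturbed position shows that the derivative is nonnegative there.
  have hnonneg : ∀ n, 0 ≤ ∫ x, deriv l (terminal x₀ g (c n) x) *
      (terminal x₀ g a x - terminal x₀ g b x) ∂P := fun n => by
    have i1 := h.integrable_loss x₀ hP (hcm n)
    have i2 := h.integrable_loss x₀ hP hb.1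
    have h1 : expLoss x₀ l g P (c n) - expLoss x₀ l g P b ≤ s n * ∫ x,
        deriv l (terminal x₀ g (c n) x) * (terminal x₀ g a x - terminal x₀ g b x) ∂P := by
      rw [expLoss, expLoss, ← integral_sub i1 i2, ← integral_const_mul]
      refine integral_mono (i1.sub i2) ((hi n).const_mul _) fun x => ?_
      have := h.tangent_le (terminal x₀ g (c n) x) (terminal x₀ g b x)
      have e : terminal x₀ g b x - terminal x₀ g (c n) x =
        -(s n * (terminal x₀ g a x - terminal x₀ g b x)) := by rw [hct]; ring
      rw [e] at this
      simp only
      linarith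
    have h2 := value_le_expLoss h x₀ hP (hcm n)
    rw [hb.2] at h1
    have h3 := hs0 n
    by_contra hneg
    rw [not_le] at hneg
    nlinarith
  refine ge_of_tendsto' (tendsto_integral_of_dominated_convergence
    (fun x => (2 * C * C) * (1 + ‖x‖) ^ p) (fun n => (hi n).1) (hPi.const_mul _)
    (fun n => Eventually.of_forall fun x => ?_) (Eventually.of_forall fun x => ?_)) hnonneg
  · rw [Real.norm_eq_abs, abs_mul, ← mul_rpow_sub_one (by positivity)]
    have h1 : |deriv l (terminal x₀ g (c n) x)| ≤ C * (1 + ‖x‖) ^ (p - 1) :=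
      (hC (c n x) x fun t => (hcm n t).2 x).2.1
    calc _ ≤ (C * (1 + ‖x‖) ^ (p - 1)) * (2 * C * (1 + ‖x‖)) :=
          mul_le_mul h1 (hkb x) (abs_nonneg _) (by positivity)
      _ = _ := by ring
  · refine Tendsto.mul_const _ ((h.cont_deriv.tendsto _).comp ?_)
    simp only [hct]
    have := (hst.mul_const (terminal x₀ g a x - terminal x₀ g b x)).const_add (terminal x₀ g b x)
    simpa using this

/-! ### Non-uniqueness of optimizers -/

/-- The gains up to time `n` of the strategy `c`. -/
def gains (x₀ : ℝ) (c : Path T → Fin T → ℝ) (n : ℕ) (x : Path T) : ℝ :=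
  ∑ s : Fin T, if (s : ℕ) < n then c x s * (x s - prev x₀ x s) else 0

lemma gains_succ (c : Path T → Fin T → ℝ) (t : Fin T) (x : Path T) :
    gains x₀ c ((t : ℕ) + 1) x = gains x₀ c t x + c x t * (x t - prev x₀ x t) := by
  have e : c x t * (x t - prev x₀ x t) =
      ∑ s : Fin T, if s = t then c x s * (x s - prev x₀ x s) else 0 := by simp
  rw [gains, gains, e, ← Finset.sum_add_distrib]
  refine Finset.sum_congr rfl fun s _ => ?_
  rcases lt_trichotomy (s : ℕ) t with h | h | h
  · rw [if_pos (by omega), if_pos h, if_neg (by rintro rfl; omega), add_zero]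
  · rw [if_pos (by omega), if_neg (by omega), if_pos (Fin.ext h), zero_add]
  · rw [if_neg (by omega), if_neg (by omega), if_neg (by rintro rfl; omega), add_zero]

lemma gains_self (a b : Path T → Fin T → ℝ) (x : Path T) :
    gains x₀ (fun x t => a x t - b x t) T x = terminal x₀ g a x - terminal x₀ g b x := by
  rw [terminal_eq_wealth, terminal_eq_wealth, wealth_sub_wealth, gains]
  exact Finset.sum_congr rfl fun s _ => if_pos s.isLt

lemma measurable_gains {c : Path T → Fin T → ℝ}
    (hc : ∀ t : Fin T, Measurable[canonFilt T (t : ℕ)] fun x => c x t) (n : ℕ) :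
    Measurable[canonFilt T n] (gains x₀ c n) := by
  have hmul : Measurable fun q : ℝ × ℝ => q.1 * q.2 := measurable_mul
  unfold gains
  refine @Finset.measurable_sum _ _ _ _ _ _ (canonFilt T n) _ _ fun s _ => ?_
  split_ifs with h
  · exact hmul.comp (((hc s).mono (canonFilt_mono h.le) le_rfl).prodMk
      ((measurable_increment s).mono (canonFilt_mono h) le_rfl))
  · exact @measurable_const _ _ _ (canonFilt T n) _

lemma abs_increment_le (x : Path T) (t : Fin T) :
    |x t - prev x₀ x t| ≤ (2 + |x₀|) * (1 + ‖x‖) := by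
  have h3 := abs_prev_le (x₀ := x₀) x t
  have h4 : |x t| ≤ ‖x‖ := norm_le_pi_norm x t
  have h5 := abs_sub (x t) (prev x₀ x t)
  nlinarith [abs_nonneg x₀, norm_nonneg x]

lemma abs_gains_le {c : Path T → Fin T → ℝ} {M : ℝ} (hM : 0 ≤ M) (hc : ∀ x t, |c x t| ≤ M) (n : ℕ)
    (x : Path T) : |gains x₀ c n x| ≤ (T * (M * (2 + |x₀|))) * (1 + ‖x‖) := by
  have h1 : |gains x₀ c n x| ≤ ∑ _s : Fin T, M * ((2 + |x₀|) * (1 + ‖x‖)) := by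
    refine (Finset.abs_sum_le_sum_abs _ _).trans (Finset.sum_le_sum fun s _ => ?_)
    split_ifs
    · rw [abs_mul]
      exact mul_le_mul (hc x s) (abs_increment_le x s) (abs_nonneg _) hM
    · rw [abs_zero]; positivity
  rw [Finset.sum_const, Finset.card_univ, Fintype.card_fin, nsmul_eq_mul] at h1
  linarith

lemma midpoint_isOptimizer (h : Regular p L l g) {P : Measure (Path T)}
    (hP : P ∈ probMeasures p T) {a b : Path T → Fin T → ℝ} (ha : IsOptimizer L x₀ l g P a)
    (hb : IsOptimizer L x₀ l g P b) :
    IsOptimizer L x₀ l g P (fun x t => (1 - 1 / 2) * a x t + 1 / 2 * b x t) := by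
  have hm := combo_mem_controls ha.1 hb.1 (s := 1 / 2) (by norm_num) (by norm_num)
  refine ⟨hm, le_antisymm ?_ (value_le_expLoss h x₀ hP hm)⟩
  refine (expLoss_combo_le h x₀ hP ha.1 hb.1 (by norm_num) (by norm_num)).trans ?_
  rw [ha.2, hb.2]; linarith

/-- The gains of the difference of two optimizers are orthogonal to the marginal loss, one period at
a time: in the middle of two optimizers, half of their difference can be added or subtracted. -/
lemma integral_deriv_mul_diff_eq_zero (h : Regular p L l g) {P : Measure (Path T)}
    (hP : P ∈ probMeasures p T) {a b : Path T → Fin T → ℝ} (ha : IsOptimizer L x₀ l g P a)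
    (hb : IsOptimizer L x₀ l g P b) (t : Fin T) {A : Set (Path T)}
    (hA : MeasurableSet[canonFilt T t] A) :
    ∫ x in A, deriv l (terminal x₀ g b x) * ((a x t - b x t) * (x t - prev x₀ x t)) ∂P = 0 := by
  classical
  set m : Path T → Fin T → ℝ := fun x t => (1 - 1 / 2) * a x t + 1 / 2 * b x t with hm
  have hmo : IsOptimizer L x₀ l g P m := midpoint_isOptimizer h hP ha hb
  have hZ := terminal_ae_eq_of_isOptimizer h hP hmo hb
  -- the perturbation of the midpoint in the period `t` and on the event `A`
  have key : ∀ σ : ℝ, |σ| ≤ 1 → 0 ≤ σ * ∫ x in A, deriv l (terminal x₀ g b x) *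
      ((a x t - b x t) * (x t - prev x₀ x t)) ∂P := by
    intro σ hσ
    set m' : Path T → Fin T → ℝ := fun x s =>
      m x s + if s = t then A.indicator (fun x => σ / 2 * (a x t - b x t)) x else 0 with hm'
    have hm'c : m' ∈ controls T L := by
      intro s
      refine ⟨?_, fun x => ?_⟩
      · by_cases hs : s = t
        · subst hs
          have hq : Measurable fun q : ℝ × ℝ => q.1 + q.2 := measurable_add
          have hq' : Measurable fun q : ℝ × ℝ => σ / 2 * (q.1 - q.2) := by fun_prop
          have h1 := (hq'.comp ((ha.1 s).1.prodMk (hb.1 s).1)).indicator hA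
          have h2 := hq.comp ((hmo.1 s).1.prodMk h1)
          have e : (fun x => m' x s) = fun x =>
              m x s + A.indicator (fun x => σ / 2 * (a x s - b x s)) x := by
            funext x; simp [hm']
          rw [e]
          exact h2
        · simpa [hm', hs] using (hmo.1 s).1
      · have h1 := abs_le.1 ((ha.1 s).2 x)
        have h2 := abs_le.1 ((hb.1 s).2 x)
        have hmL := (hmo.1 s).2 x
        by_cases hs : s = t
        · subst hs
          by_cases hx : x ∈ A
          · have e : m' x s = (1 + σ) / 2 * a x s + (1 - σ) / 2 * b x s := by
              simp [hm', hm, hx]; ring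
            have := abs_le.1 hσ
            rw [e, abs_le]
            constructor <;> nlinarith
          · simpa [hm', hx] using hmL
        · simpa [hm', hs] using hmL
    have hdiff : ∀ x, terminal x₀ g m' x - terminal x₀ g m x =
        A.indicator (fun x => σ / 2 * ((a x t - b x t) * (x t - prev x₀ x t))) x := by
      intro x
      rw [terminal_eq_wealth, terminal_eq_wealth, wealth_sub_wealth]
      have : ∀ s, (m' x s - m x s) * (x s - prev x₀ x s) = if s = t then
          A.indicator (fun x => σ / 2 * ((a x t - b x t) * (x t - prev x₀ x t))) x else 0 := by
        intro s
        by_cases hs : s = t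
        · subst hs
          by_cases hx : x ∈ A
          · simp [hm', hx]; ring
          · simp [hm', hx]
        · simp [hm', hs]
      simp [this]
    have h1 := hmo.integral_deriv_mul_nonneg h hP hm'c
    have h2 : ∫ x, deriv l (terminal x₀ g m x) * (terminal x₀ g m' x - terminal x₀ g m x) ∂P =
        σ / 2 * ∫ x in A, deriv l (terminal x₀ g b x) *
          ((a x t - b x t) * (x t - prev x₀ x t)) ∂P := by
      rw [← integral_indicator (canonFilt_le T t A hA), ← integral_const_mul]
      refine integral_congr_ae ?_
      filter_upwards [hZ] with x hx
      rw [hx, ← hx, hdiff]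
      by_cases hxA : x ∈ A
      · simp [hxA, hx]; ring
      · simp [hxA]
    rw [h2] at h1
    linarith
  have h1 := key 1 (by simp)
  have h2 := key (-1) (by simp)
  linarith

section Invariance

variable {P : Measure (Path T)} {a b : Path T → Fin T → ℝ}

lemma integrable_deriv_mul_gains (h : Regular p L l g) (hP : P ∈ probMeasures p T)
    (ha : a ∈ controls T L) (hb : b ∈ controls T L) (n : ℕ) :
    Integrable (fun x => deriv l (terminal x₀ g b x) *
      gains x₀ (fun x t => a x t - b x t) n x) P := by
  have hL := h.nonneg
  refine h.integrable_deriv_mul x₀ hP hb ?_ (abs_gains_le (M := L + L) (by linarith) (fun x t =>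
    (abs_sub _ _).trans (add_le_add ((ha t).2 x) ((hb t).2 x))) n)
  have hq : Measurable fun q : ℝ × ℝ => q.1 - q.2 := measurable_sub
  exact (measurable_gains (fun t => hq.comp ((ha t).1.prodMk (hb t).1)) n).mono
    (canonFilt_le T n) le_rfl

lemma measurable_gains_sub (ha : a ∈ controls T L) (hb : b ∈ controls T L) (n : ℕ) :
    Measurable[canonFilt T n] (gains x₀ (fun x t => a x t - b x t) n) := by
  have hq : Measurable fun q : ℝ × ℝ => q.1 - q.2 := measurable_sub
  exact measurable_gains (fun t => hq.comp ((ha t).1.prodMk (hb t).1)) n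

/-- At every time, the gains of the difference of two optimizers vanish wherever the conditional
marginal loss does not: at the end they vanish, and the orthogonality of each period to the marginal
loss carries this backwards in time. -/
lemma condExp_deriv_mul_gains (h : Regular p L l g) (hP : P ∈ probMeasures p T)
    (ha : IsOptimizer L x₀ l g P a) (hb : IsOptimizer L x₀ l g P b) {n : ℕ} (hn : n ≤ T) :
    ∀ᵐ x ∂P, condExp (canonFilt T n) P (fun y => deriv l (terminal x₀ g b y)) x *
      gains x₀ (fun x t => a x t - b x t) n x = 0 := by
  have hPp := hP.1
  have hy := h.integrable_deriv x₀ hP hb.1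
  have hyG := integrable_deriv_mul_gains (x₀ := x₀) h hP ha.1 hb.1
  have hpull : ∀ n, condExp (canonFilt T n) P (fun x => deriv l (terminal x₀ g b x) *
      gains x₀ (fun x t => a x t - b x t) n x) =ᵐ[P] fun x =>
      condExp (canonFilt T n) P (fun y => deriv l (terminal x₀ g b y)) x *
      gains x₀ (fun x t => a x t - b x t) n x := fun n =>
    condExp_mul_of_stronglyMeasurable_right (measurable_gains_sub ha.1 hb.1 n).stronglyMeasurable
      (hyG n) hy
  suffices hs : condExp (canonFilt T n) P (fun x => deriv l (terminal x₀ g b x) *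
      gains x₀ (fun x t => a x t - b x t) n x) =ᵐ[P] 0 by
    filter_upwards [hs, hpull n] with x h1 h2
    rw [← h2, h1]; rfl
  refine Nat.decreasingInduction (motive := fun n _ => condExp (canonFilt T n) P
      (fun x => deriv l (terminal x₀ g b x) * gains x₀ (fun x t => a x t - b x t) n x) =ᵐ[P] 0)
    (fun k hk ih => ?_) ?_ hn
  · set t : Fin T := ⟨k, hk⟩ with ht
    have hinc : Integrable (fun x => deriv l (terminal x₀ g b x) *
        ((a x t - b x t) * (x t - prev x₀ x t))) P := by
      refine ((hyG (k + 1)).sub (hyG k)).congr (Eventually.of_forall fun x => ?_)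
      have := gains_succ (x₀ := x₀) (fun x t => a x t - b x t) t x
      simp only [ht] at this ⊢
      simp only [Pi.sub_apply, this]; ring
    have h0 : condExp (canonFilt T k) P (fun x => deriv l (terminal x₀ g b x) *
        ((a x t - b x t) * (x t - prev x₀ x t))) =ᵐ[P] 0 := by
      symm
      refine ae_eq_condExp_of_forall_setIntegral_eq (canonFilt_le T k) hinc
        (fun s _ _ => (integrable_zero _ _ _).integrableOn) ?_
        (stronglyMeasurable_zero.aestronglyMeasurable)
      intro s hs _
      rw [integral_deriv_mul_diff_eq_zero h hP ha hb t hs]; simp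
    have e : (fun x => deriv l (terminal x₀ g b x) * gains x₀ (fun x t => a x t - b x t) k x) =
        (fun x => deriv l (terminal x₀ g b x) * gains x₀ (fun x t => a x t - b x t) (k + 1) x) -
        fun x => deriv l (terminal x₀ g b x) * ((a x t - b x t) * (x t - prev x₀ x t)) := by
      funext x
      have := gains_succ (x₀ := x₀) (fun x t => a x t - b x t) t x
      simp only [ht] at this ⊢
      simp only [Pi.sub_apply, this]; ring
    rw [e]
    have h1 := condExp_sub (hyG (k + 1)) hinc (canonFilt T k)
    have h2 := condExp_condExp_of_le (μ := P) (f := fun x => deriv l (terminal x₀ g b x) *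
      gains x₀ (fun x t => a x t - b x t) (k + 1) x) (canonFilt_mono (T := T) (Nat.le_succ k))
      (canonFilt_le T (k + 1))
    have h3 := condExp_congr_ae (m := canonFilt T k) ih
    rw [condExp_zero] at h3
    filter_upwards [h0, h1, h2, h3] with x e0 e1 e2 e3
    rw [e1, Pi.sub_apply, e0, ← e2, e3]; simp
  · have hZ := terminal_ae_eq_of_isOptimizer h hP ha hb
    have : (fun x => deriv l (terminal x₀ g b x) * gains x₀ (fun x t => a x t - b x t) T x)
        =ᵐ[P] 0 := by
      filter_upwards [hZ] with x hx
      rw [gains_self (g := g), hx]; simp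
    have h3 := condExp_congr_ae (m := canonFilt T T) this
    rwa [condExp_zero] at h3

/-- Where two optimizers differ in the period `t`, the conditional marginal loss vanishes before that
period: otherwise the gains of the difference vanish up to `t`, hence not after it because `X` moves
in the period, and the conditional marginal loss is zero after the period and so before it. -/
lemma condExp_deriv_mul_diff (h : Regular p L l g) (hP : P ∈ probMeasures p T)
    (hPX : ∀ t : Fin T, P {x | x t = prev x₀ x t} = 0)
    (ha : IsOptimizer L x₀ l g P a) (hb : IsOptimizer L x₀ l g P b) (t : Fin T) :
    ∀ᵐ x ∂P, condExp (canonFilt T t) P (fun y => deriv l (terminal x₀ g b y)) x *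
      (a x t - b x t) = 0 := by
  have hPp := hP.1
  have hy := h.integrable_deriv x₀ hP hb.1
  set y : Path T → ℝ := fun x => deriv l (terminal x₀ g b x) with hyd
  have hG0 := condExp_deriv_mul_gains h hP ha hb (n := t) t.isLt.le
  have hG1 := condExp_deriv_mul_gains h hP ha hb (n := t + 1) t.isLt
  have hq : Measurable fun q : ℝ × ℝ => q.1 - q.2 := measurable_sub
  have hcm : Measurable[canonFilt T t] fun x => a x t - b x t :=
    hq.comp ((ha.1 t).1.prodMk (hb.1 t).1)
  have hGm := measurable_gains_sub (x₀ := x₀) ha.1 hb.1 (t : ℕ)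
  set S : Set (Path T) := {x | a x t - b x t ≠ 0} ∩ {x | gains x₀ (fun x t => a x t - b x t) t x = 0}
    with hS
  have hSm : MeasurableSet[canonFilt T t] S :=
    MeasurableSet.inter (m := canonFilt T t) (hcm (measurableSet_singleton (0 : ℝ)).compl)
      (hGm (measurableSet_singleton (0 : ℝ)))
  have hX : ∀ᵐ x ∂P, x t ≠ prev x₀ x t := by
    rw [ae_iff]; simpa using hPX t
  have h1 : S.indicator (condExp (canonFilt T (t + 1)) P y) =ᵐ[P] 0 := by
    filter_upwards [hX, hG1] with x hx hxG
    by_cases hxS : x ∈ S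
    · have e := gains_succ (x₀ := x₀) (fun x t => a x t - b x t) t x
      rw [show gains x₀ (fun x t => a x t - b x t) t x = 0 from hxS.2, zero_add] at e
      rw [Set.indicator_of_mem hxS]
      rw [e] at hxG
      exact (mul_eq_zero.1 hxG).resolve_right
        (mul_ne_zero hxS.1 (sub_ne_zero.2 hx))
    · rw [Set.indicator_of_notMem hxS]; rfl
  have h2 := condExp_indicator (m := canonFilt T (t + 1)) hy (canonFilt_mono (Nat.le_succ _) S hSm)
  have h3 := condExp_indicator (m := canonFilt T t) hy hSm
  have h4 := condExp_condExp_of_le (μ := P) (f := S.indicator y)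
    (canonFilt_mono (T := T) (Nat.le_succ t)) (canonFilt_le T (t + 1))
  have h5 := condExp_congr_ae (m := canonFilt T t) (h2.trans h1)
  rw [condExp_zero] at h5
  filter_upwards [hG0, h3, h4, h5] with x e0 e3 e4 e5
  by_cases hc : a x t - b x t = 0
  · rw [hc, mul_zero]
  by_cases hg : gains x₀ (fun x t => a x t - b x t) t x = 0
  · have hxS : x ∈ S := ⟨hc, hg⟩
    rw [Set.indicator_of_mem hxS, ← e4, e5] at e3
    rw [← e3]; simp
  · rw [(mul_eq_zero.1 e0).resolve_right hg, zero_mul]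

/-- Where two optimizers differ in the period `t`, the conditional marginal loss vanishes after that
period, too: either the gains of the difference do not vanish, or they do, and then `X_t` is a
function of the past. -/
lemma condExp_succ_deriv_mul_diff (h : Regular p L l g) (hP : P ∈ probMeasures p T)
    (hPX : ∀ t : Fin T, P {x | x t = prev x₀ x t} = 0)
    (ha : IsOptimizer L x₀ l g P a) (hb : IsOptimizer L x₀ l g P b) (t : Fin T) :
    ∀ᵐ x ∂P, condExp (canonFilt T (t + 1)) P (fun y => deriv l (terminal x₀ g b y)) x *
      (a x t - b x t) = 0 := by
  classical
  have hPp := hP.1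
  have hy := h.integrable_deriv x₀ hP hb.1
  set y : Path T → ℝ := fun x => deriv l (terminal x₀ g b x) with hyd
  have hN := condExp_deriv_mul_diff h hP hPX ha hb t
  have hG1 := condExp_deriv_mul_gains h hP ha hb (n := t + 1) t.isLt
  have hq : Measurable fun q : ℝ × ℝ => q.1 - q.2 := measurable_sub
  have hcm : Measurable[canonFilt T t] fun x => a x t - b x t :=
    hq.comp ((ha.1 t).1.prodMk (hb.1 t).1)
  have hGm := measurable_gains_sub (x₀ := x₀) ha.1 hb.1 (t : ℕ)
  set D : Set (Path T) := {x | a x t - b x t ≠ 0} with hD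
  have hDm : MeasurableSet[canonFilt T t] D := hcm (measurableSet_singleton (0 : ℝ)).compl
  have hDm1 : MeasurableSet[canonFilt T (t + 1)] D := canonFilt_mono (Nat.le_succ _) D hDm
  -- the path whose coordinate `t` makes the gains up to that time vanish
  set ξ : Path T → ℝ := fun x =>
    prev x₀ x t - gains x₀ (fun x t => a x t - b x t) t x / (a x t - b x t) with hξ
  have hξm : Measurable[canonFilt T t] ξ := by
    have hq3 : Measurable fun q : ℝ × ℝ × ℝ => q.1 - q.2.1 / q.2.2 := by fun_prop
    exact hq3.comp ((measurable_prev t).prodMk (hGm.prodMk hcm))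
  set κ : Path T → Path T := fun x => Function.update x t (ξ x) with hκ
  have hκm : @Measurable _ _ (canonFilt T t) (canonFilt T (t + 1)) κ := by
    refine measurable_canonFilt_of fun s hs => ?_
    by_cases hst : s = t
    · subst hst; simpa [hκ] using hξm
    · simp only [hκ, Function.update_of_ne hst]
      refine measurable_coord ?_
      have : (s : ℕ) ≠ t := fun e => hst (Fin.ext e)
      omega
  have hκid : ∀ x ∈ D, gains x₀ (fun x t => a x t - b x t) (t + 1) x = 0 → κ x = x := by
    intro x hx hg
    have hx' : a x t - b x t ≠ 0 := hx
    rw [gains_succ] at hg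
    have : ξ x = x t := by
      rw [hξ]; simp only; field_simp; linarith
    simp only [hκ]
    rw [this, Function.update_eq_self]
  have h0 : condExp (canonFilt T (t + 1)) P (D.indicator y) =ᵐ[P] 0 := by
    symm
    refine ae_eq_condExp_of_forall_setIntegral_eq (canonFilt_le T _)
      (hy.indicator (canonFilt_le T _ D hDm))
      (fun s _ _ => (integrable_zero _ _ _).integrableOn) ?_
      (stronglyMeasurable_zero.aestronglyMeasurable)
    intro B hB _
    have hB' : MeasurableSet[canonFilt T t] (κ ⁻¹' B) := hκm hB
    have m1 : MeasurableSet[canonFilt T (t + 1)] (B ∩ D) :=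
      MeasurableSet.inter (m := canonFilt T (t + 1)) hB hDm1
    have m2 : MeasurableSet[canonFilt T t] (κ ⁻¹' B ∩ D) :=
      MeasurableSet.inter (m := canonFilt T t) hB' hDm
    have m3 := canonFilt_mono (Nat.le_succ _) _ m2
    have e1 : ∫ x in B, D.indicator y x ∂P = ∫ x in B ∩ D, y x ∂P :=
      setIntegral_indicator (canonFilt_le T _ D hDm)
    have e2 : ∫ x in B ∩ D, condExp (canonFilt T (t + 1)) P y x ∂P =
        ∫ x in κ ⁻¹' B ∩ D, condExp (canonFilt T (t + 1)) P y x ∂P := by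
      rw [← integral_indicator (canonFilt_le T _ _ m1),
        ← integral_indicator (canonFilt_le T _ _ m2)]
      refine integral_congr_ae ?_
      filter_upwards [hG1] with x hx
      by_cases hxD : x ∈ D
      · by_cases hg : gains x₀ (fun x t => a x t - b x t) (t + 1) x = 0
        · have := hκid x hxD hg
          simp [Set.indicator, this]
        · have : condExp (canonFilt T (t + 1)) P y x = 0 := (mul_eq_zero.1 hx).resolve_right hg
          simp [Set.indicator, this]
      · simp [Set.indicator, hxD]
    have e3 : ∫ x in κ ⁻¹' B ∩ D, condExp (canonFilt T t) P y x ∂P = 0 := by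
      rw [← integral_indicator (canonFilt_le T _ _ m2),
        ← integral_zero (Path T) ℝ (μ := P)]
      refine integral_congr_ae ?_
      filter_upwards [hN] with x hx
      by_cases hxD : x ∈ κ ⁻¹' B ∩ D
      · rw [Set.indicator_of_mem hxD]
        exact (mul_eq_zero.1 hx).resolve_right hxD.2
      · rw [Set.indicator_of_notMem hxD]
    rw [e1, ← setIntegral_condExp (canonFilt_le T _) hy m1, e2,
      setIntegral_condExp (canonFilt_le T _) hy m3, ← setIntegral_condExp (canonFilt_le T _) hy m2, e3]
    simp
  have h1 := condExp_indicator (m := canonFilt T (t + 1)) hy hDm1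
  filter_upwards [h0, h1] with x e0 e1
  by_cases hxD : x ∈ D
  · rw [Set.indicator_of_mem hxD, e0] at e1
    rw [← e1]; simp
  · have : a x t - b x t = 0 := by simpa [hD] using hxD
    rw [this, mul_zero]

/-- Optimizers need not be unique, but the conditional marginal loss vanishes wherever the changes
of position of two optimizers differ. -/
theorem condExp_deriv_mul_change_eq (h : Regular p L l g) (hP : P ∈ probMeasures p T)
    (hPX : ∀ t : Fin T, P {x | x t = prev x₀ x t} = 0)
    (ha : IsOptimizer L x₀ l g P a) (hb : IsOptimizer L x₀ l g P b) (t : Fin T) :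
    ∀ᵐ x ∂P, condExp (canonFilt T (t + 1)) P (fun y => deriv l (terminal x₀ g b y)) x *
      (nextControl a x t - a x t) =
      condExp (canonFilt T (t + 1)) P (fun y => deriv l (terminal x₀ g b y)) x *
      (nextControl b x t - b x t) := by
  have h1 := condExp_succ_deriv_mul_diff h hP hPX ha hb t
  by_cases ht : (t : ℕ) + 1 < T
  · have h2 := condExp_deriv_mul_diff h hP hPX ha hb ⟨t + 1, ht⟩
    filter_upwards [h1, h2] with x e1 e2
    simp only [nextControl, dif_pos ht]
    linarith
  · filter_upwards [h1] with x e1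
    simp only [nextControl, dif_neg ht]
    linarith

lemma integral_deriv_mul_eq_condExp (h : Regular p L l g) (hP : P ∈ probMeasures p T)
    (hb : b ∈ controls T L) {n : ℕ} {k : Path T → ℝ} (hk : Measurable[canonFilt T n] k) {M : ℝ}
    (hkM : ∀ x, |k x| ≤ M) : ∫ x, deriv l (terminal x₀ g b x) * k x ∂P =
      ∫ x, condExp (canonFilt T n) P (fun y => deriv l (terminal x₀ g b y)) x * k x ∂P := by
  have hPp := hP.1
  rw [← integral_condExp (canonFilt_le T n)]
  exact integral_congr_ae (condExp_mul_of_stronglyMeasurable_right hk.stronglyMeasurable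
    (h.integrable_deriv_mul_bdd x₀ hP hb (hk.mono (canonFilt_le T n) le_rfl) hkM)
    (h.integrable_deriv x₀ hP hb))

lemma integral_deriv_mul_change_eq (h : Regular p L l g) (hP : P ∈ probMeasures p T)
    (hPX : ∀ t : Fin T, P {x | x t = prev x₀ x t} = 0)
    (ha : IsOptimizer L x₀ l g P a) (hb : IsOptimizer L x₀ l g P b) (t : Fin T) {f : Path T → ℝ}
    (hf : Measurable[canonFilt T (t + 1)] f) {M : ℝ} (hfM : ∀ x, |f x| ≤ M) :
    ∫ x, deriv l (terminal x₀ g b x) * ((nextControl a x t - a x t) * f x) ∂P =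
      ∫ x, deriv l (terminal x₀ g b x) * ((nextControl b x t - b x t) * f x) ∂P := by
  have hL := h.nonneg
  have hq : Measurable fun q : ℝ × ℝ × ℝ => (q.1 - q.2.1) * q.2.2 := by fun_prop
  have hm : ∀ c ∈ controls T L, Measurable[canonFilt T (t + 1)] fun x =>
      (nextControl c x t - c x t) * f x := fun c hc =>
    hq.comp ((measurable_nextControl hc t).prodMk
      (((hc t).1.mono (canonFilt_mono (Nat.le_succ _)) le_rfl).prodMk hf))
  have hbd : ∀ c ∈ controls T L, ∀ x, |(nextControl c x t - c x t) * f x| ≤ (L + L) * M :=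
    fun c hc x => by
      rw [abs_mul]
      exact mul_le_mul ((abs_sub _ _).trans (add_le_add (abs_nextControl_le hL hc t x)
        ((hc t).2 x))) (hfM x) (abs_nonneg _) (by linarith)
  rw [integral_deriv_mul_eq_condExp h hP hb.1 (hm a ha.1) (hbd a ha.1),
    integral_deriv_mul_eq_condExp h hP hb.1 (hm b hb.1) (hbd b hb.1)]
  refine integral_congr_ae ?_
  filter_upwards [condExp_deriv_mul_change_eq h hP hPX ha hb t] with x hx
  rw [← mul_assoc, hx, mul_assoc]

end Invariance

/-! ### Integrability of the first-order coefficient -/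

lemma holderConjugate (hp : 1 < p) : p.HolderConjugate (p / (p - 1)) :=
  Real.HolderConjugate.conjExponent hp

/-- Functions of growth `p - 1` have a finite moment of the conjugate order. -/
lemma memLp_conj_of_growth (hp : 1 < p) {P : Measure (Path T)} (hP : P ∈ probMeasures p T)
    {w : Path T → ℝ} (hw : Measurable w) {C : ℝ} (hC : 0 ≤ C)
    (hwC : ∀ x, |w x| ≤ C * (1 + ‖x‖) ^ (p - 1)) :
    MemLp w (ENNReal.ofReal (p / (p - 1))) P := by
  have hq := (holderConjugate hp).symm.pos
  rw [← integrable_norm_rpow_iff hw.aestronglyMeasurable (by simpa using hq) (by simp),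
    ENNReal.toReal_ofReal hq.le]
  refine integrable_of_growth (C := C ^ (p / (p - 1))) (integrable_norm_growth (by linarith) hP)
    (hw.norm.pow_const _) fun x => ?_
  rw [abs_of_nonneg (by positivity)]
  calc ‖w x‖ ^ (p / (p - 1)) ≤ (C * (1 + ‖x‖) ^ (p - 1)) ^ (p / (p - 1)) :=
        Real.rpow_le_rpow (norm_nonneg _) (hwC x) hq.le
    _ = _ := by
        rw [Real.mul_rpow hC (by positivity), ← Real.rpow_mul (by positivity),
          mul_div_cancel₀ _ (by linarith : p - 1 ≠ 0)]

lemma abs_partialDeriv_le {K : ℝ} (hK : ∀ x, ‖fderiv ℝ g x‖ ≤ K) (t : Fin T) (x : Path T) :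
    |partialDeriv g t x| ≤ K := by
  refine ((fderiv ℝ g x).le_opNorm _).trans ?_
  have : ‖(Pi.single t 1 : Path T)‖ ≤ 1 := by
    refine (pi_norm_le_iff_of_nonneg zero_le_one).2 fun s => ?_
    by_cases hs : s = t
    · subst hs; simp
    · simp [hs]
  have h0 := norm_nonneg (fderiv ℝ g x)
  nlinarith [hK x]

lemma Regular.measurable_partialDeriv (h : Regular p L l g) (t : Fin T) :
    Measurable (partialDeriv g t) :=
  (h.cont_fderiv.clm_apply continuous_const).measurable

/-- The derivative of the loss in the coordinate `t` of the path, along a control. -/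
def controlGrad (x₀ : ℝ) (l : ℝ → ℝ) (g : Path T → ℝ) (a : Path T → Fin T → ℝ) (t : Fin T)
    (x : Path T) : ℝ :=
  deriv l (terminal x₀ g a x) * (partialDeriv g t x + a x t - nextControl a x t)

lemma pathDeriv_eq_sum_controlGrad (a : Path T → Fin T → ℝ) (x d : Path T) :
    pathDeriv x₀ l g (a x) x d = ∑ t, controlGrad x₀ l g a t x * d t :=
  pathDeriv_eq_sum (a x) x d

section Static

variable {P : Measure (Path T)} {a : Path T → Fin T → ℝ}

lemma Regular.measurable_controlGrad (h : Regular p L l g) (ha : a ∈ controls T L) (t : Fin T) :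
    Measurable (controlGrad x₀ l g a t) :=
  (measurable_pi_apply t).comp
    (h.measurable_pathGrad_comp (measurable_of_mem_controls ha) measurable_id)

lemma Regular.memLp_controlGrad (h : Regular p L l g) (x₀ : ℝ) (hP : P ∈ probMeasures p T)
    (ha : a ∈ controls T L) (t : Fin T) :
    MemLp (controlGrad x₀ l g a t) (ENNReal.ofReal (p / (p - 1))) P := by
  obtain ⟨C, hC1, hC⟩ := h.exists_growth x₀
  obtain ⟨K, hK⟩ := h.fderiv_bdd
  have hL := h.nonneg
  have hK0 : 0 ≤ K := (norm_nonneg _).trans (hK 0)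
  refine memLp_conj_of_growth h.one_lt hP (h.measurable_controlGrad ha t)
    (C := C * (K + L + L)) (by positivity) fun x => ?_
  rw [controlGrad, abs_mul]
  have h1 : |deriv l (terminal x₀ g a x)| ≤ C * (1 + ‖x‖) ^ (p - 1) :=
    (hC (a x) x fun t => (ha t).2 x).2.1
  have h2 : |partialDeriv g t x + a x t - nextControl a x t| ≤ K + L + L :=
    (abs_sub _ _).trans (add_le_add ((abs_add_le _ _).trans
      (add_le_add (abs_partialDeriv_le hK t x) ((ha t).2 x))) (abs_nextControl_le hL ha t x))
  calc _ ≤ C * (1 + ‖x‖) ^ (p - 1) * (K + L + L) :=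
        mul_le_mul h1 h2 (abs_nonneg _) (by positivity)
    _ = _ := by ring

lemma one_le_conj (hp : 1 < p) : 1 ≤ ENNReal.ofReal (p / (p - 1)) := by
  rw [ENNReal.one_le_ofReal]; exact (holderConjugate hp).symm.lt.le

lemma Regular.integrable_controlGrad (h : Regular p L l g) (x₀ : ℝ) (hP : P ∈ probMeasures p T)
    (ha : a ∈ controls T L) (t : Fin T) : Integrable (controlGrad x₀ l g a t) P :=
  have := hP.1
  (h.memLp_controlGrad x₀ hP ha t).integrable (one_le_conj h.one_lt)

lemma Regular.integrable_deriv_mul_partialDeriv (h : Regular p L l g) (x₀ : ℝ)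
    (hP : P ∈ probMeasures p T) (ha : a ∈ controls T L) (t : Fin T) :
    Integrable (fun x => deriv l (terminal x₀ g a x) * partialDeriv g t x) P := by
  obtain ⟨K, hK⟩ := h.fderiv_bdd
  exact h.integrable_deriv_mul_bdd x₀ hP ha (h.measurable_partialDeriv t) (abs_partialDeriv_le hK t)

/-- The first-order coefficient in the coordinate `t` is the adapted part of the derivative of the
loss in that coordinate, up to the sign. -/
lemma Regular.condExp_controlGrad (h : Regular p L l g) (x₀ : ℝ) (hP : P ∈ probMeasures p T)
    (ha : a ∈ controls T L) (t : Fin T) :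
    condExp (canonFilt T (t + 1)) P (controlGrad x₀ l g a t) =ᵐ[P]
      fun x => - sensTerm x₀ l g P a t x := by
  have hPp := hP.1
  have hL := h.nonneg
  have hq : Measurable fun q : ℝ × ℝ => q.1 - q.2 := measurable_sub
  have hm : Measurable[canonFilt T (t + 1)] fun x => nextControl a x t - a x t :=
    hq.comp ((measurable_nextControl ha t).prodMk
      ((ha t).1.mono (canonFilt_mono (Nat.le_succ _)) le_rfl))
  have i1 := h.integrable_deriv_mul_partialDeriv x₀ hP ha t
  have i2 : Integrable ((fun x => deriv l (terminal x₀ g a x)) *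
      fun x => nextControl a x t - a x t) P :=
    h.integrable_deriv_mul_bdd x₀ hP ha (hm.mono (canonFilt_le T _) le_rfl) (A := L + L)
      fun x => (abs_sub _ _).trans (add_le_add (abs_nextControl_le hL ha t x) ((ha t).2 x))
  have e : controlGrad x₀ l g a t = (fun x => deriv l (terminal x₀ g a x) * partialDeriv g t x) -
      (fun x => deriv l (terminal x₀ g a x)) * fun x => nextControl a x t - a x t := by
    funext x
    simp only [controlGrad, Pi.sub_apply, Pi.mul_apply]; ring
  rw [e]
  filter_upwards [condExp_sub i1 i2 (canonFilt T (t + 1)),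
    condExp_mul_of_stronglyMeasurable_right hm.stronglyMeasurable i2
      (h.integrable_deriv x₀ hP ha)] with x h1 h2
  rw [h1, Pi.sub_apply, h2, Pi.mul_apply, sensTerm]
  ring

lemma Regular.memLp_sensTerm (h : Regular p L l g) (x₀ : ℝ) (hP : P ∈ probMeasures p T)
    (ha : a ∈ controls T L) (t : Fin T) :
    MemLp (sensTerm x₀ l g P a t) (ENNReal.ofReal (p / (p - 1))) P := by
  have h1 := ((h.memLp_controlGrad x₀ hP ha t).condExp (m := canonFilt T (t + 1))
    (one_le_conj h.one_lt)).neg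
  refine h1.ae_eq ?_
  filter_upwards [h.condExp_controlGrad x₀ hP ha t] with x hx
  rw [Pi.neg_apply, hx, neg_neg]

lemma Regular.integrable_sensTerm_rpow (h : Regular p L l g) (x₀ : ℝ) (hP : P ∈ probMeasures p T)
    (ha : a ∈ controls T L) (t : Fin T) :
    Integrable (fun x => |sensTerm x₀ l g P a t x| ^ (p / (p - 1))) P := by
  have hq := (holderConjugate h.one_lt).symm.pos
  have := (h.memLp_sensTerm x₀ hP ha t).integrable_norm_rpow (by simpa using hq) (by simp)
  rwa [ENNReal.toReal_ofReal hq.le] at this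

end Static

/-! ### Couplings at a given distance -/

lemma norm_rpow_le_sum (hp : 0 < p) (d : Path T) : ‖d‖ ^ p ≤ ∑ t, |d t| ^ p := by
  have h0 : 0 ≤ ∑ t, |d t| ^ p := Finset.sum_nonneg fun t _ => by positivity
  have h1 : ‖d‖ ≤ (∑ t, |d t| ^ p) ^ p⁻¹ := by
    refine (pi_norm_le_iff_of_nonneg (by positivity)).2 fun t => ?_
    rw [Real.le_rpow_inv_iff_of_pos (norm_nonneg _) h0 hp]
    exact Finset.single_le_sum (f := fun t => |d t| ^ p) (fun t _ => by positivity)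
      (Finset.mem_univ t)
  rwa [Real.le_rpow_inv_iff_of_pos (norm_nonneg _) h0 hp] at h1

lemma exists_bicausal_coupling (hp : 0 < p) {P Q : Measure (Path T)} {r r' : ℝ} (hr : 0 ≤ r)
    (hrr : r < r') (hQ : Q ∈ adaptedBall p P r) :
    ∃ π : Measure (Path T × Path T), IsCoupling P Q π ∧ IsBicausal π ∧
      ∑ t : Fin T, ∫⁻ z, ENNReal.ofReal (|z.1 t - z.2 t| ^ p) ∂π ≤ ENNReal.ofReal (r' ^ p) := by
  have h1 : adaptedW p P Q < ENNReal.ofReal r' :=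
    hQ.2.trans_lt ((ENNReal.ofReal_lt_ofReal_iff (by linarith)).2 hrr)
  rw [adaptedW] at h1
  obtain ⟨π, h2⟩ := iInf_lt_iff.1 h1
  obtain ⟨⟨hc, hb⟩, h3⟩ := iInf_lt_iff.1 h2
  refine ⟨π, hc, hb, ?_⟩
  rw [one_div] at h3
  rw [← ENNReal.ofReal_rpow_of_pos (by linarith)]
  exact (ENNReal.rpow_inv_le_iff hp).1 h3.le

lemma integrable_coord_rpow_of_cost (hp : 0 < p) {π : Measure (Path T × Path T)} {r : ℝ}
    (hcost : ∑ t : Fin T, ∫⁻ z, ENNReal.ofReal (|z.1 t - z.2 t| ^ p) ∂π ≤ ENNReal.ofReal (r ^ p))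
    (t : Fin T) : Integrable (fun z : Path T × Path T => |z.1 t - z.2 t| ^ p) π := by
  refine ⟨by fun_prop (disch := linarith), ?_⟩
  rw [hasFiniteIntegral_iff_ofReal (Eventually.of_forall fun z => by positivity)]
  refine lt_of_le_of_lt ?_ (hcost.trans_lt ENNReal.ofReal_lt_top)
  exact Finset.single_le_sum (f := fun t : Fin T => ∫⁻ z : Path T × Path T,
    ENNReal.ofReal (|z.1 t - z.2 t| ^ p) ∂π) (fun _ _ => zero_le) (Finset.mem_univ t)

lemma sum_integral_le_of_cost (hp : 0 < p) {π : Measure (Path T × Path T)} {r : ℝ} (hr : 0 ≤ r)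
    (hcost : ∑ t : Fin T, ∫⁻ z, ENNReal.ofReal (|z.1 t - z.2 t| ^ p) ∂π ≤ ENNReal.ofReal (r ^ p)) :
    ∑ t : Fin T, ∫ z : Path T × Path T, |z.1 t - z.2 t| ^ p ∂π ≤ r ^ p := by
  rw [← ENNReal.ofReal_le_ofReal_iff (by positivity), ENNReal.ofReal_sum_of_nonneg
    fun t _ => integral_nonneg fun z => by positivity]
  refine le_trans (le_of_eq ?_) hcost
  exact Finset.sum_congr rfl fun t _ => ofReal_integral_eq_lintegral_ofReal
    (integrable_coord_rpow_of_cost hp hcost t) (Eventually.of_forall fun z => by positivity)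

lemma integrable_norm_rpow_of_cost (hp : 0 < p) {π : Measure (Path T × Path T)} {r : ℝ}
    (hcost : ∑ t : Fin T, ∫⁻ z, ENNReal.ofReal (|z.1 t - z.2 t| ^ p) ∂π ≤ ENNReal.ofReal (r ^ p)) :
    Integrable (fun z : Path T × Path T => ‖z.2 - z.1‖ ^ p) π := by
  refine (integrable_finsetSum Finset.univ
    fun t _ => integrable_coord_rpow_of_cost hp hcost t).mono' (by fun_prop (disch := linarith))
    (Eventually.of_forall fun z => ?_)
  rw [Real.norm_of_nonneg (by positivity), norm_sub_rev]
  exact norm_rpow_le_sum hp (z.1 - z.2)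

lemma integral_norm_rpow_le_of_cost (hp : 0 < p) {π : Measure (Path T × Path T)} {r : ℝ}
    (hr : 0 ≤ r)
    (hcost : ∑ t : Fin T, ∫⁻ z, ENNReal.ofReal (|z.1 t - z.2 t| ^ p) ∂π ≤ ENNReal.ofReal (r ^ p)) :
    ∫ z : Path T × Path T, ‖z.2 - z.1‖ ^ p ∂π ≤ r ^ p := by
  refine le_trans ?_ (sum_integral_le_of_cost hp hr hcost)
  rw [← integral_finsetSum _ fun t _ => integrable_coord_rpow_of_cost hp hcost t]
  refine integral_mono (integrable_norm_rpow_of_cost hp hcost)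
    (integrable_finsetSum _ fun t _ => integrable_coord_rpow_of_cost hp hcost t) fun z => ?_
  simp only
  rw [norm_sub_rev]
  exact norm_rpow_le_sum hp (z.1 - z.2)

lemma isProbabilityMeasure_of_coupling {P Q : Measure (Path T)} [IsProbabilityMeasure P]
    {π : Measure (Path T × Path T)} (hc : IsCoupling P Q π) : IsProbabilityMeasure π := by
  refine ⟨?_⟩
  have : P Set.univ = 1 := measure_univ
  rwa [← hc.1, Measure.map_apply measurable_fst MeasurableSet.univ, Set.preimage_univ] at this

/-! ### The upper bound -/

theorem bddAbove_value_adaptedBall (h : Regular p L l g) (x₀ : ℝ) {P : Measure (Path T)}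
    (hP : P ∈ probMeasures p T) {r : ℝ} (hr : 0 ≤ r) :
    BddAbove (value L x₀ l g '' adaptedBall p P r) := by
  have hp := h.one_lt
  have hPp := hP.1
  obtain ⟨C, hC1, hC⟩ := h.exists_growth x₀
  have hPi := integrable_norm_growth (by linarith) hP
  refine ⟨C * (2 ^ p * (∫ x, (1 + ‖x‖) ^ p ∂P + (r + 1) ^ p)), ?_⟩
  rintro _ ⟨Q, hQ, rfl⟩
  obtain ⟨π, hc, -, hcost⟩ := exists_bicausal_coupling (by linarith) hr (lt_add_one r) hQ
  have hπ := isProbabilityMeasure_of_coupling hc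
  have hD := integrable_norm_rpow_of_cost (by linarith) hcost
  have hDr := integral_norm_rpow_le_of_cost (by linarith) (by linarith) hcost
  have hQi := integrable_norm_growth (by linarith) hQ.1
  have h0 := zero_mem_controls (T := T) h.nonneg
  have hPi' : Integrable (fun z : Path T × Path T => (1 + ‖z.1‖) ^ p) π := by
    rw [← hc.1] at hPi; exact hPi.comp_measurable measurable_fst
  have hQi' : Integrable (fun z : Path T × Path T => (1 + ‖z.2‖) ^ p) π := by
    rw [← hc.2] at hQi; exact hQi.comp_measurable measurable_snd
  have h1 : value L x₀ l g Q ≤ C * ∫ x, (1 + ‖x‖) ^ p ∂Q := by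
    refine (value_le_expLoss h x₀ hQ.1 h0).trans ?_
    rw [expLoss, ← integral_const_mul]
    exact integral_mono (h.integrable_loss x₀ hQ.1 h0) (hQi.const_mul C) fun x =>
      (le_abs_self _).trans (hC 0 x fun t => by simpa using h.nonneg).2.2.1
  have h2 : ∫ x, (1 + ‖x‖) ^ p ∂Q = ∫ z : Path T × Path T, (1 + ‖z.2‖) ^ p ∂π := by
    rw [← hc.2, integral_map measurable_snd.aemeasurable (by rw [hc.2]; exact hQi.1)]
  have h3 : ∫ x, (1 + ‖x‖) ^ p ∂P = ∫ z : Path T × Path T, (1 + ‖z.1‖) ^ p ∂π := by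
    rw [← hc.1, integral_map measurable_fst.aemeasurable (by rw [hc.1]; exact hPi.1)]
  have h4 : ∫ z : Path T × Path T, (1 + ‖z.2‖) ^ p ∂π ≤
      2 ^ p * (∫ z : Path T × Path T, (1 + ‖z.1‖) ^ p ∂π + ∫ z, ‖z.2 - z.1‖ ^ p ∂π) := by
    rw [← integral_add hPi' hD, ← integral_const_mul]
    refine integral_mono hQi' ((hPi'.add hD).const_mul _) fun z => ?_
    have h5 : 1 + ‖z.2‖ ≤ 2 * max (1 + ‖z.1‖) ‖z.2 - z.1‖ := by
      have := norm_add_le z.1 (z.2 - z.1)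
      rw [add_sub_cancel] at this
      linarith [le_max_left (1 + ‖z.1‖) ‖z.2 - z.1‖, le_max_right (1 + ‖z.1‖) ‖z.2 - z.1‖]
    refine (Real.rpow_le_rpow (by positivity) h5 (by linarith)).trans ?_
    rw [Real.mul_rpow (by positivity) (by positivity)]
    gcongr
    rcases max_cases (1 + ‖z.1‖) ‖z.2 - z.1‖ with ⟨e, -⟩ | ⟨e, -⟩ <;> rw [e]
    · linarith [show 0 ≤ ‖z.2 - z.1‖ ^ p by positivity]
    · linarith [show 0 ≤ (1 + ‖z.1‖) ^ p by positivity]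
  refine h1.trans ?_
  rw [h2, h3]
  have hC0 : 0 ≤ C := by linarith
  refine mul_le_mul_of_nonneg_left (h4.trans ?_) hC0
  gcongr

/-- Observing `Y` instead of `X` and projecting the control does not increase the expected loss of
the position in `Y`, by convexity. -/
theorem value_le_integral_coupling (h : Regular p L l g) (x₀ : ℝ) {P Q : Measure (Path T)}
    (hP : P ∈ probMeasures p T) (hQ : Q ∈ probMeasures p T) {π : Measure (Path T × Path T)}
    (hc : IsCoupling P Q π) (hcaus : IsCausal (π.map Prod.swap)) {a : Path T → Fin T → ℝ}
    (ha : a ∈ controls T L) : value L x₀ l g Q ≤ ∫ z, l (wealth x₀ g (a z.1) z.2) ∂π := by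
  have hPp := hP.1
  have hπ := isProbabilityMeasure_of_coupling hc
  obtain ⟨C, hC1, hC⟩ := h.exists_growth x₀
  have hQi := integrable_norm_growth (by linarith [h.one_lt]) hQ
  have hQi' : Integrable (fun z : Path T × Path T => (1 + ‖z.2‖) ^ p) π := by
    rw [← hc.2] at hQi; exact hQi.comp_measurable measurable_snd
  have ham := measurable_of_mem_controls ha
  obtain ⟨b, hb, hproj⟩ := exists_projected_control hcaus hc.2 h.nonneg ha
  have hbm := measurable_of_mem_controls hb
  refine (value_le_expLoss h x₀ hQ hb).trans ?_
  have i1 : Integrable (fun z : Path T × Path T => l (wealth x₀ g (a z.1) z.2)) π :=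
    integrable_of_growth (C := C) hQi' (h.loss.continuous.measurable.comp
      (measurable_wealth_comp h.cont_payoff (ham.comp measurable_fst) measurable_snd))
      fun z => (hC (a z.1) z.2 fun t => (ha t).2 _).2.2.1
  have i2 : Integrable (fun z : Path T × Path T => l (terminal x₀ g b z.2)) π := by
    have := h.integrable_loss x₀ hQ hb
    rw [← hc.2] at this
    exact this.comp_measurable measurable_snd
  have e1 : expLoss x₀ l g Q b = ∫ z, l (terminal x₀ g b z.2) ∂π := by
    rw [expLoss, ← hc.2, integral_map measurable_snd.aemeasurable
      (by rw [hc.2]; exact (h.integrable_loss x₀ hQ hb).1)]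
  set v : Fin T → Path T → ℝ := fun t y =>
    deriv l (terminal x₀ g b y) * (y t - prev x₀ y t) with hv
  have hincm : ∀ t : Fin T, Measurable fun y : Path T => y t - prev x₀ y t := fun t =>
    (measurable_increment t).mono (canonFilt_le T _) le_rfl
  have hvi : ∀ t, Integrable (v t) Q := fun t =>
    h.integrable_deriv_mul x₀ hQ hb (hincm t) fun y => abs_increment_le y t
  have hvm : ∀ t, Measurable (v t) := fun t =>
    (h.cont_deriv.measurable.comp (measurable_terminal h.cont_payoff hb)).mul (hincm t)
  have hvi' : ∀ t, Integrable (fun z : Path T × Path T => v t z.2) π := fun t => by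
    have := hvi t
    rw [← hc.2] at this
    exact this.comp_measurable measurable_snd
  have j1 : ∀ t, Integrable (fun z : Path T × Path T => a z.1 t * v t z.2) π := fun t =>
    (hvi' t).bdd_mul ((measurable_pi_apply t).comp (ham.comp measurable_fst)).aestronglyMeasurable
      (Eventually.of_forall fun z => (ha t).2 z.1)
  have j2 : ∀ t, Integrable (fun z : Path T × Path T => b z.2 t * v t z.2) π := fun t =>
    (hvi' t).bdd_mul ((measurable_pi_apply t).comp (hbm.comp measurable_snd)).aestronglyMeasurable
      (Eventually.of_forall fun z => (hb t).2 z.2)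
  have j12 : ∀ t, Integrable (fun z : Path T × Path T =>
      a z.1 t * v t z.2 - b z.2 t * v t z.2) π := fun t => (j1 t).sub (j2 t)
  have j3 : Integrable (fun z : Path T × Path T =>
      ∑ t, (a z.1 t * v t z.2 - b z.2 t * v t z.2)) π :=
    integrable_finsetSum _ fun t _ => j12 t
  have hzero : ∫ z, ∑ t, (a z.1 t * v t z.2 - b z.2 t * v t z.2) ∂π = 0 := by
    rw [integral_finsetSum _ fun t _ => j12 t]
    refine Finset.sum_eq_zero fun t _ => ?_
    rw [integral_sub (j1 t) (j2 t), hproj t (v t) (hvm t) (hvi t), sub_self]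
  have hle : ∫ z, (l (terminal x₀ g b z.2) +
      ∑ t, (a z.1 t * v t z.2 - b z.2 t * v t z.2)) ∂π ≤
      ∫ z, l (wealth x₀ g (a z.1) z.2) ∂π := by
    refine integral_mono (i2.add j3) i1 fun z => ?_
    have := h.tangent_le (terminal x₀ g b z.2) (wealth x₀ g (a z.1) z.2)
    rw [terminal_eq_wealth, wealth_sub_wealth, Finset.mul_sum] at this
    refine le_trans (le_of_eq ?_) this
    simp only [hv, terminal_eq_wealth]
    congr 1
    refine Finset.sum_congr rfl fun t _ => ?_
    ring
  rw [integral_add i2 j3, hzero, add_zero] at hle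
  rw [e1]; exact hle

/-- Hölder's inequality for the first-order term: by causality, only its adapted part matters. -/
theorem integral_pathDeriv_le (h : Regular p L l g) (x₀ : ℝ) {P Q : Measure (Path T)}
    (hP : P ∈ probMeasures p T) (hQ : Q ∈ probMeasures p T) {π : Measure (Path T × Path T)}
    (hc : IsCoupling P Q π) (hcaus : IsCausal π) {r : ℝ} (hr : 0 ≤ r)
    (hcost : ∑ t : Fin T, ∫⁻ z, ENNReal.ofReal (|z.1 t - z.2 t| ^ p) ∂π ≤ ENNReal.ofReal (r ^ p))
    {a : Path T → Fin T → ℝ} (ha : a ∈ controls T L) :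
    ∫ z, pathDeriv x₀ l g (a z.1) z.1 (z.2 - z.1) ∂π ≤ r * sensitivity p x₀ l g P a := by
  have hPp := hP.1
  have hp := h.one_lt
  have hπ := isProbabilityMeasure_of_coupling hc
  have hpq := holderConjugate hp
  have hENN := hpq.symm.ennrealOfReal
  set q := p / (p - 1) with hq
  have hX : ∀ t : Fin T, MemLp (fun z : Path T × Path T => z.1 t) (ENNReal.ofReal p) π := fun t => by
    have h1 := hP.2
    rw [← hc.1] at h1
    exact (h1.comp_of_map measurable_fst.aemeasurable).of_le (by fun_prop)
      (Eventually.of_forall fun z => norm_le_pi_norm z.1 t)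
  have hY : ∀ t : Fin T, MemLp (fun z : Path T × Path T => z.2 t) (ENNReal.ofReal p) π := fun t => by
    have h1 := hQ.2
    rw [← hc.2] at h1
    exact (h1.comp_of_map measurable_snd.aemeasurable).of_le (by fun_prop)
      (Eventually.of_forall fun z => norm_le_pi_norm z.2 t)
  have hlift : ∀ w : Path T → ℝ, MemLp w (ENNReal.ofReal q) P →
      MemLp (fun z : Path T × Path T => w z.1) (ENNReal.ofReal q) π := fun w hw => by
    rw [← hc.1] at hw; exact hw.comp_of_map measurable_fst.aemeasurable
  set w := controlGrad x₀ l g a with hw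
  set s := sensTerm x₀ l g P a with hs
  have hwq : ∀ t, MemLp (w t) (ENNReal.ofReal q) P := h.memLp_controlGrad x₀ hP ha
  have hsq : ∀ t, MemLp (s t) (ENNReal.ofReal q) P := h.memLp_sensTerm x₀ hP ha
  have hEq : ∀ t : Fin T, MemLp (condExp (canonFilt T ((t : ℕ) + 1)) P (w t)) (ENNReal.ofReal q) P :=
    fun t => (hwq t).condExp (one_le_conj hp)
  -- only the conditional expectation of the gradient is seen by the displacement
  have hterm : ∀ t, ∫ z, w t z.1 * (z.2 - z.1) t ∂π = ∫ z, - s t z.1 * (z.2 t - z.1 t) ∂π := by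
    intro t
    have iY : Integrable (fun z : Path T × Path T => w t z.1 * z.2 t) π :=
      (hlift _ (hwq t)).integrable_mul (hY t)
    have iX : Integrable (fun z : Path T × Path T => w t z.1 * z.1 t) π :=
      (hlift _ (hwq t)).integrable_mul (hX t)
    have iY' : Integrable (fun z : Path T × Path T =>
        condExp (canonFilt T ((t : ℕ) + 1)) P (w t) z.1 * z.2 t) π :=
      (hlift _ (hEq t)).integrable_mul (hY t)
    have iX' : Integrable (fun z : Path T × Path T =>
        condExp (canonFilt T ((t : ℕ) + 1)) P (w t) z.1 * z.1 t) π :=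
      (hlift _ (hEq t)).integrable_mul (hX t)
    have hwi := h.integrable_controlGrad x₀ hP ha t
    have hwm := h.measurable_controlGrad (x₀ := x₀) ha t
    have hcm : Measurable[canonFilt T ((t : ℕ) + 1)] fun x : Path T => x t :=
      measurable_coord (Nat.lt_succ_self _)
    have e1 : ∫ z, w t z.1 * z.2 t ∂π =
        ∫ z, condExp (canonFilt T ((t : ℕ) + 1)) P (w t) z.1 * z.2 t ∂π := by
      have := hcaus.integral_mul_eq (n := t + 1) t.isLt hwm (by rw [hc.1]; exact hwi) hcm iY
        (by rw [hc.1]; exact iY')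
      rw [hc.1] at this
      exact this
    have e2 : ∫ z, w t z.1 * z.1 t ∂π =
        ∫ z, condExp (canonFilt T ((t : ℕ) + 1)) P (w t) z.1 * z.1 t ∂π := by
      have hXP : MemLp (fun x : Path T => x t) (ENNReal.ofReal p) P :=
        hP.2.of_le (measurable_pi_apply t).aestronglyMeasurable
          (Eventually.of_forall fun x => norm_le_pi_norm x t)
      have m1 : AEStronglyMeasurable (fun x : Path T => w t x * x t) (π.map Prod.fst) :=
        (hwm.mul (measurable_pi_apply t)).aestronglyMeasurable
      have m2 : AEStronglyMeasurable (fun x : Path T =>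
          condExp (canonFilt T ((t : ℕ) + 1)) P (w t) x * x t) (π.map Prod.fst) := by
        rw [hc.1]; exact integrable_condExp.1.mul hXP.1
      rw [← integral_map (f := fun x : Path T => w t x * x t) measurable_fst.aemeasurable m1,
        ← integral_map (f := fun x : Path T =>
          condExp (canonFilt T ((t : ℕ) + 1)) P (w t) x * x t) measurable_fst.aemeasurable m2,
        hc.1, ← integral_condExp (canonFilt_le T ((t : ℕ) + 1))]
      exact integral_congr_ae (condExp_mul_of_stronglyMeasurable_right hcm.stronglyMeasurable
        ((hwq t).integrable_mul hXP) hwi)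
    have e3 : ∀ᵐ z ∂π, condExp (canonFilt T ((t : ℕ) + 1)) P (w t) z.1 = - s t z.1 := by
      have := h.condExp_controlGrad x₀ hP ha t
      rw [← hc.1] at this
      have := ae_of_ae_map measurable_fst.aemeasurable this
      rw [hc.1] at this
      exact this
    calc ∫ z, w t z.1 * (z.2 - z.1) t ∂π
        = ∫ z, w t z.1 * z.2 t ∂π - ∫ z, w t z.1 * z.1 t ∂π := by
          rw [← integral_sub iY iX]; simp only [Pi.sub_apply, mul_sub]
      _ = ∫ z, (condExp (canonFilt T ((t : ℕ) + 1)) P (w t) z.1 * z.2 t -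
          condExp (canonFilt T ((t : ℕ) + 1)) P (w t) z.1 * z.1 t) ∂π := by
          rw [e1, e2, ← integral_sub iY' iX']
      _ = _ := by
          refine integral_congr_ae ?_
          filter_upwards [e3] with z hz
          rw [hz]; ring
  have hD : ∀ t : Fin T, MemLp (fun z : Path T × Path T => z.2 t - z.1 t) (ENNReal.ofReal p) π :=
    fun t => (hY t).sub (hX t)
  have hholder : ∀ t, ∫ z, - s t z.1 * (z.2 t - z.1 t) ∂π ≤
      (∫ x, |s t x| ^ q ∂P) ^ (1 / q) * (∫ z : Path T × Path T, |z.1 t - z.2 t| ^ p ∂π) ^ (1 / p) := by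
    intro t
    have h1 := integral_mul_norm_le_Lp_mul_Lq hpq.symm (hlift _ (hsq t)) (hD t)
    have h2 : ∫ z : Path T × Path T, ‖s t z.1‖ ^ q ∂π = ∫ x, |s t x| ^ q ∂P := by
      have m1 : AEStronglyMeasurable (fun x => |s t x| ^ q) (π.map Prod.fst) := by
        rw [hc.1]; exact (h.integrable_sensTerm_rpow x₀ hP ha t).1
      have := integral_map measurable_fst.aemeasurable m1
      rw [hc.1] at this
      rw [this]; rfl
    have h3 : ∫ z : Path T × Path T, ‖z.2 t - z.1 t‖ ^ p ∂π =
        ∫ z : Path T × Path T, |z.1 t - z.2 t| ^ p ∂π := by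
      simp only [Real.norm_eq_abs, abs_sub_comm]
    rw [h2, h3] at h1
    refine le_trans ?_ h1
    refine integral_mono ((hlift _ (hsq t)).neg.integrable_mul (hD t))
      ((hlift _ (hsq t)).norm.integrable_mul (hD t).norm) fun z => ?_
    simp only [Real.norm_eq_abs, ← abs_mul]
    refine (le_abs_self _).trans (le_of_eq ?_)
    rw [neg_mul, abs_neg]
  have hint : ∫ z, pathDeriv x₀ l g (a z.1) z.1 (z.2 - z.1) ∂π =
      ∑ t, ∫ z, - s t z.1 * (z.2 t - z.1 t) ∂π := by
    simp only [pathDeriv_eq_sum_controlGrad]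
    have hi : ∀ t, Integrable (fun z : Path T × Path T => w t z.1 * (z.2 - z.1) t) π := fun t =>
      (hlift _ (hwq t)).integrable_mul (hD t)
    rw [integral_finsetSum _ fun t _ => hi t]
    exact Finset.sum_congr rfl fun t _ => hterm t
  have h0s : ∀ t, 0 ≤ ∫ x, |s t x| ^ q ∂P := fun t => integral_nonneg fun x => by positivity
  have h0D : ∀ t : Fin T, 0 ≤ ∫ z : Path T × Path T, |z.1 t - z.2 t| ^ p ∂π := fun t =>
    integral_nonneg fun x => by positivity
  rw [hint]
  refine (Finset.sum_le_sum fun t _ => hholder t).trans ?_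
  refine (Real.inner_le_Lp_mul_Lq_of_nonneg Finset.univ hpq.symm
    (fun t _ => Real.rpow_nonneg (h0s t) _) (fun t _ => Real.rpow_nonneg (h0D t) _)).trans ?_
  have e1 : ∀ t, ((∫ x, |s t x| ^ q ∂P) ^ (1 / q)) ^ q = ∫ x, |s t x| ^ q ∂P := fun t => by
    rw [one_div, Real.rpow_inv_rpow (h0s t) hpq.symm.ne_zero]
  have e2 : ∀ t : Fin T, ((∫ z : Path T × Path T, |z.1 t - z.2 t| ^ p ∂π) ^ (1 / p)) ^ p =
      ∫ z : Path T × Path T, |z.1 t - z.2 t| ^ p ∂π := fun t => by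
    rw [one_div, Real.rpow_inv_rpow (h0D t) hpq.ne_zero]
  simp only [e1, e2]
  rw [mul_comm]
  have hV0 : 0 ≤ sensitivity p x₀ l g P a := by
    unfold sensitivity
    exact Real.rpow_nonneg (Finset.sum_nonneg fun t _ => integral_nonneg fun x => by positivity) _
  refine mul_le_mul ?_ le_rfl hV0 hr
  rw [one_div, Real.rpow_inv_le_iff_of_pos (Finset.sum_nonneg fun t _ => h0D t) hr (by linarith)]
  exact sum_integral_le_of_cost (by linarith) hr hcost

/-- The first-order upper bound, uniformly in the ball. -/
theorem exists_value_le (h : Regular p L l g) {P : Measure (Path T)} (hP : P ∈ probMeasures p T)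
    {a : Path T → Fin T → ℝ} (ha : IsOptimizer L x₀ l g P a) {ε : ℝ} (hε : 0 < ε) :
    ∃ ρ : ℝ, 0 < ρ ∧ ∀ r : ℝ, 0 < r → r < ρ → ∀ Q ∈ adaptedBall p P r,
      value L x₀ l g Q ≤ value L x₀ l g P + r * sensitivity p x₀ l g P a + ε * r := by
  have hp := h.one_lt
  have hPp := hP.1
  obtain ⟨ρ, hρ, hrem⟩ := h.abs_integral_remainder_le x₀ hP hε
  refine ⟨ρ, hρ, fun r hr hrρ Q hQ => ?_⟩
  have key : ∀ r' : ℝ, r < r' → r' < ρ →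
      value L x₀ l g Q ≤ value L x₀ l g P + r' * sensitivity p x₀ l g P a + ε * r' := by
    intro r' hrr hr'
    have hr'0 : 0 < r' := hr.trans hrr
    obtain ⟨π, hc, hb, hcost⟩ := exists_bicausal_coupling (by linarith) hr.le hrr hQ
    have hπ := isProbabilityMeasure_of_coupling hc
    have h1 := hrem r' hr'0 hr'.le π hπ hc.1 (integrable_norm_rpow_of_cost (by linarith) hcost)
      (integral_norm_rpow_le_of_cost (by linarith) hr'0.le hcost) a
      (measurable_of_mem_controls ha.1) fun x t => (ha.1 t).2 x
    have h2 := value_le_integral_coupling h x₀ hP hQ.1 hc hb.2 ha.1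
    have h3 := integral_pathDeriv_le h x₀ hP hQ.1 hc hb.1 hr'0.le hcost ha.1
    have h4 : ∫ x, l (wealth x₀ g (a x) x) ∂P = value L x₀ l g P := ha.2
    rw [h4] at h1
    linarith [(abs_le.1 h1).2]
  -- the coupling is only known to exist for every larger radius
  have hcont : Tendsto (fun r' : ℝ => value L x₀ l g P + r' * sensitivity p x₀ l g P a + ε * r')
      (𝓝[>] r) (𝓝 (value L x₀ l g P + r * sensitivity p x₀ l g P a + ε * r)) := by
    refine Tendsto.mono_left (Continuous.tendsto ?_ r) nhdsWithin_le_nhds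
    fun_prop
  refine ge_of_tendsto hcont ?_
  filter_upwards [Ioo_mem_nhdsGT hrρ] with r' hr'
  exact key r' hr'.1 hr'.2

/-! ### Adapted perturbations of the paths -/

/-- The path with all coordinates from the index `n` on set to `0`. It generates `canonFilt T n`. -/
def freeze (n : ℕ) (x : Path T) : Path T := fun s => if (s : ℕ) < n then x s else 0

lemma freeze_freeze (n : ℕ) (x : Path T) : freeze n (freeze n x) = freeze n x := by
  funext s; unfold freeze; split_ifs <;> rfl

lemma canonFilt_le_comap_freeze (n : ℕ) :
    canonFilt T n ≤ MeasurableSpace.comap (freeze n) (inferInstance : MeasurableSpace (Path T)) := by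
  refine iSup₂_le fun s hs => ?_
  have : (fun x : Path T => x s) = (fun x : Path T => x s) ∘ freeze n := by
    funext x; simp [freeze, hs]
  rw [this, ← MeasurableSpace.comap_comp]
  exact MeasurableSpace.comap_mono (measurable_pi_apply s).comap_le

lemma measurable_freeze (n : ℕ) : Measurable[canonFilt T n] (freeze n : Path T → Path T) := by
  refine @measurable_pi_lambda _ _ _ (canonFilt T n) _ _ fun s => ?_
  unfold freeze
  split_ifs with hs
  · exact measurable_coord hs
  · exact @measurable_const _ _ _ (canonFilt T n) _

lemma apply_freeze {n : ℕ} {φ : Path T → ℝ} (hφ : Measurable[canonFilt T n] φ) (x : Path T) :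
    φ (freeze n x) = φ x :=
  (hφ.mono (canonFilt_le_comap_freeze n) le_rfl).factorsThrough (freeze_freeze n x)

lemma dist_freeze_le (n : ℕ) (x y : Path T) : dist (freeze n x) (freeze n y) ≤ dist x y := by
  refine (dist_pi_le_iff dist_nonneg).2 fun s => ?_
  unfold freeze
  split_ifs
  · exact dist_le_pi_dist x y s
  · simp

/-- Adapted functions with a finite `p`-th moment are approximated by bounded Lipschitz functions of
the same coordinates. -/
lemma exists_lipschitz_approx (hp : 1 ≤ p) {P : Measure (Path T)} [IsProbabilityMeasure P] {n : ℕ}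
    {φ : Path T → ℝ} (hφ : Measurable[canonFilt T n] φ) (hφp : MemLp φ (ENNReal.ofReal p) P)
    {η : ℝ} (hη : 0 < η) :
    ∃ f : Path T → ℝ, Measurable[canonFilt T n] f ∧ (∃ K : NNReal, LipschitzWith K f) ∧
      (∃ M : ℝ, ∀ x, |f x| ≤ M) ∧ eLpNorm (φ - f) (ENNReal.ofReal p) P ≤ ENNReal.ofReal η := by
  have hfm : Measurable (freeze n : Path T → Path T) :=
    (measurable_freeze n).mono (canonFilt_le T n) le_rfl
  have hφm : Measurable φ := hφ.mono (canonFilt_le T n) le_rfl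
  have := Measure.isProbabilityMeasure_map (μ := P) hfm.aemeasurable
  have hcomp : φ ∘ freeze n = φ := funext (apply_freeze hφ)
  have hφ' : MemLp φ (ENNReal.ofReal p) (P.map (freeze n)) := by
    rw [memLp_map_measure_iff hφm.aestronglyMeasurable hfm.aemeasurable, hcomp]
    exact hφp
  obtain ⟨u, hu, hud, hun⟩ := hφ'.exist_eLpNorm_sub_le (by simp)
    (by rw [ENNReal.one_le_ofReal]; exact hp) hη
  obtain ⟨K, hK⟩ := hud.lipschitzWith_of_hasCompactSupport hu (by simp)
  obtain ⟨M, hM⟩ := hu.exists_bound_of_continuous hud.continuous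
  refine ⟨u ∘ freeze n, hud.continuous.measurable.comp (measurable_freeze n), ⟨K, ?_⟩,
    ⟨M, fun x => hM _⟩, ?_⟩
  · refine LipschitzWith.of_dist_le_mul fun x y => (hK.dist_le_mul _ _).trans ?_
    gcongr
    exact dist_freeze_le n x y
  · rw [eLpNorm_map_measure (hφm.sub hud.continuous.measurable).aestronglyMeasurable
      hfm.aemeasurable] at hun
    have e : (φ - u) ∘ freeze n = φ - u ∘ freeze n := by
      funext x; simp [apply_freeze hφ]
    rwa [e] at hun

/-- A direction of perturbation of the paths: bounded, Lipschitz and adapted. -/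
structure IsDirection (f : Path T → Path T) : Prop where
  adapted : ∀ t : Fin T, Measurable[canonFilt T ((t : ℕ) + 1)] fun x => f x t
  lipschitz : ∃ K : NNReal, LipschitzWith K f
  bounded : ∃ M : ℝ, ∀ x, ‖f x‖ ≤ M

lemma IsDirection.measurable {f : Path T → Path T} (hf : IsDirection f) : Measurable f :=
  measurable_pi_lambda _ fun t => (hf.adapted t).mono (canonFilt_le T _) le_rfl

/-- The map that moves the path `x` by `r • f x`. -/
def shift (r : ℝ) (f : Path T → Path T) (x : Path T) : Path T := x + r • f x

lemma injective_add_smul {r : ℝ} (hr : 0 ≤ r) {K : NNReal} (hrK : r * K < 1) {f : Path T → Path T}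
    (hf : LipschitzWith K f) : Function.Injective (shift r f) := by
  intro x y hxy
  have h1 : x - y = r • (f y - f x) := by
    simp only [shift] at hxy
    rw [smul_sub, sub_eq_sub_iff_add_eq_add, hxy, add_comm]
  have h2 : dist x y ≤ r * K * dist x y := by
    calc dist x y = ‖r • (f y - f x)‖ := by rw [dist_eq_norm, h1]
      _ = r * dist (f x) (f y) := by
        rw [norm_smul, Real.norm_of_nonneg hr, dist_comm, dist_eq_norm]
      _ ≤ r * (K * dist x y) := by gcongr; exact hf.dist_le_mul x y
      _ = _ := by ring
  have h3 : dist x y = 0 := by nlinarith [dist_nonneg (x := x) (y := y)]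
  exact dist_eq_zero.1 h3

lemma measurable_shift {r : ℝ} {f : Path T → Path T} (hf : IsDirection f) (n : ℕ) :
    @Measurable _ _ (canonFilt T n) (canonFilt T n) (shift r f) := by
  refine measurable_canonFilt_of fun s hs => ?_
  have hq : Measurable fun q : ℝ × ℝ => q.1 + r * q.2 := by fun_prop
  exact hq.comp ((measurable_coord hs).prodMk ((hf.adapted s).mono (canonFilt_mono hs) le_rfl))

lemma measurable_shift_borel {r : ℝ} {f : Path T → Path T} (hf : IsDirection f) :
    Measurable (shift r f) := by
  have := hf.measurable
  unfold shift; fun_prop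

/-- For small `r`, the past of the shifted path determines the past of the path: the shift is
injective and, up to the time `n`, acts on the first `n` coordinates only. -/
lemma exists_preimage_shift {r : ℝ} (hr : 0 ≤ r) {f : Path T → Path T} (hf : IsDirection f)
    {K : NNReal} (hK : LipschitzWith K f) (hrK : r * K < 1) {n : ℕ} {B : Set (Path T)}
    (hB : MeasurableSet[canonFilt T n] B) :
    ∃ B', MeasurableSet[canonFilt T n] B' ∧ shift r f ⁻¹' B' = B := by
  obtain ⟨A, hA, rfl⟩ := canonFilt_le_comap_freeze n B hB
  set fn : Path T → Path T := fun x => freeze n (f x) with hfn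
  have hfm : Measurable (freeze n : Path T → Path T) :=
    (measurable_freeze n).mono (canonFilt_le T n) le_rfl
  have hinj : Function.Injective (shift r fn) := by
    refine injective_add_smul hr hrK (LipschitzWith.of_dist_le_mul fun x y => ?_)
    exact (dist_freeze_le n _ _).trans (hK.dist_le_mul x y)
  have hmeas : Measurable (shift r fn) := by
    have := hfm.comp hf.measurable
    unfold shift
    exact measurable_id.add (this.const_smul r)
  have hemb := hmeas.measurableEmbedding hinj
  refine ⟨freeze n ⁻¹' (shift r fn '' A), measurable_freeze n (hemb.measurableSet_image.2 hA), ?_⟩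
  have hcomm : ∀ x, freeze n (shift r f x) = shift r fn (freeze n x) := by
    intro x
    funext s
    by_cases hs : (s : ℕ) < n
    · have h1 : f (freeze n x) s = f x s :=
        apply_freeze ((hf.adapted s).mono (canonFilt_mono hs) le_rfl) x
      simp [freeze, shift, hfn, hs] at h1 ⊢
      rw [h1]; simp
    · simp [freeze, shift, hfn, hs]
  ext x
  simp only [Set.mem_preimage, hcomm]
  exact hinj.mem_set_image

/-- A coupling is causal if the past of `Y` is almost surely contained in the past of `X`. -/
lemma isCausal_of_ae_eq {π : Measure (Path T × Path T)} [IsProbabilityMeasure π]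
    (h : ∀ n ≤ T, ∀ B : Set (Path T), MeasurableSet[canonFilt T n] B →
      ∃ B' : Set (Path T), MeasurableSet[canonFilt T n] B' ∧ ∀ᵐ z ∂π, z.2 ∈ B ↔ z.1 ∈ B') :
    IsCausal π := by
  intro n _ hn B hB
  obtain ⟨B', hB', hae⟩ := h n hn B hB
  have hle : ∀ n, MeasurableSpace.comap (Prod.fst : Path T × Path T → Path T) (canonFilt T n) ≤
      (inferInstance : MeasurableSpace (Path T × Path T)) := fun n =>
    (MeasurableSpace.comap_mono (canonFilt_le T n)).trans measurable_fst.comap_le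
  set J : Path T × Path T → ℝ := (Prod.fst ⁻¹' B').indicator fun _ => (1 : ℝ) with hJ
  have hIJ : (Prod.snd ⁻¹' B).indicator (fun _ => (1 : ℝ)) =ᵐ[π] J := by
    filter_upwards [hae] with z hz
    by_cases hB : z.1 ∈ B' <;> simp [hJ, hB, hz]
  have hJi : Integrable J π := (integrable_const 1).indicator (hle n _ ⟨B', hB', rfl⟩)
  have key : ∀ m, n ≤ m → condExp (MeasurableSpace.comap
      (Prod.fst : Path T × Path T → Path T) (canonFilt T m)) π
      ((Prod.snd ⁻¹' B).indicator fun _ => (1 : ℝ)) =ᵐ[π] J := by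
    intro m hm
    refine (condExp_congr_ae hIJ).trans ?_
    rw [condExp_of_stronglyMeasurable (hle m) ?_ hJi]
    exact (@stronglyMeasurable_const _ _ (MeasurableSpace.comap
      (Prod.fst : Path T × Path T → Path T) (canonFilt T m)) _ _).indicator
      ⟨B', canonFilt_mono hm B' hB', rfl⟩
  exact (key T hn).trans (key n le_rfl).symm

section Shift

variable {P : Measure (Path T)} {r : ℝ} {f : Path T → Path T}

lemma isCoupling_shift (hf : IsDirection f) :
    IsCoupling P (P.map (shift r f)) (P.map fun x => (x, shift r f x)) := by
  have hm : Measurable fun x : Path T => (x, shift r f x) :=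
    measurable_id.prodMk (measurable_shift_borel hf)
  refine ⟨?_, ?_⟩
  · rw [Measure.map_map measurable_fst hm]
    exact Measure.map_id
  · rw [Measure.map_map measurable_snd hm]; rfl

lemma isBicausal_shift [IsProbabilityMeasure P] (hr : 0 ≤ r) (hf : IsDirection f) {K : NNReal}
    (hK : LipschitzWith K f) (hrK : r * K < 1) : IsBicausal (P.map fun x => (x, shift r f x)) := by
  have hs := measurable_shift_borel (r := r) hf
  have hm : Measurable fun x : Path T => (x, shift r f x) := measurable_id.prodMk hs
  have hm' : Measurable fun x : Path T => (shift r f x, x) := hs.prodMk measurable_id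
  have hsw : (P.map fun x => (x, shift r f x)).map Prod.swap = P.map fun x => (shift r f x, x) := by
    rw [Measure.map_map measurable_swap hm]; rfl
  have := Measure.isProbabilityMeasure_map (μ := P) hm.aemeasurable
  have := Measure.isProbabilityMeasure_map (μ := P) hm'.aemeasurable
  refine ⟨isCausal_of_ae_eq fun n _ B hB => ⟨shift r f ⁻¹' B, measurable_shift hf n hB, ?_⟩, ?_⟩
  · have hBm := canonFilt_le T n B hB
    rw [ae_map_iff hm.aemeasurable]
    · exact Eventually.of_forall fun x => Iff.rfl
    · exact (measurable_snd hBm).iff (measurable_fst (hs hBm))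
  · rw [hsw]
    refine isCausal_of_ae_eq fun n _ B hB => ?_
    obtain ⟨B', hB', he⟩ := exists_preimage_shift hr hf hK hrK hB
    refine ⟨B', hB', ?_⟩
    rw [ae_map_iff hm'.aemeasurable]
    · refine Eventually.of_forall fun x => ?_
      simp only [← he, Set.mem_preimage]
    · exact (measurable_snd (canonFilt_le T n B hB)).iff
        (measurable_fst (canonFilt_le T n B' hB'))

lemma lintegral_cost_shift_le (hp : 0 < p) [IsProbabilityMeasure P] (hr : 0 ≤ r)
    (hf : IsDirection f) (hfp : ∑ t, ∫ x, |f x t| ^ p ∂P ≤ 1) :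
    ∑ t : Fin T, ∫⁻ z, ENNReal.ofReal (|z.1 t - z.2 t| ^ p) ∂(P.map fun x => (x, shift r f x)) ≤
      ENNReal.ofReal (r ^ p) := by
  have hm : Measurable fun x : Path T => (x, shift r f x) :=
    measurable_id.prodMk (measurable_shift_borel hf)
  obtain ⟨M, hM⟩ := hf.bounded
  have hft : ∀ t, Measurable fun x => f x t := fun t =>
    (measurable_pi_apply t).comp hf.measurable
  have hi : ∀ t, Integrable (fun x => |f x t| ^ p) P := fun t => by
    refine Integrable.of_bound ((hft t).abs.pow_const p).aestronglyMeasurable (M ^ p)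
      (Eventually.of_forall fun x => ?_)
    rw [Real.norm_of_nonneg (by positivity)]
    exact Real.rpow_le_rpow (abs_nonneg _) ((norm_le_pi_norm (f x) t).trans (hM x)) hp.le
  have e : ∀ t : Fin T, ∫⁻ z, ENNReal.ofReal (|z.1 t - z.2 t| ^ p)
      ∂(P.map fun x => (x, shift r f x)) = ENNReal.ofReal (r ^ p * ∫ x, |f x t| ^ p ∂P) := by
    intro t
    have hmt : Measurable fun z : Path T × Path T => ENNReal.ofReal (|z.1 t - z.2 t| ^ p) := by
      fun_prop (disch := linarith)
    rw [lintegral_map hmt hm, ← integral_const_mul, ofReal_integral_eq_lintegral_ofReal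
      ((hi t).const_mul _) (Eventually.of_forall fun x => by positivity)]
    refine lintegral_congr fun x => ?_
    congr 1
    simp only [shift, Pi.add_apply, Pi.smul_apply, smul_eq_mul, sub_add_cancel_left, abs_neg,
      abs_mul, abs_of_nonneg hr]
    rw [Real.mul_rpow hr (abs_nonneg _)]
  simp only [e]
  rw [← ENNReal.ofReal_sum_of_nonneg fun t _ =>
    mul_nonneg (by positivity) (integral_nonneg fun x => by positivity), ← Finset.mul_sum]
  refine ENNReal.ofReal_le_ofReal ?_
  have : 0 ≤ r ^ p := by positivity
  nlinarith

lemma shift_mem_adaptedBall (hp : 0 < p) (hP : P ∈ probMeasures p T) (hr : 0 ≤ r)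
    (hf : IsDirection f) {K : NNReal} (hK : LipschitzWith K f) (hrK : r * K < 1)
    (hfp : ∑ t, ∫ x, |f x t| ^ p ∂P ≤ 1) : P.map (shift r f) ∈ adaptedBall p P r := by
  have hPp := hP.1
  have hs := measurable_shift_borel (r := r) hf
  obtain ⟨M, hM⟩ := hf.bounded
  refine ⟨⟨Measure.isProbabilityMeasure_map hs.aemeasurable, ?_⟩, ?_⟩
  · have h1 : MemLp (shift r f) (ENNReal.ofReal p) P := by
      have h2 : MemLp f (ENNReal.ofReal p) P :=
        MemLp.of_bound hf.measurable.aestronglyMeasurable M (Eventually.of_forall hM)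
      exact hP.2.add (h2.const_smul r)
    have h3 : AEStronglyMeasurable (fun x : Path T => x) (P.map (shift r f)) :=
      measurable_id.aestronglyMeasurable
    exact (memLp_map_measure_iff h3 hs.aemeasurable).2 h1
  · refine (iInf₂_le _ ⟨isCoupling_shift hf, isBicausal_shift hr hf hK hrK⟩).trans ?_
    rw [one_div, ENNReal.rpow_inv_le_iff hp, ENNReal.ofReal_rpow_of_nonneg hr hp.le]
    exact lintegral_cost_shift_le hp hr hf hfp

lemma comp_shift_mem_controls (hf : IsDirection f) {b : Path T → Fin T → ℝ}
    (hb : b ∈ controls T L) : (fun x => b (shift r f x)) ∈ controls T L := fun t =>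
  ⟨(hb t).1.comp (measurable_shift hf t), fun _ => (hb t).2 _⟩

end Shift

/-! ### Optimal directions -/

/-- The derivative of the expected loss of the control `a` in the direction `f`. -/
def dirDeriv (x₀ : ℝ) (l : ℝ → ℝ) (g : Path T → ℝ) (P : Measure (Path T)) (f : Path T → Path T)
    (a : Path T → Fin T → ℝ) : ℝ :=
  ∫ x, pathDeriv x₀ l g (a x) x (f x) ∂P

section Direction

variable {P : Measure (Path T)} {a : Path T → Fin T → ℝ}

lemma measurable_sensTerm (ha : a ∈ controls T L) (t : Fin T) :
    Measurable[canonFilt T ((t : ℕ) + 1)] (sensTerm x₀ l g P a t) := by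
  have hq : Measurable fun q : ℝ × ℝ × ℝ × ℝ => (q.1 - q.2.1) * q.2.2.1 - q.2.2.2 := by fun_prop
  exact hq.comp ((measurable_nextControl ha t).prodMk
    (((ha t).1.mono (canonFilt_mono (Nat.le_succ _)) le_rfl).prodMk
      (stronglyMeasurable_condExp.measurable.prodMk stronglyMeasurable_condExp.measurable)))

lemma Regular.dirDeriv_eq_sum (h : Regular p L l g) (x₀ : ℝ) (hP : P ∈ probMeasures p T)
    (ha : a ∈ controls T L) {f : Path T → Path T} (hf : IsDirection f) :
    dirDeriv x₀ l g P f a = ∑ t, ∫ x, - sensTerm x₀ l g P a t x * f x t ∂P := by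
  have hPp := hP.1
  obtain ⟨M, hM⟩ := hf.bounded
  have hfb : ∀ t, ∀ᵐ x ∂P, ‖f x t‖ ≤ M := fun t =>
    Eventually.of_forall fun x => (norm_le_pi_norm (f x) t).trans (hM x)
  have hft : ∀ t, Measurable fun x => f x t := fun t =>
    (measurable_pi_apply t).comp hf.measurable
  have hi : ∀ t, Integrable (fun x => controlGrad x₀ l g a t x * f x t) P := fun t =>
    (h.integrable_controlGrad x₀ hP ha t).mul_bdd (hft t).aestronglyMeasurable (hfb t)
  simp only [dirDeriv, pathDeriv_eq_sum_controlGrad]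
  rw [integral_finsetSum _ fun t _ => hi t]
  refine Finset.sum_congr rfl fun t _ => ?_
  rw [← integral_condExp (canonFilt_le T ((t : ℕ) + 1))]
  refine integral_congr_ae ?_
  filter_upwards [h.condExp_controlGrad x₀ hP ha t,
    condExp_mul_of_stronglyMeasurable_right (hf.adapted t).stronglyMeasurable (hi t)
      (h.integrable_controlGrad x₀ hP ha t)] with x h1 h2
  have h3 : condExp (canonFilt T ((t : ℕ) + 1)) P
    (fun x => controlGrad x₀ l g a t x * f x t) x = _ := h2
  rw [h3, Pi.mul_apply, h1]

/-- The extremal function in Hölder's inequality. -/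
lemma exists_adapted_extremal (h : Regular p L l g) (x₀ : ℝ) (hP : P ∈ probMeasures p T)
    (ha : a ∈ controls T L) (hV : 0 < sensitivity p x₀ l g P a) :
    ∃ φ : Fin T → Path T → ℝ, (∀ t : Fin T, Measurable[canonFilt T ((t : ℕ) + 1)] (φ t)) ∧
      (∀ t, MemLp (φ t) (ENNReal.ofReal p) P) ∧ ∑ t, ∫ x, |φ t x| ^ p ∂P = 1 ∧
      ∑ t, ∫ x, - sensTerm x₀ l g P a t x * φ t x ∂P = sensitivity p x₀ l g P a := by
  have hp := h.one_lt
  have hpq := holderConjugate hp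
  set q := p / (p - 1) with hq
  set s := sensTerm x₀ l g P a with hs
  set W : ℝ := ∑ t, ∫ x, |s t x| ^ q ∂P with hW
  have hVW : sensitivity p x₀ l g P a = W ^ (1 / q) := rfl
  have hW0 : 0 ≤ W := Finset.sum_nonneg fun t _ => integral_nonneg fun x => by positivity
  have hWpos : 0 < W := by
    rcases hW0.eq_or_lt with h0 | h0
    · rw [hVW, ← h0, Real.zero_rpow (one_div_ne_zero hpq.symm.ne_zero)] at hV
      exact absurd hV (lt_irrefl _)
    · exact h0
  set c : ℝ := W ^ (-(1 / p)) with hc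
  have hc0 : 0 ≤ c := by positivity
  have hsm : ∀ t, Measurable (s t) := fun t =>
    (measurable_sensTerm ha t).mono (canonFilt_le T _) le_rfl
  have hq1 := hpq.symm.lt
  have habs : ∀ u : ℝ, |(-c) * (u * |u| ^ (q - 2))| ^ p = c ^ p * |u| ^ q := by
    intro u
    have h1 : |u| * |u| ^ (q - 2) = |u| ^ (q - 1) := by
      rcases eq_or_ne u 0 with rfl | hu
      · rw [abs_zero, zero_mul, Real.zero_rpow (by linarith)]
      · have : |u| ≠ 0 := abs_ne_zero.2 hu
        rw [show q - 1 = (q - 2) + 1 by ring, Real.rpow_add_one this, mul_comm]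
    rw [abs_mul, abs_neg, abs_of_nonneg hc0, abs_mul,
      abs_of_nonneg (Real.rpow_nonneg (abs_nonneg u) _), h1,
      Real.mul_rpow hc0 (by positivity), ← Real.rpow_mul (abs_nonneg _)]
    congr 2
    exact hpq.symm.sub_one_mul_conj
  have hpair : ∀ u : ℝ, - u * ((-c) * (u * |u| ^ (q - 2))) = c * |u| ^ q := by
    intro u
    rcases eq_or_ne u 0 with rfl | hu
    · have h0 : (0 : ℝ) ^ q = 0 := Real.zero_rpow (by linarith)
      rw [abs_zero, h0]; ring
    · have h0 : |u| ≠ 0 := abs_ne_zero.2 hu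
      rw [show q = (q - 2) + 1 + 1 by ring, Real.rpow_add_one h0, Real.rpow_add_one h0,
        show q - 2 + 1 + 1 - 2 = q - 2 by ring, mul_assoc (|u| ^ (q - 2)), abs_mul_abs_self]
      ring
  have hφm : Measurable fun u : ℝ => (-c) * (u * |u| ^ (q - 2)) :=
    measurable_const.mul (measurable_id.mul (measurable_id.abs.pow_const _))
  refine ⟨fun t x => (-c) * (s t x * |s t x| ^ (q - 2)),
    fun t => hφm.comp (measurable_sensTerm ha t), fun t => ?_, ?_, ?_⟩
  · have hm : AEStronglyMeasurable (fun x => (-c) * (s t x * |s t x| ^ (q - 2))) P :=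
      (hφm.comp (hsm t)).aestronglyMeasurable
    change MemLp (fun x => (-c) * (s t x * |s t x| ^ (q - 2))) (ENNReal.ofReal p) P
    rw [← integrable_norm_rpow_iff hm (by simp; linarith)
      (by simp), ENNReal.toReal_ofReal (by linarith)]
    simp only [Real.norm_eq_abs, habs]
    exact (h.integrable_sensTerm_rpow x₀ hP ha t).const_mul _
  · simp only [habs, integral_const_mul]
    rw [← Finset.mul_sum, ← hW, hc, ← Real.rpow_mul hW0, neg_mul, one_div,
      inv_mul_cancel₀ (by linarith), Real.rpow_neg_one, inv_mul_cancel₀ hWpos.ne']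
  · simp only [hpair, integral_const_mul]
    rw [← Finset.mul_sum, ← hW, hVW, hc]
    nth_rewrite 2 [← Real.rpow_one W]
    rw [← Real.rpow_add hWpos]
    congr 1
    have := hpq.inv_add_inv_eq_one
    rw [one_div, one_div]; linarith

/-- Directions of norm at most one in `L^p` attain the first-order coefficient approximately. -/
theorem exists_direction (h : Regular p L l g) (x₀ : ℝ) (hP : P ∈ probMeasures p T)
    (ha : a ∈ controls T L) {ε : ℝ} (hε : 0 < ε) :
    ∃ f : Path T → Path T, IsDirection f ∧ ∑ t, ∫ x, |f x t| ^ p ∂P ≤ 1 ∧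
      sensitivity p x₀ l g P a - ε ≤ dirDeriv x₀ l g P f a := by
  have hp := h.one_lt
  have hPp := hP.1
  have hpq := holderConjugate hp
  have hENN := hpq.symm.ennrealOfReal
  have hV0 : 0 ≤ sensitivity p x₀ l g P a := by
    unfold sensitivity
    exact Real.rpow_nonneg (Finset.sum_nonneg fun t _ => integral_nonneg fun x => by positivity) _
  rcases hV0.eq_or_lt with hV | hV
  · have hd : IsDirection (0 : Path T → Path T) :=
      ⟨fun t => @measurable_const _ _ _ (canonFilt T _) _, ⟨0, LipschitzWith.const 0⟩,
        ⟨0, fun x => by simp⟩⟩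
    refine ⟨0, hd, ?_, ?_⟩
    · simp [Real.zero_rpow (by linarith : p ≠ 0)]
    · rw [h.dirDeriv_eq_sum x₀ hP ha hd, ← hV]
      simp [hε.le]
  obtain ⟨φ, hφm, hφp, hφ1, hφV⟩ := exists_adapted_extremal h x₀ hP ha hV
  set q := p / (p - 1) with hq
  set s := sensTerm x₀ l g P a with hs
  set V := sensitivity p x₀ l g P a with hVd
  -- shrinking the extremal function leaves room for the approximation error `η`
  set lam : ℝ := 1 - min (1 / 2) (ε / (2 * V)) with hlam
  have hm0 : 0 < min (1 / 2) (ε / (2 * V)) := by positivity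
  have hlam0 : 0 < lam := by linarith [min_le_left (1 / 2) (ε / (2 * V))]
  have hlam1 : 0 < 1 - lam := by rw [hlam]; linarith
  have hlamV : V - ε / 2 ≤ lam * V := by
    have : min (1 / 2) (ε / (2 * V)) * V ≤ ε / (2 * V) * V := by
      gcongr; exact min_le_right _ _
    rw [show ε / (2 * V) * V = ε / 2 by field_simp] at this
    rw [hlam]; linarith
  set S : ℝ := ∑ t, (∫ x, |s t x| ^ q ∂P) ^ (1 / q) with hS
  have hS0 : 0 ≤ S := Finset.sum_nonneg fun t _ =>
    Real.rpow_nonneg (integral_nonneg fun x => by positivity) _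
  obtain ⟨η, hη0, hη1, hη2⟩ : ∃ η : ℝ, 0 < η ∧ T * η ^ p ≤ (1 - lam) ^ p ∧ S * η ≤ ε / 2 := by
    have t1 : Tendsto (fun η : ℝ => (T : ℝ) * η ^ p) (𝓝[>] 0) (𝓝 (T * (0 : ℝ) ^ p)) :=
      ((Real.continuousAt_rpow_const 0 p (Or.inr (by linarith))).tendsto.mono_left
        nhdsWithin_le_nhds).const_mul _
    have t2 : Tendsto (fun η : ℝ => S * η) (𝓝[>] 0) (𝓝 (S * 0)) :=
      (tendsto_id.mono_left nhdsWithin_le_nhds).const_mul _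
    rw [Real.zero_rpow (by linarith), mul_zero] at t1
    rw [mul_zero] at t2
    have e1 := t1.eventually (gt_mem_nhds (Real.rpow_pos_of_pos hlam1 p))
    have e2 := t2.eventually (gt_mem_nhds (half_pos hε))
    obtain ⟨η, h1, h2, h3⟩ := (e1.and (e2.and self_mem_nhdsWithin)).exists
    exact ⟨η, h3, h1.le, h2.le⟩
  have hex : ∀ t : Fin T, ∃ f : Path T → ℝ, Measurable[canonFilt T ((t : ℕ) + 1)] f ∧
      (∃ K : NNReal, LipschitzWith K f) ∧ (∃ M : ℝ, ∀ x, |f x| ≤ M) ∧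
      eLpNorm ((fun x => lam * φ t x) - f) (ENNReal.ofReal p) P ≤ ENNReal.ofReal η := fun t =>
    exists_lipschitz_approx hp.le (by
      have hq : Measurable fun u : ℝ => lam * u := by fun_prop
      exact hq.comp (hφm t)) ((hφp t).const_mul lam) hη0
  choose f hfm hfK hfM hfη using hex
  choose K hK using hfK
  choose M hM using hfM
  have hdir : IsDirection (fun x t => f t x) := by
    refine ⟨hfm, ⟨∑ t, K t, ?_⟩, ⟨∑ t, |M t|, fun x => ?_⟩⟩
    · refine LipschitzWith.of_dist_le_mul fun x y => (dist_pi_le_iff (by positivity)).2 fun t => ?_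
      refine ((hK t).dist_le_mul x y).trans ?_
      gcongr
      exact Finset.single_le_sum (f := K) (fun _ _ => zero_le) (Finset.mem_univ t)
    · refine (pi_norm_le_iff_of_nonneg (Finset.sum_nonneg fun _ _ => abs_nonneg _)).2 fun t => ?_
      refine ((hM t x).trans (le_abs_self _)).trans ?_
      exact Finset.single_le_sum (f := fun t => |M t|) (fun _ _ => abs_nonneg _) (Finset.mem_univ t)
  have hfp : ∀ t, MemLp (f t) (ENNReal.ofReal p) P := fun t =>
    MemLp.of_bound ((hfm t).mono (canonFilt_le T _) le_rfl).aestronglyMeasurable (M t)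
      (Eventually.of_forall (hM t))
  have hep : ∀ t, MemLp ((fun x => lam * φ t x) - f t) (ENNReal.ofReal p) P := fun t =>
    ((hφp t).const_mul lam).sub (hfp t)
  have herr : ∀ t, ∫ x, |lam * φ t x - f t x| ^ p ∂P ≤ η ^ p := fun t => by
    have h1 := hfη t
    rw [(hep t).eLpNorm_eq_integral_rpow_norm (by simp; linarith) (by simp),
      ENNReal.toReal_ofReal (by linarith), ENNReal.ofReal_le_ofReal_iff hη0.le,
      Real.rpow_inv_le_iff_of_pos (integral_nonneg fun x => by positivity) hη0.le (by linarith)] at h1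
    exact h1
  have hint : ∀ {u : Path T → ℝ}, MemLp u (ENNReal.ofReal p) P →
      Integrable (fun x => |u x| ^ p) P := fun hu => by
    have := hu.integrable_norm_rpow (by simp; linarith) (by simp)
    rwa [ENNReal.toReal_ofReal (by linarith)] at this
  refine ⟨fun x t => f t x, hdir, ?_, ?_⟩
  · -- convexity of the power separates the extremal function from the error
    have hpt : ∀ t x, |f t x| ^ p ≤
        lam * |φ t x| ^ p + (1 - lam) ^ (1 - p) * |lam * φ t x - f t x| ^ p := by
      intro t x
      have hc := (convexOn_rpow hp.le).2 (Set.mem_Ici.2 (abs_nonneg (φ t x)))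
        (Set.mem_Ici.2 (by positivity : 0 ≤ |lam * φ t x - f t x| / (1 - lam))) hlam0.le hlam1.le
        (by ring)
      simp only [smul_eq_mul] at hc
      have h1 : |f t x| ≤ lam * |φ t x| + (1 - lam) * (|lam * φ t x - f t x| / (1 - lam)) := by
        rw [mul_div_cancel₀ _ hlam1.ne']
        have := abs_sub (lam * φ t x) (lam * φ t x - f t x)
        rw [sub_sub_cancel, abs_mul, abs_of_pos hlam0] at this
        exact this
      refine (Real.rpow_le_rpow (abs_nonneg _) h1 (by linarith)).trans (hc.trans (le_of_eq ?_))
      rw [Real.div_rpow (abs_nonneg _) hlam1.le, Real.rpow_sub hlam1, Real.rpow_one]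
      ring
    have h2 : ∀ t, ∫ x, |f t x| ^ p ∂P ≤
        lam * ∫ x, |φ t x| ^ p ∂P + (1 - lam) ^ (1 - p) * η ^ p := by
      intro t
      have i1 := (hint (hφp t)).const_mul lam
      have i2 := (hint (hep t)).const_mul ((1 - lam) ^ (1 - p))
      have := integral_mono (hint (hfp t)) (i1.add i2) (hpt t)
      rw [integral_add' i1 i2, integral_const_mul, integral_const_mul] at this
      refine this.trans ?_
      gcongr
      exact herr t
    refine (Finset.sum_le_sum fun t _ => h2 t).trans ?_
    rw [Finset.sum_add_distrib, ← Finset.mul_sum, hφ1, Finset.sum_const, Finset.card_univ,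
      Fintype.card_fin, nsmul_eq_mul]
    have h3 : (1 - lam) ^ (1 - p) * (T * η ^ p) ≤ (1 - lam) ^ (1 - p) * (1 - lam) ^ p := by
      gcongr
    rw [← Real.rpow_add hlam1, sub_add_cancel, Real.rpow_one] at h3
    linarith
  · have hsq : ∀ t, MemLp (s t) (ENNReal.ofReal q) P := h.memLp_sensTerm x₀ hP ha
    have h1 : ∀ t, lam * ∫ x, - s t x * φ t x ∂P - (∫ x, |s t x| ^ q ∂P) ^ (1 / q) * η ≤
        ∫ x, - s t x * f t x ∂P := by
      intro t
      have i1 : Integrable (fun x => - s t x * φ t x) P := (hsq t).neg.integrable_mul (hφp t)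
      have i2 : Integrable (fun x => - s t x * f t x) P := (hsq t).neg.integrable_mul (hfp t)
      have i3 : Integrable (fun x => ‖s t x‖ * ‖((fun x => lam * φ t x) - f t) x‖) P :=
        (hsq t).norm.integrable_mul (hep t).norm
      have h2 := integral_mul_norm_le_Lp_mul_Lq hpq.symm (hsq t) (hep t)
      have h3 : (∫ x, ‖((fun x => lam * φ t x) - f t) x‖ ^ p ∂P) ^ (1 / p) ≤ η := by
        rw [one_div, Real.rpow_inv_le_iff_of_pos (integral_nonneg fun x => by positivity) hη0.le
          (by linarith)]
        exact herr t
      have h4 : ∫ x, ‖s t x‖ * ‖((fun x => lam * φ t x) - f t) x‖ ∂P ≤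
          (∫ x, |s t x| ^ q ∂P) ^ (1 / q) * η := by
        refine h2.trans ?_
        refine mul_le_mul le_rfl h3 (by positivity) ?_
        exact Real.rpow_nonneg (integral_nonneg fun x => by positivity) _
      have h5 : lam * ∫ x, - s t x * φ t x ∂P ≤ ∫ x, (- s t x * f t x +
          ‖s t x‖ * ‖((fun x => lam * φ t x) - f t) x‖) ∂P := by
        rw [← integral_const_mul]
        refine integral_mono (i1.const_mul lam) (i2.add i3) fun x => ?_
        simp only [Pi.sub_apply, Real.norm_eq_abs, ← abs_mul]
        have := neg_abs_le (s t x * (lam * φ t x - f t x))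
        linarith
      rw [integral_add i2 i3] at h5
      linarith
    rw [h.dirDeriv_eq_sum x₀ hP ha hdir]
    have h2 := Finset.sum_le_sum (s := Finset.univ) fun t (_ : t ∈ Finset.univ) => h1 t
    rw [Finset.sum_sub_distrib, ← Finset.mul_sum, ← Finset.sum_mul, hφV, ← hS] at h2
    linarith

end Direction

/-! ### Stability of the directional derivative at the optimizers -/

/-- The derivative of the terminal position of the control `a` in the direction `f`. -/
def terminalDeriv (g : Path T → ℝ) (f : Path T → Path T) (a : Path T → Fin T → ℝ) (x : Path T) : ℝ :=
  fderiv ℝ g x (f x) + ∑ t, a x t * (f x t - prev 0 (f x) t)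

lemma Regular.measurable_terminalDeriv (h : Regular p L l g) {f : Path T → Path T}
    (hf : Measurable f) {a : Path T → Fin T → ℝ} (ha : a ∈ controls T L) :
    Measurable (terminalDeriv g f a) := by
  have h1 : Measurable fun x => fderiv ℝ g x (f x) :=
    ((h.cont_fderiv.comp continuous_fst).clm_apply continuous_snd).measurable.comp
      (measurable_id.prodMk hf)
  refine h1.add (Finset.measurable_sum _ fun t _ => ?_)
  exact ((measurable_pi_apply t).comp (measurable_of_mem_controls ha)).mul
    (((measurable_pi_apply t).comp hf).sub ((continuous_prev t).measurable.comp hf))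

lemma Regular.exists_abs_terminalDeriv_le (h : Regular p L l g) {f : Path T → Path T}
    (hf : IsDirection f) : ∃ A : ℝ, 0 ≤ A ∧
      ∀ a ∈ controls T L, ∀ x, |terminalDeriv g f a x| ≤ A := by
  obtain ⟨C, hC1, hC⟩ := h.exists_growth 0
  obtain ⟨M, hM⟩ := hf.bounded
  have hM0 : 0 ≤ M := (norm_nonneg _).trans (hM 0)
  refine ⟨C * M, by positivity, fun a ha x => ?_⟩
  refine ((hC (a x) x fun t => (ha t).2 x).2.2.2 (f x)).trans ?_
  gcongr
  exact hM x

lemma terminalDeriv_midpoint (f : Path T → Path T) (a b : Path T → Fin T → ℝ) (x : Path T) :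
    terminalDeriv g f (fun x t => (1 - 1 / 2) * a x t + 1 / 2 * b x t) x =
      1 / 2 * terminalDeriv g f a x + 1 / 2 * terminalDeriv g f b x := by
  simp only [terminalDeriv, add_mul, Finset.sum_add_distrib, mul_assoc, ← Finset.mul_sum]
  ring

/-- Summation by parts, as for `pathDeriv_eq_sum`. -/
lemma terminalDeriv_sub_terminalDeriv (f : Path T → Path T) (a b : Path T → Fin T → ℝ)
    (x : Path T) : terminalDeriv g f b x - terminalDeriv g f a x =
      ∑ t, ((nextControl a x t - a x t) * f x t - (nextControl b x t - b x t) * f x t) := by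
  have key : ∀ c : Path T → Fin T → ℝ, ∑ t, c x t * prev 0 (f x) t =
      ∑ t, nextControl c x t * f x t := fun c => sum_mul_prev (c x) (f x)
  simp only [terminalDeriv, mul_sub, sub_mul, Finset.sum_sub_distrib, key]
  ring

section Stability

variable {P : Measure (Path T)} {b : Path T → Fin T → ℝ} {f : Path T → Path T}

/-- With the marginal loss of one optimizer, all optimizers have the same directional derivative. -/
lemma integral_deriv_mul_terminalDeriv_eq (h : Regular p L l g) (hP : P ∈ probMeasures p T)
    (hPX : ∀ t : Fin T, P {x | x t = prev x₀ x t} = 0) {a : Path T → Fin T → ℝ}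
    (ha : IsOptimizer L x₀ l g P a) (hb : IsOptimizer L x₀ l g P b) (hf : IsDirection f) :
    ∫ x, deriv l (terminal x₀ g b x) * terminalDeriv g f a x ∂P =
      ∫ x, deriv l (terminal x₀ g b x) * terminalDeriv g f b x ∂P := by
  have hL := h.nonneg
  obtain ⟨A, -, hA⟩ := h.exists_abs_terminalDeriv_le hf
  obtain ⟨M, hM⟩ := hf.bounded
  have hfM : ∀ t x, |f x t| ≤ M := fun t x => (norm_le_pi_norm (f x) t).trans (hM x)
  have hi : ∀ c ∈ controls T L, Integrable (fun x => deriv l (terminal x₀ g b x) *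
      terminalDeriv g f c x) P := fun c hc =>
    h.integrable_deriv_mul_bdd x₀ hP hb.1 (h.measurable_terminalDeriv hf.measurable hc) (hA c hc)
  have hj : ∀ c ∈ controls T L, ∀ t, Integrable (fun x => deriv l (terminal x₀ g b x) *
      ((nextControl c x t - c x t) * f x t)) P := fun c hc t => by
    refine h.integrable_deriv_mul_bdd x₀ hP hb.1 (A := (L + L) * M) ?_ fun x => ?_
    · exact (((measurable_nextControl hc t).mono (canonFilt_le T _) le_rfl).sub
        ((hc t).1.mono (canonFilt_le T _) le_rfl)).mul ((measurable_pi_apply t).comp hf.measurable)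
    · rw [abs_mul]
      exact mul_le_mul ((abs_sub _ _).trans (add_le_add (abs_nextControl_le hL hc t x)
        ((hc t).2 x))) (hfM t x) (abs_nonneg _) (by positivity)
  have h1 : ∫ x, deriv l (terminal x₀ g b x) * terminalDeriv g f b x ∂P -
      ∫ x, deriv l (terminal x₀ g b x) * terminalDeriv g f a x ∂P = 0 := by
    rw [← integral_sub (hi b hb.1) (hi a ha.1)]
    simp only [← mul_sub, terminalDeriv_sub_terminalDeriv, Finset.mul_sum]
    simp only [mul_sub (deriv l _)]
    have hd : ∀ t, Integrable (fun x =>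
        deriv l (terminal x₀ g b x) * ((nextControl a x t - a x t) * f x t) -
          deriv l (terminal x₀ g b x) * ((nextControl b x t - b x t) * f x t)) P := fun t =>
      (hj a ha.1 t).sub (hj b hb.1 t)
    rw [integral_finsetSum _ fun t _ => hd t]
    refine Finset.sum_eq_zero fun t _ => ?_
    rw [integral_sub (hj a ha.1 t) (hj b hb.1 t),
      integral_deriv_mul_change_eq h hP hPX ha hb t (hf.adapted t) (hfM t), sub_self]
  linarith

/-- Near-optimizers have a directional derivative that is nearly at least that of an optimizer. For
the linear part this holds because near-optimizers that violate it would accumulate, almost surely,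
at an optimizer that violates it. -/
theorem exists_le_dirDeriv (h : Regular p L l g) (hP : P ∈ probMeasures p T)
    (hPX : ∀ t : Fin T, P {x | x t = prev x₀ x t} = 0) (hb : IsOptimizer L x₀ l g P b)
    (hf : IsDirection f) {ε : ℝ} (hε : 0 < ε) :
    ∃ δ : ℝ, 0 < δ ∧ ∀ a ∈ controls T L, expLoss x₀ l g P a ≤ value L x₀ l g P + δ →
      dirDeriv x₀ l g P f b - ε ≤ dirDeriv x₀ l g P f a := by
  obtain ⟨A, hA0, hA⟩ := h.exists_abs_terminalDeriv_le hf
  have hm : ∀ c ∈ controls T L, Measurable (terminalDeriv g f c) := fun c hc =>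
    h.measurable_terminalDeriv hf.measurable hc
  set Λ : (Path T → Fin T → ℝ) → ℝ := fun a =>
    ∫ x, deriv l (terminal x₀ g b x) * terminalDeriv g f a x ∂P with hΛ
  have hΛb : Λ b = dirDeriv x₀ l g P f b := rfl
  have hi : ∀ c ∈ controls T L, Integrable (fun x => deriv l (terminal x₀ g b x) *
      terminalDeriv g f c x) P := fun c hc =>
    h.integrable_deriv_mul_bdd x₀ hP hb.1 (hm c hc) (hA c hc)
  have hlin : ∃ δ : ℝ, 0 < δ ∧ ∀ a ∈ controls T L,
      expLoss x₀ l g P a ≤ value L x₀ l g P + δ → Λ b - ε / 2 ≤ Λ a := by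
    by_contra! hcon
    obtain ⟨a, ha, s, hs, hsS, hlim⟩ := exists_optimizer_of_near h x₀ hP
      (S := {a | a ∈ controls T L ∧ Λ a ≤ Λ b - ε / 2})
      (fun a ha c hc => by
        refine ⟨combo_mem_controls ha.1 hc.1 (by norm_num) (by norm_num), ?_⟩
        have e : Λ (fun x t => (1 - 1 / 2) * a x t + 1 / 2 * c x t) =
            1 / 2 * Λ a + 1 / 2 * Λ c := by
          simp only [hΛ, terminalDeriv_midpoint]
          rw [← integral_const_mul, ← integral_const_mul,
            ← integral_add ((hi a ha.1).const_mul _) ((hi c hc.1).const_mul _)]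
          refine integral_congr_ae (Eventually.of_forall fun x => ?_)
          simp only
          ring
        rw [e]
        linarith [ha.2, hc.2])
      (fun δ hδ => by
        obtain ⟨a, ha, h1, h2⟩ := hcon δ hδ
        exact ⟨a, ha, ⟨ha, h2.le⟩, h1⟩)
    have ht : Tendsto (fun n => Λ (s n)) atTop (𝓝 (Λ a)) := by
      refine tendsto_integral_of_dominated_convergence
        (fun x => |deriv l (terminal x₀ g b x)| * A) (fun n => (hi _ (hs n)).1)
        ((h.integrable_deriv x₀ hP hb.1).abs.mul_const A)
        (fun n => Eventually.of_forall fun x => ?_) ?_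
      · rw [Real.norm_eq_abs, abs_mul]
        gcongr
        exact hA _ (hs n) x
      · filter_upwards [hlim] with x hx
        refine Tendsto.const_mul _ (Tendsto.const_add _ ?_)
        exact tendsto_finsetSum _ fun t _ => (hx t).mul_const _
    have h1 : Λ a ≤ Λ b - ε / 2 := le_of_tendsto' ht fun n => (hsS n).2
    have h2 : Λ a = Λ b := integral_deriv_mul_terminalDeriv_eq h hP hPX ha hb hf
    linarith
  obtain ⟨δ₁, hδ₁, h1⟩ := hlin
  obtain ⟨δ₂, hδ₂, h2⟩ := h.exists_integral_abs_deriv_sub_le hP hb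
    (ε := ε / (2 * (A + 1))) (by positivity)
  refine ⟨min δ₁ δ₂, lt_min hδ₁ hδ₂, fun a ha hle => ?_⟩
  have h3 := h1 a ha (hle.trans (by linarith [min_le_left δ₁ δ₂]))
  have h4 := h2 a ha (hle.trans (by linarith [min_le_right δ₁ δ₂]))
  have hia : Integrable (fun x => deriv l (terminal x₀ g a x) * terminalDeriv g f a x) P :=
    h.integrable_deriv_mul_bdd x₀ hP ha (hm a ha) (hA a ha)
  have h5 : |dirDeriv x₀ l g P f a - Λ a| ≤ ε / 2 := by
    have e : dirDeriv x₀ l g P f a - Λ a = ∫ x, (deriv l (terminal x₀ g a x) -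
        deriv l (terminal x₀ g b x)) * terminalDeriv g f a x ∂P := by
      simp only [sub_mul]
      exact (integral_sub hia (hi a ha)).symm
    have i1 : Integrable (fun x => |deriv l (terminal x₀ g a x) -
        deriv l (terminal x₀ g b x)| * A) P :=
      ((h.integrable_deriv x₀ hP ha).sub (h.integrable_deriv x₀ hP hb.1)).abs.mul_const A
    have h6 := norm_integral_le_of_norm_le (f := fun x => (deriv l (terminal x₀ g a x) -
      deriv l (terminal x₀ g b x)) * terminalDeriv g f a x) i1 (Eventually.of_forall fun x => by
        rw [Real.norm_eq_abs, abs_mul]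
        gcongr
        exact hA a ha x)
    rw [← e, integral_mul_const, Real.norm_eq_abs] at h6
    refine h6.trans ?_
    have h7 : ε / (2 * (A + 1)) * A ≤ ε / 2 := by
      rw [div_mul_eq_mul_div, div_le_div_iff₀ (by positivity) (by positivity)]
      nlinarith
    exact (mul_le_mul_of_nonneg_right h4 hA0).trans h7
  linarith [(abs_le.1 h5).1]

lemma Regular.exists_abs_dirDeriv_le (h : Regular p L l g) (x₀ : ℝ) (hP : P ∈ probMeasures p T)
    (hf : IsDirection f) : ∃ D : ℝ, 0 ≤ D ∧
      ∀ a ∈ controls T L, |dirDeriv x₀ l g P f a| ≤ D := by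
  obtain ⟨C, hC0, hC⟩ := h.abs_pathDeriv_le x₀
  obtain ⟨M, hM⟩ := hf.bounded
  have hM0 : 0 ≤ M := (norm_nonneg _).trans (hM 0)
  have hp := h.one_lt
  have hPi := integrable_norm_growth (by linarith) hP
  have hint : 0 ≤ ∫ x, (1 + ‖x‖) ^ p ∂P := integral_nonneg fun x => by positivity
  refine ⟨∫ x, C * M * (1 + ‖x‖) ^ p ∂P, by rw [integral_const_mul]; positivity, fun a ha => ?_⟩
  rw [dirDeriv, ← Real.norm_eq_abs]
  refine norm_integral_le_of_norm_le (hPi.const_mul (C * M)) (Eventually.of_forall fun x => ?_)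
  have h1 : (1 + ‖x‖) ^ (p - 1) ≤ (1 + ‖x‖) ^ p :=
    Real.rpow_le_rpow_of_exponent_le (by linarith [norm_nonneg x]) (by linarith)
  calc _ ≤ C * (1 + ‖x‖) ^ (p - 1) * ‖f x‖ := hC (a x) x (f x) fun t => (ha t).2 x
    _ ≤ C * (1 + ‖x‖) ^ p * M := by gcongr; exact hM x
    _ = _ := by ring

/-! ### The lower bound of the expansion -/

/-- The expected loss of a control `c` under the shifted measure is, to first order, that of the
control `c ∘ shift r f` under `P`. -/
lemma Regular.exists_abs_expLoss_shift_sub_le (h : Regular p L l g) (x₀ : ℝ)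
    (hP : P ∈ probMeasures p T) (hf : IsDirection f) (hfp : ∑ t, ∫ x, |f x t| ^ p ∂P ≤ 1)
    {ε : ℝ} (hε : 0 < ε) : ∃ ρ : ℝ, 0 < ρ ∧ ∀ r : ℝ, 0 < r → r ≤ ρ → ∀ c ∈ controls T L,
      |expLoss x₀ l g (P.map (shift r f)) c - expLoss x₀ l g P (fun x => c (shift r f x)) -
        r * dirDeriv x₀ l g P f (fun x => c (shift r f x))| ≤ ε * r := by
  have hp := h.one_lt
  have hPp := hP.1
  obtain ⟨ρ, hρ, hrem⟩ := h.abs_integral_remainder_le x₀ hP hε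
  refine ⟨ρ, hρ, fun r hr hrρ c hc => ?_⟩
  have hs := measurable_shift_borel (r := r) hf
  have hm : Measurable fun x : Path T => (x, shift r f x) := measurable_id.prodMk hs
  have hcost := lintegral_cost_shift_le (by linarith) hr.le hf hfp
  have hcs := comp_shift_mem_controls (r := r) hf hc
  have hcm := measurable_of_mem_controls hcs
  have h1 := hrem r hr hrρ (P.map fun x => (x, shift r f x))
    (Measure.isProbabilityMeasure_map hm.aemeasurable) (isCoupling_shift hf).1
    (integrable_norm_rpow_of_cost (by linarith) hcost)
    (integral_norm_rpow_le_of_cost (by linarith) hr.le hcost)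
    (fun x => c (shift r f x)) hcm fun x t => (hcs t).2 x
  have m1 : Measurable fun z : Path T × Path T => l (wealth x₀ g (c (shift r f z.1)) z.2) :=
    h.loss.continuous.measurable.comp
      (measurable_wealth_comp h.cont_payoff (hcm.comp measurable_fst) measurable_snd)
  have m2 : Measurable fun z : Path T × Path T =>
      pathDeriv x₀ l g (c (shift r f z.1)) z.1 (z.2 - z.1) :=
    h.measurable_pathDeriv_comp (hcm.comp measurable_fst) measurable_fst
      (measurable_snd.sub measurable_fst)
  have m3 : Measurable fun x => l (terminal x₀ g c x) :=
    h.loss.continuous.measurable.comp (measurable_terminal h.cont_payoff hc)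
  have e1 : ∫ z, l (wealth x₀ g (c (shift r f z.1)) z.2) ∂(P.map fun x => (x, shift r f x)) =
      expLoss x₀ l g (P.map (shift r f)) c := by
    rw [integral_map hm.aemeasurable m1.aestronglyMeasurable, expLoss,
      integral_map hs.aemeasurable m3.aestronglyMeasurable]
    rfl
  have e2 : ∫ z, pathDeriv x₀ l g (c (shift r f z.1)) z.1 (z.2 - z.1)
      ∂(P.map fun x => (x, shift r f x)) =
      r * dirDeriv x₀ l g P f (fun x => c (shift r f x)) := by
    rw [integral_map hm.aemeasurable m2.aestronglyMeasurable, dirDeriv, ← integral_const_mul]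
    refine integral_congr_ae (Eventually.of_forall fun x => ?_)
    have : shift r f x - x = r • f x := by simp [shift]
    simp only [this, pathDeriv_eq_sum_pathGrad, Finset.mul_sum, Pi.smul_apply, smul_eq_mul]
    exact Finset.sum_congr rfl fun t _ => by ring
  rw [e1, e2] at h1
  exact h1

/-- The first-order lower bound: shifts along nearly optimal directions are nearly worst cases. -/
theorem exists_le_value (h : Regular p L l g) (hP : P ∈ probMeasures p T)
    (hPX : ∀ t : Fin T, P {x | x t = prev x₀ x t} = 0) (hb : IsOptimizer L x₀ l g P b)
    {ε : ℝ} (hε : 0 < ε) : ∃ ρ : ℝ, 0 < ρ ∧ ∀ r : ℝ, 0 < r → r < ρ → ∃ Q ∈ adaptedBall p P r,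
      value L x₀ l g P + r * sensitivity p x₀ l g P b - ε * r ≤ value L x₀ l g Q := by
  have hp := h.one_lt
  have hPp := hP.1
  set V := sensitivity p x₀ l g P b with hV
  have hV0 : 0 ≤ V := by
    rw [hV]; unfold sensitivity
    exact Real.rpow_nonneg (Finset.sum_nonneg fun t _ => integral_nonneg fun x => by positivity) _
  obtain ⟨f, hf, hfp, hfV⟩ := exists_direction h x₀ hP hb.1 (ε := ε / 3) (by positivity)
  obtain ⟨K, hK⟩ := hf.lipschitz
  obtain ⟨δ, hδ, hnear⟩ := exists_le_dirDeriv h hP hPX hb hf (ε := ε / 3) (by positivity)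
  obtain ⟨D, hD0, hD⟩ := h.exists_abs_dirDeriv_le x₀ hP hf
  obtain ⟨ρ, hρ, hexp⟩ := h.exists_abs_expLoss_shift_sub_le x₀ hP hf hfp
    (ε := ε / 3) (by positivity)
  refine ⟨min ρ (min (1 / (K + 1)) (δ / (D + V + 1))), by positivity, fun r hr hrρ => ?_⟩
  rw [lt_min_iff, lt_min_iff, lt_div_iff₀ (by positivity), lt_div_iff₀ (by positivity)] at hrρ
  obtain ⟨hr1, hr2, hr3⟩ := hrρ
  refine ⟨P.map (shift r f), shift_mem_adaptedBall (by linarith) hP hr.le hf hK (by linarith) hfp,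
    le_value h.nonneg fun c hc => ?_⟩
  have hcs := comp_shift_mem_controls (r := r) hf hc
  have h1 := (abs_le.1 (hexp r hr hr1.le c hc)).1
  -- a control that is far from optimal loses more than the gain of order `r`
  by_cases hn : expLoss x₀ l g P (fun x => c (shift r f x)) ≤ value L x₀ l g P + δ
  · have h2 := hnear _ hcs hn
    have h3 := value_le_expLoss h x₀ hP hcs
    have h4 : r * (V - ε / 3 - ε / 3) ≤ r * dirDeriv x₀ l g P f (fun x => c (shift r f x)) := by
      gcongr; linarith
    linarith
  · have h2 := (abs_le.1 (hD _ hcs)).1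
    have h4 : r * (-D) ≤ r * dirDeriv x₀ l g P f (fun x => c (shift r f x)) := by gcongr
    have h5 : 0 < r * ε := by positivity
    rw [not_le] at hn
    linarith

end Stability

end AWSens

end

theorem corollary3 (T : ℕ) (p : ℝ) (hp : 1 < p) (L : ℝ) (hL : 0 ≤ L) (x₀ : ℝ)
    (l : ℝ → ℝ) (hl : ContDiff ℝ 2 l) (hlb : BddBelow (Set.range l))
    (hlc : ∀ u, 0 < deriv (deriv l) u)
    (hlg : ∃ c : ℝ, ∀ u, |deriv l u| ≤ c * (1 + |u| ^ (p - 1)))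
    (g : AWSens.Path T → ℝ) (hg : ContDiff ℝ 1 g) (hgb : ∃ K : ℝ, ∀ x, ‖fderiv ℝ g x‖ ≤ K)
    (P : Measure (AWSens.Path T)) (hP : P ∈ AWSens.probMeasures p T)
    (hPX : ∀ t : Fin T, P {x | x t = AWSens.prev x₀ x t} = 0) :
    -- the problem and the suprema are well posed
    (∀ Q ∈ AWSens.probMeasures p T, ∀ a ∈ AWSens.controls T L,
      Integrable (fun x => l (AWSens.terminal x₀ g a x)) Q) ∧
    (∀ r : ℝ, 0 ≤ r → BddAbove (AWSens.value L x₀ l g '' AWSens.adaptedBall p P r)) ∧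
    -- an optimizer exists, and its terminal position is unique
    (∃ a, AWSens.IsOptimizer L x₀ l g P a) ∧
    (∀ a b, AWSens.IsOptimizer L x₀ l g P a → AWSens.IsOptimizer L x₀ l g P b →
      AWSens.terminal x₀ g a =ᵐ[P] AWSens.terminal x₀ g b) ∧
    -- the coefficient is well defined and gives the first-order expansion
    (∀ a, AWSens.IsOptimizer L x₀ l g P a →
      (Integrable (fun x => deriv l (AWSens.terminal x₀ g a x)) P ∧
        ∀ t : Fin T,
          Integrable (fun x => deriv l (AWSens.terminal x₀ g a x) * AWSens.partialDeriv g t x) P ∧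
          Integrable (fun x => |AWSens.sensTerm x₀ l g P a t x| ^ (p / (p - 1))) P) ∧
      (fun r : ℝ => sSup (AWSens.value L x₀ l g '' AWSens.adaptedBall p P r)
          - (AWSens.value L x₀ l g P + r * AWSens.sensitivity p x₀ l g P a))
        =o[𝓝[>] (0 : ℝ)] (fun r : ℝ => r)) := by
  have h : AWSens.Regular p L l g := ⟨hp, hL, hl, hlb, hlc, hlg, hg, hgb⟩
  refine ⟨fun Q hQ a ha => h.integrable_loss x₀ hQ ha,
    fun r hr => AWSens.bddAbove_value_adaptedBall h x₀ hP hr, AWSens.exists_isOptimizer h x₀ hP,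
    fun a b ha hb => AWSens.terminal_ae_eq_of_isOptimizer h hP ha hb, fun a ha =>
    ⟨⟨h.integrable_deriv x₀ hP ha.1, fun t => ⟨h.integrable_deriv_mul_partialDeriv x₀ hP ha.1 t,
      h.integrable_sensTerm_rpow x₀ hP ha.1 t⟩⟩, ?_⟩⟩
  refine isLittleO_iff.2 fun ε hε => ?_
  obtain ⟨ρ₁, hρ₁, h1⟩ := AWSens.exists_value_le h hP ha hε
  obtain ⟨ρ₂, hρ₂, h2⟩ := AWSens.exists_le_value h hP hPX ha hε
  filter_upwards [Ioo_mem_nhdsGT (lt_min hρ₁ hρ₂)] with r hr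
  obtain ⟨Q, hQ, hQv⟩ := h2 r hr.1 (hr.2.trans_le (min_le_right _ _))
  have h3 := le_csSup (AWSens.bddAbove_value_adaptedBall h x₀ hP hr.1.le)
    (Set.mem_image_of_mem (AWSens.value L x₀ l g) hQ)
  have h4 : sSup (AWSens.value L x₀ l g '' AWSens.adaptedBall p P r) ≤
      AWSens.value L x₀ l g P + r * AWSens.sensitivity p x₀ l g P a + ε * r := by
    refine csSup_le ⟨_, Set.mem_image_of_mem _ hQ⟩ ?_
    rintro _ ⟨Q', hQ', rfl⟩
    exact h1 r hr.1 (hr.2.trans_le (min_le_left _ _)) Q' hQ'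
  rw [Real.norm_eq_abs, Real.norm_of_nonneg hr.1.le, abs_le]
  constructor <;> linarith
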